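/- Let $d\ge 2$. For $f:\mathbb R^d\to\mathbb C$ and $t>0$ let $A_tf(x)=\int_{S^{d-1}}f(x+t\omega)\,d\sigma(\omega)$, where $\sigma$ is the normalized surface measure on $S^{d-1}$, and for $E\subset(0,\infty)$ let $M_Ef(x)=\sup_{t\in E}|A_tf(x)|$. Let $L^p(w_\alpha)$ be the $L^p$ space on $\mathbb R^d$ of the measure $|x|^\alpha\,dx$. Equip $(0,\infty)$ either with the Euclidean metric or with the metric $d_\times(s,t)=|\log_2(s/t)|$. For an interval $I\subset(0,\infty)$ let $|I|$ be its diameter, and for $\delta>0$ let $N(S,\delta)$ be the minimum number of intervals of diameter $\delta$ required to cover $S$. Let $p\in[1,2]$, $\alpha\le 0$ and $\varepsilon>0$. There is a constant $C=C(d,p,\alpha,\varepsilon)$ such that the following holds for both choices of the metric. Let $E\subset[1,2]$ be nonempty and let $A\ge1$ be such that $$\sup_{0<\delta<1}\ \sup_{\delta\le|I|\le1}N(E\cap I,\delta)\,\delta^{(d-1)(p-1)-\varepsilon}\,|I|^{\alpha+(d-1)(2-p)}\le A^p .$$ Then $\|M_E\|_{L^p(w_\alpha)\to L^p(w_\alpha)}\le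 C A$. That is, for every $f\in L^p(w_\alpha)$ the following hold: for almost every $x$ the function $\omega\mapsto f(x+t\omega)$ is $\sigma$-integrable for all $t\in E$; the function $M_Ef$ is Lebesgue measurable; and $\|M_Ef\|_{L^p(w_\alpha)}\le CA\,\|f\|_{L^p(w_\alpha)}$. -/

import Mathlib

open MeasureTheory Set
open scoped ENNReal

noncomputable section

/-- The multiplicative metric `|log₂ (s / t)|` on `(0, ∞)`. -/
def mulDist (s t : ℝ) : ℝ := |Real.logb 2 (s / t)|

/-- The entropy number `N(S, δ)` with respect to the metric `ρ` on `(0, ∞)`: the minimum number of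
intervals of `ρ`-diameter `δ` required to cover `S`. (Passing to closures, one may take the
intervals closed. The infimum is over a nonempty set whenever `δ > 0` and `S` is contained in a
compact subset of `(0, ∞)`, for both metrics used below.) -/
def entropyNumber (ρ : ℝ → ℝ → ℝ) (S : Set ℝ) (δ : ℝ) : ℕ :=
  sInf {n : ℕ | ∃ a b : Fin n → ℝ,
    (∀ i, 0 < a i ∧ a i ≤ b i ∧ ρ (a i) (b i) = δ) ∧ S ⊆ ⋃ i, Icc (a i) (b i)}

/-- The rotation invariant surface measure of the unit sphere of `ℝ^d`, normalized to have total
mass one. -/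
def sphereProb (d : ℕ) : Measure (Metric.sphere (0 : EuclideanSpace ℝ (Fin d)) 1) :=
  ((volume : Measure (EuclideanSpace ℝ (Fin d))).toSphere univ)⁻¹ •
    (volume : Measure (EuclideanSpace ℝ (Fin d))).toSphere

/-- The average `A_t f(x)` of `f` over the sphere of radius `t` centred at `x`. -/
def sphericalMean {d : ℕ} (t : ℝ) (f : EuclideanSpace ℝ (Fin d) → ℂ)
    (x : EuclideanSpace ℝ (Fin d)) : ℂ :=
  ∫ ω, f (x + t • (ω : EuclideanSpace ℝ (Fin d))) ∂(sphereProb d)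

/-- The spherical maximal function `M_E f(x) = sup_{t ∈ E} |A_t f(x)|`, with values in `[0, ∞]`. -/
def sphericalMax {d : ℕ} (E : Set ℝ) (f : EuclideanSpace ℝ (Fin d) → ℂ)
    (x : EuclideanSpace ℝ (Fin d)) : ℝ≥0∞ :=
  ⨆ t ∈ E, ‖sphericalMean t f x‖ₑ

/-- The measure `|x|^α dx` on `ℝ^d`. -/
def powerWeight (d : ℕ) (α : ℝ) : Measure (EuclideanSpace ℝ (Fin d)) :=
  volume.withDensity fun x => ENNReal.ofReal (‖x‖ ^ α)

end

/-!
Write `A_t f = f ∗ σ_t` and fix a point `x`, a scale `r` and radii `t` in an interval of length about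
`r`. The averages are split dyadically in frequency with compactly supported mollifiers `Q δ`
(`IsMollifier`): `f` is the limit of `Q (r / 2 ^ N) ∗ f`, which telescopes into the coarse part
`Q r ∗ f` and the pieces `(Q δ - Q (2 δ)) ∗ f` with `δ = r / 2 ^ j`.

For a single `δ` and radii in an interval of length `δ` there are two estimates. On `L²`, the decay
of order `(d - 1) / 2` of the Fourier transform of `σ` (`exists_sphereProfile_decay`, from the Bessel
equation) and the fundamental theorem of calculus in `t` give an operator norm squared of order
`δ ^ (d - 1)` (`lintegral_iSup_sphericalMean_smear_sq_le`). On `L¹`, the smeared averages are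
averages over shells of width `δ`, and the norm is bounded by the density `κ` in thin shells of the
region where `x` varies (`exists_lintegral_iSup_sphericalMean_smear_rpow_le`); for a ball of radius
`r` this density is `r ^ (d - 1)` (`exists_thinShells`). Interpolation (`marcinkiewicz`) gives
`κ ^ (2 - p) * δ ^ ((d - 1) * (p - 1))` on `Lᵖ`, and summing the `p`-th powers over a covering of
the set of radii by intervals of length `δ` costs the factor counted by the entropy number. The
entropy condition then leaves a factor `δ ^ ε`, so the dyadic pieces can be summed
(`exists_lintegral_sphericalMax_le`).

The weight is almost constant on dyadic shells `‖x‖ ≈ r`. If `r ≤ 1` and `t` is restricted to an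
interval of length `r / 2`, then only values of `f` in an annulus of width about `r` enter; the
annuli belonging to different intervals overlap boundedly often, the weight is bounded below on
them since `α ≤ 0`, and there is a factor `r ^ ε` to sum over the shells. If `‖x‖ ≥ 1`, only values
of `f` at comparable distance from the origin enter. This proves the inequality for continuous
functions of compact support (`exists_lintegral_weight_sphericalMax_le`).

Finally, the inequality extends to the weighted space (`MaximalBound.extend`): applied to bump
functions of small open sets it shows that null sets are negligible on almost every sphere, and
applied to the increments of an approximating sequence it shows that the means converge uniformly in
the radius, almost everywhere. For `p = 1` the entropy condition is never satisfied, since its left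
side with `|I| = 1` is at least `δ ^ (-ε)`; with `|I| = δ` it forces `α ≥ 1 - d + ε`, which makes
the weight locally integrable.
-/

notation "𝔼" d:max => EuclideanSpace ℝ (Fin d)

/-! ### The normalized surface measure of the sphere -/

section Sphere

open scoped Pointwise

variable {d : ℕ}

theorem toSphere_univ_ne_zero (hd : 2 ≤ d) :
    (volume : Measure (𝔼 d)).toSphere univ ≠ 0 := by
  have : Nonempty (Fin d) := ⟨⟨0, by omega⟩⟩
  rw [Measure.measure_univ_ne_zero]
  exact Measure.toSphere_ne_zero _

theorem isProbabilityMeasure_sphereProb (hd : 2 ≤ d) : IsProbabilityMeasure (sphereProb d) := by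
  refine ⟨?_⟩
  rw [sphereProb, Measure.smul_apply, smul_eq_mul]
  exact ENNReal.inv_mul_cancel (toSphere_univ_ne_zero hd) (measure_ne_top _ _)

theorem toSphere_eq_smul_sphereProb (hd : 2 ≤ d) :
    (volume : Measure (𝔼 d)).toSphere =
      (volume : Measure (𝔼 d)).toSphere univ • sphereProb d := by
  rw [sphereProb, smul_smul, ENNReal.mul_inv_cancel (toSphere_univ_ne_zero hd)
    (measure_ne_top _ _), one_smul]

/-- Integration in polar coordinates with respect to the normalized surface measure. -/
theorem lintegral_polar (hd : 2 ≤ d) {f : 𝔼 d → ℝ≥0∞} (hf : Measurable f) :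
    ∫⁻ x : 𝔼 d, f x = (volume : Measure (𝔼 d)).toSphere univ *
      ∫⁻ s in Ioi (0 : ℝ), ENNReal.ofReal (s ^ (d - 1)) *
        ∫⁻ ω, f (s • (ω : 𝔼 d)) ∂(sphereProb d) := by
  have : Nonempty (Fin d) := ⟨⟨0, by omega⟩⟩
  have := isProbabilityMeasure_sphereProb hd
  set c := (volume : Measure (𝔼 d)).toSphere univ
  have h1 : ∫⁻ x, f x = ∫⁻ x : ({(0 : 𝔼 d)}ᶜ : Set (𝔼 d)), f x ∂((volume : Measure (𝔼 d)).comap (↑)) := by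
    rw [lintegral_subtype_comap (measurableSet_singleton _).compl, restrict_compl_singleton]
  have h2 := (volume : Measure (𝔼 d)).measurePreserving_homeomorphUnitSphereProd.lintegral_comp_emb
    (Homeomorph.measurableEmbedding _)
    (fun z : Metric.sphere (0 : 𝔼 d) 1 × Ioi (0 : ℝ) => f ((z.2 : ℝ) • (z.1 : 𝔼 d)))
  have h3 : ∀ x : ({(0 : 𝔼 d)}ᶜ : Set (𝔼 d)),
      f (((homeomorphUnitSphereProd (𝔼 d) x).2 : ℝ) • ((homeomorphUnitSphereProd (𝔼 d) x).1 : 𝔼 d)) = f x := by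
    intro x
    have := congrArg Subtype.val ((homeomorphUnitSphereProd (𝔼 d)).symm_apply_apply x)
    rw [homeomorphUnitSphereProd_symm_apply_coe] at this
    rw [this]
  rw [h1]
  simp only [h3] at h2
  rw [h2, toSphere_eq_smul_sphereProb hd, lintegral_prod_symm' _ (by fun_prop)]
  simp only [lintegral_smul_measure, smul_eq_mul, finrank_euclideanSpace, Fintype.card_fin]
  rw [Measure.volumeIoiPow, lintegral_const_mul _ (by fun_prop), lintegral_withDensity_eq_lintegral_mul _ (by fun_prop) (by fun_prop)]
  simp only [Pi.mul_apply]
  rw [lintegral_subtype_comap measurableSet_Ioi (fun s : ℝ => ENNReal.ofReal (s ^ (d - 1)) *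
        ∫⁻ ω, f (s • (ω : 𝔼 d)) ∂(sphereProb d))]

/-- The action of a linear isometry on the unit sphere. -/
noncomputable def sphereMap (L : 𝔼 d ≃ₗᵢ[ℝ] 𝔼 d) :
    Metric.sphere (0 : 𝔼 d) 1 → Metric.sphere (0 : 𝔼 d) 1 :=
  fun ω => ⟨L ω, by simp⟩

theorem continuous_sphereMap (L : 𝔼 d ≃ₗᵢ[ℝ] 𝔼 d) :
    Continuous (sphereMap L) := by
  unfold sphereMap; fun_prop

theorem map_sphereMap_sphereProb
    (L : 𝔼 d ≃ₗᵢ[ℝ] 𝔼 d) :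
    (sphereProb d).map (sphereMap L) = sphereProb d := by
  have hL := (continuous_sphereMap L).measurable
  rw [sphereProb, Measure.map_smul]
  congr 1
  ext s hs
  rw [Measure.map_apply hL hs, Measure.toSphere_apply' _ (hL hs), Measure.toSphere_apply' _ hs]
  congr 1
  have : Ioo (0 : ℝ) 1 • ((↑) '' (sphereMap L ⁻¹' s) : Set (𝔼 d)) =
      L ⁻¹' (Ioo (0 : ℝ) 1 • ((↑) '' s)) := by
    ext x
    simp only [mem_smul, mem_image, mem_preimage]
    constructor
    · rintro ⟨a, ha, _, ⟨ω, hω, rfl⟩, rfl⟩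
      exact ⟨a, ha, _, ⟨_, hω, rfl⟩, by simp [sphereMap]⟩
    · rintro ⟨a, ha, _, ⟨ω, hω, rfl⟩, h⟩
      refine ⟨a, ha, _, ⟨sphereMap L.symm ω, ?_, rfl⟩, ?_⟩
      · have : sphereMap L (sphereMap L.symm ω) = ω := by ext1; simp [sphereMap]
        rwa [this]
      · apply L.injective; rw [← h]; simp [sphereMap]
  rw [this, L.measurePreserving.measure_preimage_emb L.toHomeomorph.measurableEmbedding]

theorem integral_sphere_comp_isometry
    (L : 𝔼 d ≃ₗᵢ[ℝ] 𝔼 d)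
    {f : 𝔼 d → ℝ} (hf : Continuous f) :
    ∫ ω : Metric.sphere (0 : 𝔼 d) 1, f (L ω) ∂(sphereProb d) =
      ∫ ω : Metric.sphere (0 : 𝔼 d) 1, f ω ∂(sphereProb d) := by
  conv_rhs => rw [← map_sphereMap_sphereProb L]
  rw [integral_map (continuous_sphereMap L).aemeasurable
    (Continuous.aestronglyMeasurable (by fun_prop))]
  rfl

/-- The part of the sphere in a ball of radius `ρ` has measure `O(ρ ^ (d - 1))`, whatever the
centre of the ball: the cone segment over it of length `ρ` sits in a ball of radius `2 * ρ`. -/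
theorem exists_sphereProb_cap_le (hd : 2 ≤ d) : ∃ C : ℝ, 0 < C ∧
    ∀ (z : 𝔼 d) (ρ : ℝ), 0 < ρ →
      sphereProb d {ω | ‖(ω : 𝔼 d) - z‖ ≤ ρ} ≤
        ENNReal.ofReal (C * ρ ^ (d - 1)) := by
  have : Nonempty (Fin d) := ⟨⟨0, by omega⟩⟩
  have := isProbabilityMeasure_sphereProb hd
  set c := (volume : Measure (𝔼 d)).toSphere univ with hc
  have hc0 : c ≠ 0 := toSphere_univ_ne_zero hd
  have hct : c ≠ ⊤ := measure_ne_top _ _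
  set v := (volume : Measure (𝔼 d)) (Metric.closedBall 0 1) with hv
  have hvt : v ≠ ⊤ := measure_closedBall_lt_top.ne
  have hv0 : v ≠ 0 := (Metric.measure_closedBall_pos _ _ one_pos).ne'
  refine ⟨(c⁻¹ * v).toReal * 2 ^ d, ?_, fun z ρ hρ => ?_⟩
  · have : 0 < (c⁻¹ * v).toReal := ENNReal.toReal_pos
      (mul_ne_zero (ENNReal.inv_ne_zero.2 hct) hv0) (ENNReal.mul_ne_top (ENNReal.inv_ne_top.2 hc0) hvt)
    positivity
  set S : Set (Metric.sphere (0 : 𝔼 d) 1) := {ω | ‖(ω : 𝔼 d) - z‖ ≤ ρ} with hS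
  have hSm : MeasurableSet S := (isClosed_le (by fun_prop) continuous_const).measurableSet
  have key : c * (ENNReal.ofReal ρ * sphereProb d S) ≤ ENNReal.ofReal ((2 * ρ) ^ d) * v := by
    calc c * (ENNReal.ofReal ρ * sphereProb d S)
        = c * ∫⁻ s in Ioo (1 : ℝ) (1 + ρ), sphereProb d S := by
          rw [setLIntegral_const, Real.volume_Ioo, add_sub_cancel_left, mul_comm (ENNReal.ofReal ρ)]
      _ ≤ c * ∫⁻ s in Ioi (0 : ℝ), ENNReal.ofReal (s ^ (d - 1)) *
          ∫⁻ ω, (Metric.closedBall z (2 * ρ)).indicator 1 (s • (ω : 𝔼 d)) ∂(sphereProb d) := by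
          refine mul_le_mul' le_rfl ?_
          rw [← lintegral_indicator measurableSet_Ioo, ← lintegral_indicator measurableSet_Ioi]
          refine lintegral_mono fun s => ?_
          by_cases hs : s ∈ Ioo (1 : ℝ) (1 + ρ)
          · have hs0 : s ∈ Ioi (0 : ℝ) := lt_trans one_pos hs.1
            rw [indicator_of_mem hs, indicator_of_mem hs0]
            have h1 : (1 : ℝ≥0∞) ≤ ENNReal.ofReal (s ^ (d - 1)) := by
              rw [ENNReal.one_le_ofReal]; exact one_le_pow₀ hs.1.le
            have h2 : sphereProb d S ≤
                ∫⁻ ω, (Metric.closedBall z (2 * ρ)).indicator 1 (s • (ω : 𝔼 d)) ∂(sphereProb d) := by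
              rw [← lintegral_indicator_one hSm]
              refine lintegral_mono fun ω => ?_
              by_cases hω : ω ∈ S
              · rw [indicator_of_mem hω, indicator_of_mem]
                · simp
                rw [Metric.mem_closedBall, dist_eq_norm]
                have e : s • (ω : 𝔼 d) - z = (s - 1) • (ω : 𝔼 d) + ((ω : 𝔼 d) - z) := by module
                rw [e]
                refine (norm_add_le _ _).trans ?_
                have hω' : ‖(ω : 𝔼 d) - z‖ ≤ ρ := hω
                rw [norm_smul, norm_eq_of_mem_sphere, mul_one, Real.norm_eq_abs,
                  abs_of_pos (by linarith [hs.1])]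
                linarith [hs.2]
              · rw [indicator_of_notMem hω]; exact zero_le
            calc sphereProb d S = 1 * sphereProb d S := (one_mul _).symm
              _ ≤ _ := mul_le_mul' h1 h2
          · rw [indicator_of_notMem hs]; exact zero_le
      _ = volume (Metric.closedBall z (2 * ρ)) := by
          rw [← lintegral_indicator_one (Metric.isClosed_closedBall.measurableSet),
            lintegral_polar hd (measurable_one.indicator Metric.isClosed_closedBall.measurableSet)]
      _ = ENNReal.ofReal ((2 * ρ) ^ d) * v := by
          rw [Measure.addHaar_closedBall' _ _ (by positivity)]; simp [hv]
  have hρ0 : ENNReal.ofReal ρ ≠ 0 := by simpa using hρ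
  calc sphereProb d S = (ENNReal.ofReal ρ)⁻¹ * (c⁻¹ * (c * (ENNReal.ofReal ρ * sphereProb d S))) := by
        rw [← mul_assoc c⁻¹, ENNReal.inv_mul_cancel hc0 hct, one_mul, ← mul_assoc,
          ENNReal.inv_mul_cancel hρ0 ENNReal.ofReal_ne_top, one_mul]
    _ ≤ (ENNReal.ofReal ρ)⁻¹ * (c⁻¹ * (ENNReal.ofReal ((2 * ρ) ^ d) * v)) := by gcongr
    _ = ENNReal.ofReal ((c⁻¹ * v).toReal * 2 ^ d * ρ ^ (d - 1)) := by
        have hd1 : d = (d - 1) + 1 := by omega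
        have e : (2 * ρ) ^ d = ρ * (2 ^ d * ρ ^ (d - 1)) := by
          rw [mul_pow]; conv_lhs => rw [hd1, pow_succ ρ]
          rw [← hd1]; ring
        rw [e, mul_assoc (c⁻¹ * v).toReal, ENNReal.ofReal_mul hρ.le,
          ENNReal.ofReal_mul ENNReal.toReal_nonneg, ENNReal.ofReal_toReal
          (ENNReal.mul_ne_top (ENNReal.inv_ne_top.2 hc0) hvt)]
        calc _ = ((ENNReal.ofReal ρ)⁻¹ * ENNReal.ofReal ρ) *
              (c⁻¹ * v * ENNReal.ofReal (2 ^ d * ρ ^ (d - 1))) := by ring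
          _ = _ := by rw [ENNReal.inv_mul_cancel hρ0 ENNReal.ofReal_ne_top, one_mul]

end Sphere

/-! ### Decay of the Fourier transform of the surface measure -/

section Decay

variable {d : ℕ}

theorem integrable_sphere (hd : 2 ≤ d) {f : 𝔼 d → ℝ} (hf : Continuous f) :
    Integrable (fun ω : Metric.sphere (0 : 𝔼 d) 1 => f ω) (sphereProb d) := by
  have := isProbabilityMeasure_sphereProb hd
  exact (hf.comp continuous_subtype_val).integrable_of_hasCompactSupport
    (HasCompactSupport.of_compactSpace _)

/-- Differentiation under the integral sign for the oscillating integrals over the sphere. -/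
theorem hasDerivAt_integral_sphere (hd : 2 ≤ d) {φ φ' : ℝ → ℝ} (hφ : ∀ x, HasDerivAt φ (φ' x) x)
    (hφ' : Continuous φ') (hb : ∀ x, |φ' x| ≤ 1) {a b c : 𝔼 d → ℝ} (ha : Continuous a)
    (hbc : Continuous b) (hc : Continuous c) (s : ℝ) :
    HasDerivAt (fun s => ∫ ω : Metric.sphere (0 : 𝔼 d) 1, c ω * φ (a ω + s * b ω) ∂(sphereProb d))
      (∫ ω : Metric.sphere (0 : 𝔼 d) 1, c ω * (b ω * φ' (a ω + s * b ω)) ∂(sphereProb d)) s := by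
  have := isProbabilityMeasure_sphereProb hd
  have hφc : Continuous φ := continuous_iff_continuousAt.2 fun x => (hφ x).continuousAt
  refine (hasDerivAt_integral_of_dominated_loc_of_deriv_le (μ := sphereProb d)
    (bound := fun ω => |c ω * b ω|) (s := univ)
    (F := fun s (ω : Metric.sphere (0 : 𝔼 d) 1) => c ω * φ (a ω + s * b ω))
    (F' := fun s (ω : Metric.sphere (0 : 𝔼 d) 1) => c ω * (b ω * φ' (a ω + s * b ω)))
    Filter.univ_mem ?_ ?_ ?_ ?_ ?_ ?_).2
  · exact Filter.Eventually.of_forall fun s =>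
      (integrable_sphere hd (f := fun ω => c ω * φ (a ω + s * b ω))
        (by fun_prop)).aestronglyMeasurable
  · exact integrable_sphere hd (f := fun ω => c ω * φ (a ω + s * b ω)) (by fun_prop)
  · exact (integrable_sphere hd (f := fun ω => c ω * (b ω * φ' (a ω + s * b ω)))
        (by fun_prop)).aestronglyMeasurable
  · refine Filter.Eventually.of_forall fun ω x _ => ?_
    rw [Real.norm_eq_abs, ← mul_assoc, abs_mul]
    exact mul_le_of_le_one_right (abs_nonneg _) (hb _)
  · exact integrable_sphere hd (f := fun ω => |c ω * b ω|) (by fun_prop)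
  · refine Filter.Eventually.of_forall fun ω x _ => ?_
    have h1 : HasDerivAt (fun s : ℝ => a ω + s * b ω) (b ω) x := by
      simpa using ((hasDerivAt_id x).mul_const (b ω)).const_add (a ω)
    have := ((hφ _).comp x h1).const_mul (c ω)
    simpa [mul_comm] using this

/-- The radial profile `g` of the Fourier transform of the normalized surface measure:
`∫ cos ⟪ω, ξ⟫ dσ(ω) = g ‖ξ‖`. -/
noncomputable def sphereProfile (d : ℕ) [NeZero d] (r : ℝ) : ℝ :=
  ∫ ω : Metric.sphere (0 : 𝔼 d) 1, Real.cos (r * (ω : 𝔼 d) 0) ∂(sphereProb d)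

/-- The derivative of `sphereProfile`. -/
noncomputable def sphereProfileDeriv (d : ℕ) [NeZero d] (r : ℝ) : ℝ :=
  -∫ ω : Metric.sphere (0 : 𝔼 d) 1, (ω : 𝔼 d) 0 * Real.sin (r * (ω : 𝔼 d) 0) ∂(sphereProb d)

variable [NeZero d]

/-- By rotation invariance the cosine transform of the surface measure is radial; a reflection moves
`ξ` to the first coordinate axis. -/
theorem integral_cos_inner (ξ : 𝔼 d) :
    ∫ ω : Metric.sphere (0 : 𝔼 d) 1, Real.cos (inner ℝ (ω : 𝔼 d) ξ) ∂(sphereProb d) =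
      sphereProfile d ‖ξ‖ := by
  set w : 𝔼 d := ‖ξ‖ • EuclideanSpace.single 0 1 with hw
  have hn : ‖ξ‖ = ‖w‖ := by simp [hw, norm_smul]
  set L : 𝔼 d ≃ₗᵢ[ℝ] 𝔼 d := (ℝ ∙ (ξ - w))ᗮ.reflection
  have hL : L ξ = w := Submodule.reflection_sub hn
  rw [sphereProfile, ← integral_sphere_comp_isometry L
    (f := fun ω => Real.cos (‖ξ‖ * ω 0)) (by fun_prop)]
  congr 1
  ext ω
  rw [← L.inner_map_map, hL, hw, inner_smul_right]
  simp [EuclideanSpace.inner_single_right]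

omit [NeZero d] in
theorem integral_sin_inner (ξ : 𝔼 d) :
    ∫ ω : Metric.sphere (0 : 𝔼 d) 1, Real.sin (inner ℝ (ω : 𝔼 d) ξ) ∂(sphereProb d) = 0 := by
  have := integral_sphere_comp_isometry (LinearIsometryEquiv.neg ℝ (E := 𝔼 d))
    (f := fun ω => Real.sin (inner ℝ ω ξ)) (by fun_prop)
  simp only [LinearIsometryEquiv.coe_neg, inner_neg_left, Real.sin_neg, integral_neg] at this
  linarith

omit [NeZero d] in
theorem abs_coord_sphere_le (ω : Metric.sphere (0 : 𝔼 d) 1) (i : Fin d) : |(ω : 𝔼 d) i| ≤ 1 := by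
  have := PiLp.norm_apply_le (ω : 𝔼 d) i
  rwa [norm_eq_of_mem_sphere, Real.norm_eq_abs] at this

theorem abs_sphereProfile_le (hd : 2 ≤ d) (r : ℝ) : |sphereProfile d r| ≤ 1 := by
  have := isProbabilityMeasure_sphereProb hd
  have := norm_integral_le_of_norm_le_const (μ := sphereProb d) (C := 1)
    (f := fun ω : Metric.sphere (0 : 𝔼 d) 1 => Real.cos (r * (ω : 𝔼 d) 0))
    (Filter.Eventually.of_forall fun ω => Real.abs_cos_le_one _)
  simpa [sphereProfile] using this

theorem abs_sphereProfileDeriv_le (hd : 2 ≤ d) (r : ℝ) : |sphereProfileDeriv d r| ≤ 1 := by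
  have := isProbabilityMeasure_sphereProb hd
  have := norm_integral_le_of_norm_le_const (μ := sphereProb d) (C := 1)
    (f := fun ω : Metric.sphere (0 : 𝔼 d) 1 => (ω : 𝔼 d) 0 * Real.sin (r * (ω : 𝔼 d) 0))
    (Filter.Eventually.of_forall fun ω => by
      rw [norm_mul]
      exact mul_le_one₀ (abs_coord_sphere_le _ _) (norm_nonneg _) (Real.abs_sin_le_one _))
  simpa [sphereProfileDeriv] using this

theorem hasDerivAt_sphereProfile (hd : 2 ≤ d) (r : ℝ) :
    HasDerivAt (sphereProfile d) (sphereProfileDeriv d r) r := by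
  have := hasDerivAt_integral_sphere hd (φ := Real.cos) (φ' := fun x => -Real.sin x)
    Real.hasDerivAt_cos (by fun_prop) (fun x => by simpa using Real.abs_sin_le_one x)
    (a := fun _ : 𝔼 d => 0) (b := fun ω => ω 0) (c := fun _ => 1) (by fun_prop) (by fun_prop)
    (by fun_prop) r
  simp only [one_mul, zero_add, mul_neg, integral_neg] at this
  exact this

/-- The radial profile satisfies the Bessel type equation `g'' + (d - 1) g' / r + g = 0`. -/
theorem hasDerivAt_sphereProfileDeriv (hd : 2 ≤ d) {r : ℝ} (hr : 0 < r) :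
    HasDerivAt (sphereProfileDeriv d)
      (-sphereProfile d r - ((d : ℝ) - 1) * sphereProfileDeriv d r / r) r := by
  have := isProbabilityMeasure_sphereProb hd
  set I : Fin d → ℝ := fun k =>
    ∫ ω : Metric.sphere (0 : 𝔼 d) 1, (ω : 𝔼 d) k * ((ω : 𝔼 d) k * Real.cos (r * (ω : 𝔼 d) 0))
      ∂(sphereProb d) with hI
  have h2 : HasDerivAt (sphereProfileDeriv d) (-I 0) r := by
    have := (hasDerivAt_integral_sphere hd (φ := Real.sin) (φ' := Real.cos)
      Real.hasDerivAt_sin (by fun_prop) Real.abs_cos_le_one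
      (a := fun _ : 𝔼 d => 0) (b := fun ω => ω 0) (c := fun ω => ω 0) (by fun_prop) (by fun_prop)
      (by fun_prop) r).neg
    simp only [zero_add] at this
    exact this
  -- Differentiate `∫ cos (r ω₀ + s ωₖ) = g (√(r² + s²))` twice in `s` at `s = 0`.
  have hk : ∀ k : Fin d, k ≠ 0 → I k = -(sphereProfileDeriv d r / r) := by
    intro k hk
    have hN : ∀ s : ℝ, ‖(r • EuclideanSpace.single 0 1 + s • EuclideanSpace.single k 1 : 𝔼 d)‖ =
        √(r ^ 2 + s ^ 2) := by
      intro s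
      rw [← Real.sqrt_sq (norm_nonneg _), norm_add_sq_real]
      congr 1
      simp [norm_smul, inner_smul_left, inner_smul_right, EuclideanSpace.inner_single_left, hk]
    have hg : ∀ s : ℝ, ∫ ω : Metric.sphere (0 : 𝔼 d) 1,
        Real.cos (r * (ω : 𝔼 d) 0 + s * (ω : 𝔼 d) k) ∂(sphereProb d) =
          sphereProfile d (√(r ^ 2 + s ^ 2)) := by
      intro s
      rw [← hN s, ← integral_cos_inner]
      simp [inner_add_right, inner_smul_right, EuclideanSpace.inner_single_right]
    have hpos : ∀ s : ℝ, 0 < r ^ 2 + s ^ 2 := fun s => by positivity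
    have hsq : ∀ s : ℝ, HasDerivAt (fun s : ℝ => √(r ^ 2 + s ^ 2)) (s / √(r ^ 2 + s ^ 2)) s := by
      intro s
      have h1 : HasDerivAt (fun s : ℝ => r ^ 2 + s ^ 2) (2 * s) s := by
        simpa using (hasDerivAt_pow 2 s).const_add (r ^ 2)
      have := h1.sqrt (hpos s).ne'
      convert this using 1
      have := Real.sqrt_pos.2 (hpos s)
      field_simp
    have hfirst : ∀ s : ℝ, -∫ ω : Metric.sphere (0 : 𝔼 d) 1,
        (ω : 𝔼 d) k * Real.sin (r * (ω : 𝔼 d) 0 + s * (ω : 𝔼 d) k) ∂(sphereProb d) =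
          sphereProfileDeriv d (√(r ^ 2 + s ^ 2)) * (s / √(r ^ 2 + s ^ 2)) := by
      intro s
      have e1 := (hasDerivAt_sphereProfile hd (√(r ^ 2 + s ^ 2))).comp s (hsq s)
      have e2 := hasDerivAt_integral_sphere hd (φ := Real.cos) (φ' := fun x => -Real.sin x)
        Real.hasDerivAt_cos (by fun_prop) (fun x => by simpa using Real.abs_sin_le_one x)
        (a := fun ω : 𝔼 d => r * ω 0) (b := fun ω => ω k) (c := fun _ => 1) (by fun_prop)
        (by fun_prop) (by fun_prop) s
      simp only [one_mul, hg, mul_neg, integral_neg] at e2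
      exact e2.unique e1
    have hr0 : √(r ^ 2 + 0 ^ 2) = r := by simp [Real.sqrt_sq hr.le]
    have e1 := (hasDerivAt_integral_sphere hd (φ := Real.sin) (φ' := Real.cos)
      Real.hasDerivAt_sin (by fun_prop) Real.abs_cos_le_one
      (a := fun ω : 𝔼 d => r * ω 0) (b := fun ω => ω k) (c := fun ω => ω k) (by fun_prop)
      (by fun_prop) (by fun_prop) 0).neg
    have e2 : HasDerivAt (fun s => sphereProfileDeriv d (√(r ^ 2 + s ^ 2)) *
        (s / √(r ^ 2 + s ^ 2))) (sphereProfileDeriv d r / r) 0 := by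
      have h2' : HasDerivAt (sphereProfileDeriv d) (-I 0) (√(r ^ 2 + 0 ^ 2)) := by rwa [hr0]
      have a1 := HasDerivAt.comp (0 : ℝ) h2' (hsq 0)
      have a2 := (hasDerivAt_id (0 : ℝ)).div (hsq 0) (by rw [hr0]; exact hr.ne')
      have := a1.mul a2
      simp only [hr0, Function.comp_apply, id] at this
      refine HasDerivAt.congr_deriv this ?_
      field_simp
      simp
      ring
    have e3 := e1.congr_of_eventuallyEq (f₁ := fun s => sphereProfileDeriv d (√(r ^ 2 + s ^ 2)) *
        (s / √(r ^ 2 + s ^ 2))) (Filter.Eventually.of_forall fun s => (hfirst s).symm)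
    have e4 := e3.unique e2
    simp only [zero_mul, add_zero] at e4
    rw [← e4, neg_neg]
  -- Since `∑ ωₖ² = 1`, the integrals `I k` add up to `g r`.
  have hsum : ∑ k, I k = sphereProfile d r := by
    rw [hI, ← integral_finsetSum _ fun k _ => integrable_sphere hd
      (f := fun ω => ω k * (ω k * Real.cos (r * ω 0))) (by fun_prop), sphereProfile]
    congr 1
    ext ω
    have h1 : ∑ i, (ω : 𝔼 d) i ^ 2 = 1 := by
      have := EuclideanSpace.real_norm_sq_eq (ω : 𝔼 d)
      rw [← this, norm_eq_of_mem_sphere, one_pow]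
    calc ∑ i, (ω : 𝔼 d) i * ((ω : 𝔼 d) i * Real.cos (r * (ω : 𝔼 d) 0))
        = (∑ i, (ω : 𝔼 d) i ^ 2) * Real.cos (r * (ω : 𝔼 d) 0) := by
          rw [Finset.sum_mul]; congr 1; ext i; ring
      _ = _ := by rw [h1, one_mul]
  rw [← Finset.add_sum_erase _ _ (Finset.mem_univ (0 : Fin d)),
    Finset.sum_congr rfl fun k hk' => hk k (Finset.ne_of_mem_erase hk'), Finset.sum_const,
    Finset.card_erase_of_mem (Finset.mem_univ _), Finset.card_univ, Fintype.card_fin,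
    nsmul_eq_mul, Nat.cast_sub (by omega), Nat.cast_one] at hsum
  convert h2 using 1
  linear_combination hsum

/-- The decay of the Fourier transform of the surface measure, from the energy
`V = r ^ (d - 1) (g ^ 2 + g' ^ 2) + (d - 1) r ^ (d - 2) g g'`, whose derivative is
`-(d - 1) r ^ (d - 3) g g' = O(V / r ^ 2)`. -/
theorem exists_sphereProfile_decay (hd : 2 ≤ d) : ∃ C : ℝ, 0 < C ∧ ∀ r : ℝ, 0 < r →
    (sphereProfile d r ^ 2 + sphereProfileDeriv d r ^ 2) * r ^ (d - 1) ≤ C := by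
  obtain ⟨n, rfl⟩ : ∃ n, d = n + 2 := ⟨d - 2, by omega⟩
  simp only [show n + 2 - 1 = n + 1 by omega]
  set g := sphereProfile (n + 2)
  set g' := sphereProfileDeriv (n + 2)
  set N : ℝ := n + 1 with hN
  have hN0 : 0 < N := by positivity
  set V : ℝ → ℝ := fun r => r ^ (n + 1) * (g r ^ 2 + g' r ^ 2) + N * (r ^ n * (g r * g' r))
  have hV : ∀ r, 0 < r → HasDerivAt V (-(N * (r ^ n * (g r * g' r) / r))) r := by
    intro r hr
    have h1 := hasDerivAt_sphereProfile hd r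
    have h2 := hasDerivAt_sphereProfileDeriv hd hr
    have h3 := (hasDerivAt_pow (n + 1) r).mul ((h1.pow 2).add (h2.pow 2))
    have h4 := ((hasDerivAt_pow n r).mul (h1.mul h2)).const_mul N
    refine (h3.add h4).congr_deriv ?_
    have e : (n : ℝ) * r ^ (n - 1) = n * (r ^ n / r) := by
      rcases n with _ | n
      · simp
      · rw [Nat.add_sub_cancel, pow_succ]; field_simp
    simp only [e, Nat.add_sub_cancel, Pi.add_apply, Pi.mul_apply, Pi.pow_apply]
    push_cast
    rw [hN]
    change _ = -((n + 1 : ℝ) * (r ^ n * (sphereProfile (n + 2) r * sphereProfileDeriv (n + 2) r) / r))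
    field_simp
    ring
  -- The mixed term of the energy is harmless for `r ≥ N = d - 1`.
  have hVlow : ∀ r, N ≤ r → r ^ (n + 1) * (g r ^ 2 + g' r ^ 2) ≤ 2 * V r := by
    intro r hr
    have hr0 : 0 < r := hN0.trans_le hr
    have h1 : |g r * g' r| ≤ (g r ^ 2 + g' r ^ 2) / 2 := by
      rw [abs_le]; constructor <;> nlinarith [sq_nonneg (g r + g' r), sq_nonneg (g r - g' r)]
    have h2 : N * (r ^ n * |g r * g' r|) ≤ r * (r ^ n * ((g r ^ 2 + g' r ^ 2) / 2)) := by gcongr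
    have h3 : -(N * (r ^ n * |g r * g' r|)) ≤ N * (r ^ n * (g r * g' r)) := by
      rw [← mul_neg, ← mul_neg]; gcongr; exact neg_abs_le _
    simp only [V]
    have : r ^ (n + 1) = r * r ^ n := by ring
    nlinarith
  -- The integrating factor `exp (N / r)` absorbs `V' = O(V / r ^ 2)`.
  set W : ℝ → ℝ := fun r => V r * Real.exp (N / r)
  have hW : ∀ r, 0 < r → HasDerivAt W
      (-(N * (r ^ n * (g r * g' r) / r)) * Real.exp (N / r) +
        V r * (Real.exp (N / r) * (-N / r ^ 2))) r := by
    intro r hr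
    have h1 : HasDerivAt (fun r : ℝ => N / r) (-N / r ^ 2) r := by
      have := (hasDerivAt_inv hr.ne').const_mul N
      simpa [div_eq_mul_inv] using this
    exact (hV r hr).mul h1.exp
  have hanti : AntitoneOn W (Ici N) := by
    refine antitoneOn_of_deriv_nonpos (convex_Ici _) ?_ ?_ ?_
    · exact fun r hr => (hW r (hN0.trans_le hr)).continuousAt.continuousWithinAt
    · rw [interior_Ici]
      exact fun r hr => (hW r (hN0.trans hr)).differentiableAt.differentiableWithinAt
    · rw [interior_Ici]
      intro r hr
      have hr0 : 0 < r := hN0.trans hr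
      rw [(hW r hr0).deriv]
      have h1 : -(g r * g' r) ≤ (g r ^ 2 + g' r ^ 2) / 2 := by
        nlinarith [sq_nonneg (g r + g' r)]
      have h2 := hVlow r (le_of_lt hr)
      have h3 : -(N * (r ^ n * (g r * g' r) / r)) ≤ N / r ^ 2 * V r := by
        calc -(N * (r ^ n * (g r * g' r) / r)) = N * (r ^ n / r) * (-(g r * g' r)) := by ring
          _ ≤ N * (r ^ n / r) * ((g r ^ 2 + g' r ^ 2) / 2) := by gcongr
          _ = N / r ^ 2 * ((r ^ (n + 1) * (g r ^ 2 + g' r ^ 2)) / 2) := by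
            field_simp
            ring
          _ ≤ N / r ^ 2 * V r := by gcongr; linarith
      have h4 : -(N * (r ^ n * (g r * g' r) / r)) * Real.exp (N / r) +
        V r * (Real.exp (N / r) * (-N / r ^ 2)) =
          (-(N * (r ^ n * (g r * g' r) / r)) - N / r ^ 2 * V r) * Real.exp (N / r) := by ring
      rw [h4]
      exact mul_nonpos_of_nonpos_of_nonneg (by linarith) (Real.exp_pos _).le
  refine ⟨2 * N ^ (n + 1) + 2 * |W N|, by positivity, fun r hr => ?_⟩
  rcases le_total r N with h | h
  · have h1 : g r ^ 2 ≤ 1 := (sq_le_one_iff_abs_le_one _).2 (abs_sphereProfile_le hd r)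
    have h2 : g' r ^ 2 ≤ 1 := (sq_le_one_iff_abs_le_one _).2 (abs_sphereProfileDeriv_le hd r)
    calc (g r ^ 2 + g' r ^ 2) * r ^ (n + 1) ≤ 2 * N ^ (n + 1) := by
          gcongr; linarith
      _ ≤ _ := by linarith [abs_nonneg (W N)]
  · have h1 := hVlow r h
    have h2 : W r ≤ W N := hanti (mem_Ici.2 le_rfl) h h
    have h3 : 0 ≤ V r := by
      have : 0 ≤ r ^ (n + 1) * (g r ^ 2 + g' r ^ 2) := by positivity
      linarith
    have h4 : V r ≤ W r := le_mul_of_one_le_right h3 (Real.one_le_exp (by positivity))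
    have : 0 < N ^ (n + 1) := by positivity
    rw [mul_comm]
    linarith [le_abs_self (W N)]

end Decay

/-! ### Plancherel's theorem on `L¹ ∩ L²` -/

section Plancherel

open scoped FourierTransform SchwartzMap ContDiff

variable {d : ℕ}

/-- The Fourier transform on `L²`, defined by extension, is given by the Fourier integral on
`L¹ ∩ L²`; both are identified as tempered distributions. -/
theorem toLp_fourier_ae_eq {f : 𝔼 d → ℂ} (hf : Integrable f) (hf2 : MemLp f 2) :
    (𝓕 (hf2.toLp f) : Lp ℂ 2 (volume : Measure (𝔼 d))) =ᵐ[volume] 𝓕 f := by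
  set F : Lp ℂ 2 (volume : Measure (𝔼 d)) := hf2.toLp f
  have hc : Continuous (𝓕 f) := VectorFourier.fourierIntegral_continuous
    Real.continuous_fourierChar continuous_inner hf
  refine ae_eq_of_integral_contDiff_smul_eq ((Lp.memLp _).locallyIntegrable (by norm_num))
    hc.locallyIntegrable fun g hg hgs => ?_
  have hgs' : HasCompactSupport (fun x => (g x : ℂ)) := hgs.comp_left (g := fun r : ℝ => (r : ℂ)) rfl
  set G : 𝓢(𝔼 d, ℂ) := hgs'.toSchwartzMap (Complex.ofRealCLM.contDiff.comp hg)
  have h1 := congrArg (fun T => T G) (Lp.fourier_toTemperedDistribution_eq F)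
  simp only [TemperedDistribution.fourier_apply, Lp.toTemperedDistribution_apply] at h1
  have h2 : ∫ x, (𝓕 G) x • F x = ∫ x, (𝓕 G) x • f x := by
    refine integral_congr_ae ?_
    filter_upwards [hf2.coeFn_toLp] with x hx
    rw [hx]
  have h3 : ∫ x, G x • (𝓕 f) x = ∫ x, (𝓕 G) x • f x := by
    have := VectorFourier.integral_fourierIntegral_smul_eq_flip (μ := (volume : Measure (𝔼 d)))
      (ν := (volume : Measure (𝔼 d))) (e := Real.fourierChar) (L := innerₗ (𝔼 d)) (f := G) (g := f)
      Real.continuous_fourierChar continuous_inner G.integrable hf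
    rw [flip_innerₗ] at this
    exact this.symm
  rw [h2, ← h3] at h1
  exact h1.symm

/-- Plancherel's theorem for the Fourier integral of a function in `L¹ ∩ L²`. -/
theorem lintegral_enorm_fourier_sq {f : 𝔼 d → ℂ} (hf : Integrable f) (hf2 : MemLp f 2) :
    ∫⁻ ξ, ‖𝓕 f ξ‖ₑ ^ 2 = ∫⁻ x, ‖f x‖ₑ ^ 2 := by
  set F : Lp ℂ 2 (volume : Measure (𝔼 d)) := hf2.toLp f
  have h1 : eLpNorm (𝓕 f) 2 volume = eLpNorm f 2 volume := by
    rw [← eLpNorm_congr_ae (toLp_fourier_ae_eq hf hf2), ← eLpNorm_congr_ae hf2.coeFn_toLp,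
      ← Lp.enorm_def, ← Lp.enorm_def, ← ofReal_norm, Lp.norm_fourier_eq,
      ofReal_norm]
  have h2 : ∀ g : 𝔼 d → ℂ, ∫⁻ x, ‖g x‖ₑ ^ 2 = eLpNorm g 2 volume ^ 2 := by
    intro g
    have := eLpNorm_nnreal_pow_eq_lintegral (f := g) (μ := volume) (p := 2) (by norm_num)
    simp only [NNReal.coe_ofNat, ENNReal.rpow_ofNat, ENNReal.coe_ofNat] at this
    exact this.symm
  rw [h2, h2, h1]

theorem lintegral_enorm_fourierInv_sq {f : 𝔼 d → ℂ} (hf : Integrable f) (hf2 : MemLp f 2) :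
    ∫⁻ x, ‖𝓕⁻ f x‖ₑ ^ 2 = ∫⁻ x, ‖f x‖ₑ ^ 2 := by
  rw [← lintegral_enorm_fourier_sq hf hf2,
    ← lintegral_neg_eq_self (μ := (volume : Measure (𝔼 d))) (fun ξ => ‖𝓕 f ξ‖ₑ ^ 2)]
  simp only [Real.fourierInv_eq_fourier_neg]

end Plancherel

/-! ### Compactly supported kernels with vanishing moments -/

section Kernel

open scoped FourierTransform SchwartzMap ContDiff

variable {d : ℕ}

theorem exists_fourier_lipschitz (φ : 𝓢(𝔼 d, ℂ)) :
    ∃ C : ℝ, 0 ≤ C ∧ ∀ ξ, ‖φ ξ - φ 0‖ ≤ C * ‖ξ‖ := by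
  obtain ⟨C, hC⟩ := φ.decay' 0 1
  refine ⟨C, ?_, fun ξ => ?_⟩
  · have := hC 0
    simp only [pow_zero, one_mul] at this
    exact (norm_nonneg _).trans this
  · have := Convex.norm_image_sub_le_of_norm_fderiv_le (𝕜 := ℝ) (f := φ) (C := C) (s := univ)
      (x := 0) (y := ξ) (fun x _ => φ.differentiableAt) (fun x _ => ?_) convex_univ
      (mem_univ _) (mem_univ _)
    · simpa using this
    · have := hC x
      rw [pow_zero, one_mul] at this
      rw [← norm_iteratedFDeriv_one]
      exact this

/-- There is a test function supported in a small ball all of whose moments of order between `1`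
and `N - 1` vanish and whose integral is one. In the induction step, `1 - 𝓕 Q` is multiplied by
`1 - 𝓕 φ` for a bump function `φ`. -/
theorem exists_kernel_vanishing_moments (N : ℕ) : ∀ ρ : ℝ, 0 < ρ → ∃ Q : 𝓢(𝔼 d, ℂ),
    (∀ x, ρ < ‖x‖ → Q x = 0) ∧ ∃ C : ℝ, 0 ≤ C ∧ ∀ ξ, ‖1 - (𝓕 Q) ξ‖ ≤ C * ‖ξ‖ ^ N := by
  induction N with
  | zero => exact fun ρ _ => ⟨0, fun _ _ => rfl, 1, zero_le_one, fun ξ => by simp⟩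
  | succ N ih =>
    intro ρ hρ
    obtain ⟨Q, hQ, C, hC0, hC⟩ := ih (ρ / 2) (by positivity)
    let b : ContDiffBump (0 : 𝔼 d) := ⟨ρ / 4, ρ / 2, by positivity, by linarith⟩
    have hbs : HasCompactSupport (fun x => ((b.normed volume x : ℝ) : ℂ)) :=
      b.hasCompactSupport_normed.comp_left (g := fun r : ℝ => (r : ℂ)) rfl
    set φ : 𝓢(𝔼 d, ℂ) := hbs.toSchwartzMap (Complex.ofRealCLM.contDiff.comp b.contDiff_normed)
      with hφ
    have hφs : ∀ x, ρ / 2 < ‖x‖ → φ x = 0 := by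
      intro x hx
      have : x ∉ Function.support (b.normed volume) := by
        rw [b.support_normed_eq, mem_ball_zero_iff]
        exact not_lt.2 hx.le
      simp only [Function.mem_support, not_not] at this
      change ((b.normed volume x : ℝ) : ℂ) = 0
      rw [this, Complex.ofReal_zero]
    have hφ0 : (𝓕 φ) 0 = 1 := by
      rw [SchwartzMap.fourier_coe, Real.fourier_eq]
      simp only [inner_zero_right, neg_zero, AddChar.map_zero_eq_one, one_smul]
      calc ∫ x, φ x = ∫ x, ((b.normed volume x : ℝ) : ℂ) := rfl
        _ = 1 := by rw [integral_complex_ofReal, b.integral_normed]; simp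
    obtain ⟨C', hC'0, hC'⟩ := exists_fourier_lipschitz (𝓕 φ)
    refine ⟨Q + φ - SchwartzMap.convolution (ContinuousLinearMap.mul ℂ ℂ) Q φ, ?_, C * C',
      by positivity, fun ξ => ?_⟩
    · intro x hx
      have h1 : (SchwartzMap.convolution (ContinuousLinearMap.mul ℂ ℂ) Q φ) x = 0 := by
        rw [SchwartzMap.convolution_apply, convolution_def]
        refine integral_eq_zero_of_ae (Filter.Eventually.of_forall fun t => ?_)
        simp only [ContinuousLinearMap.mul_apply', Pi.zero_apply, mul_eq_zero]
        by_contra! h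
        have h1 : ‖t‖ ≤ ρ / 2 := not_lt.1 fun h' => h.1 (hQ t h')
        have h2 : ‖x - t‖ ≤ ρ / 2 := not_lt.1 fun h' => h.2 (hφs _ h')
        have := norm_add_le (x - t) t
        rw [sub_add_cancel] at this
        linarith
      simp [h1, hQ x (by linarith), hφs x (by linarith)]
    · have e : (𝓕 (Q + φ - SchwartzMap.convolution (ContinuousLinearMap.mul ℂ ℂ) Q φ)) ξ =
          (𝓕 Q) ξ + (𝓕 φ) ξ - (𝓕 Q) ξ * (𝓕 φ) ξ := by
        rw [sub_eq_add_neg, FourierTransform.fourier_add, FourierTransform.fourier_add,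
          FourierTransform.fourier_neg, SchwartzMap.fourier_convolution]
        simp [sub_eq_add_neg, SchwartzMap.pairing_apply_apply]
      have e2 : 1 - (𝓕 (Q + φ - SchwartzMap.convolution (ContinuousLinearMap.mul ℂ ℂ) Q φ)) ξ =
          (1 - (𝓕 Q) ξ) * ((𝓕 φ) 0 - (𝓕 φ) ξ) := by
        rw [e, hφ0]; ring
      rw [e2, norm_mul]
      calc _ ≤ (C * ‖ξ‖ ^ N) * (C' * ‖ξ‖) := by
            gcongr
            · exact hC ξ
            · exact (norm_sub_rev _ _).trans_le (hC' ξ)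
        _ = _ := by ring

/-- The dilate `δ ^ (-d) Q (· / δ)` as a Schwartz function. -/
theorem exists_dilate (Q : 𝓢(𝔼 d, ℂ)) {δ : ℝ} (hδ : 0 < δ) : ∃ K : 𝓢(𝔼 d, ℂ),
    (∀ x, K x = ((δ ^ d)⁻¹ : ℝ) • Q (δ⁻¹ • x)) ∧ ∀ ξ, (𝓕 K) ξ = (𝓕 Q) (δ • ξ) := by
  let u : ℝˣ := Units.mk0 δ⁻¹ (inv_ne_zero hδ.ne')
  let L : 𝔼 d ≃L[ℝ] 𝔼 d := ContinuousLinearEquiv.smulLeft u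
  refine ⟨((δ ^ d)⁻¹ : ℝ) • SchwartzMap.compCLMOfContinuousLinearEquiv ℝ L Q, fun x => rfl,
    fun ξ => ?_⟩
  rw [SchwartzMap.fourier_coe, SchwartzMap.fourier_coe, Real.fourier_eq, Real.fourier_eq]
  have := Measure.integral_comp_inv_smul_of_nonneg (volume : Measure (𝔼 d))
    (fun v => Real.fourierChar (-inner ℝ v (δ • ξ)) • Q v) hδ.le
  rw [finrank_euclideanSpace, Fintype.card_fin] at this
  rw [← inv_smul_eq_iff₀ (by positivity)] at this
  rw [← this, ← integral_smul]
  refine integral_congr_ae (Filter.Eventually.of_forall fun x => ?_)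
  have h1 : inner ℝ (δ⁻¹ • x) (δ • ξ) = inner ℝ x ξ := by
    rw [inner_smul_left, inner_smul_right]
    simp; field_simp
  simp only [h1]
  rw [smul_comm]
  rfl

/-- A family of approximate identities `Q δ` at scale `δ`, supported in the ball of radius `δ`, with
enough vanishing moments that `1 - 𝓕 (Q δ) ξ = O(|δ ξ| ^ d)`. -/
structure IsMollifier (Q : ℝ → 𝓢(𝔼 d, ℂ)) (C : ℝ) : Prop where
  pos : 0 < C
  eq_zero : ∀ δ, 0 < δ → ∀ x, δ < ‖x‖ → Q δ x = 0
  norm_le : ∀ δ, 0 < δ → ∀ x, ‖Q δ x‖ ≤ C / δ ^ d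
  fourier_zero : ∀ δ, 0 < δ → (𝓕 (Q δ)) 0 = 1
  norm_one_sub_fourier : ∀ δ, 0 < δ → ∀ ξ, ‖1 - (𝓕 (Q δ)) ξ‖ ≤ C * (δ * ‖ξ‖) ^ d
  norm_fourier : ∀ δ, 0 < δ → ∀ ξ, ‖(𝓕 (Q δ)) ξ‖ ≤ C
  norm_fourier_mul : ∀ δ, 0 < δ → ∀ ξ, δ * ‖ξ‖ * ‖(𝓕 (Q δ)) ξ‖ ≤ C

theorem exists_isMollifier (hd : 2 ≤ d) :
    ∃ (Q : ℝ → 𝓢(𝔼 d, ℂ)) (C : ℝ), IsMollifier Q C := by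
  obtain ⟨Q, hQ, C, hC0, hC⟩ := exists_kernel_vanishing_moments (d := d) d 1 one_pos
  obtain ⟨C1, h1⟩ := Q.decay' 0 0
  obtain ⟨C2, h2⟩ := (𝓕 Q).decay' 0 0
  obtain ⟨C3, h3⟩ := (𝓕 Q).decay' 1 0
  have hQb : ∀ x, ‖Q x‖ ≤ C1 := fun x => by
    have := h1 x; rwa [pow_zero, one_mul, norm_iteratedFDeriv_zero] at this
  have hFb : ∀ x, ‖(𝓕 Q) x‖ ≤ C2 := fun x => by
    have := h2 x; rwa [pow_zero, one_mul, norm_iteratedFDeriv_zero] at this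
  have hF1 : ∀ x, ‖x‖ * ‖(𝓕 Q) x‖ ≤ C3 := fun x => by
    have := h3 x; rwa [pow_one, norm_iteratedFDeriv_zero] at this
  have e1 : 0 ≤ C1 := (norm_nonneg _).trans (hQb 0)
  have e2 : 0 ≤ C2 := (norm_nonneg _).trans (hFb 0)
  have e3 : 0 ≤ C3 := (by positivity : (0 : ℝ) ≤ _).trans (hF1 0)
  have hex : ∀ δ : ℝ, ∃ K : 𝓢(𝔼 d, ℂ), 0 < δ → (∀ x, K x = ((δ ^ d)⁻¹ : ℝ) • Q (δ⁻¹ • x)) ∧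
      ∀ ξ, (𝓕 K) ξ = (𝓕 Q) (δ • ξ) := by
    intro δ
    by_cases hδ : 0 < δ
    · obtain ⟨K, hK⟩ := exists_dilate Q hδ
      exact ⟨K, fun _ => hK⟩
    · exact ⟨0, fun h => absurd h hδ⟩
  choose K hK using hex
  have hn : ∀ δ : ℝ, 0 < δ → ∀ ξ : 𝔼 d, ‖δ • ξ‖ = δ * ‖ξ‖ := fun δ hδ ξ => by
    rw [norm_smul, Real.norm_eq_abs, abs_of_pos hδ]
  refine ⟨K, C + C1 + C2 + C3 + 1, by positivity, fun δ hδ x hx => ?_, fun δ hδ x => ?_,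
    fun δ hδ => ?_, fun δ hδ ξ => ?_, fun δ hδ ξ => ?_, fun δ hδ ξ => ?_⟩
  · rw [(hK δ hδ).1, hQ, smul_zero]
    rw [hn _ (inv_pos.2 hδ)]
    rw [← div_eq_inv_mul, one_lt_div hδ]; exact hx
  · rw [(hK δ hδ).1, norm_smul, Real.norm_eq_abs, abs_of_pos (by positivity), div_eq_inv_mul]
    gcongr
    exact (hQb _).trans (by linarith)
  · rw [(hK δ hδ).2, smul_zero]
    have := hC 0
    rw [norm_zero, zero_pow (by omega), mul_zero, norm_le_zero_iff, sub_eq_zero] at this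
    exact this.symm
  · rw [(hK δ hδ).2, ← hn δ hδ]
    refine (hC _).trans ?_
    gcongr; linarith
  · rw [(hK δ hδ).2]
    exact (hFb _).trans (by linarith)
  · rw [(hK δ hδ).2, ← hn δ hδ]
    exact (hF1 _).trans (by linarith)

/-- The difference kernel `Q δ - Q (2 δ)` lives at frequencies of size about `1 / δ`: for small
frequencies the vanishing moments are used, for large ones the decay of `𝓕 Q`. The power `d - 1` on
the right is what the decay of the surface measure compensates. -/
theorem IsMollifier.norm_fourier_sub_sq_le {Q : ℝ → 𝓢(𝔼 d, ℂ)} {C : ℝ} (hd : 2 ≤ d)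
    (hQ : IsMollifier Q C) {δ : ℝ} (hδ : 0 < δ) (ξ : 𝔼 d) :
    (1 + (δ * ‖ξ‖) ^ 2) * ‖(𝓕 (Q δ - Q (2 * δ))) ξ‖ ^ 2 ≤
      2 * (C * (1 + 2 ^ d)) ^ 2 * (δ * ‖ξ‖) ^ (d - 1) := by
  have hC := hQ.pos
  have e : (𝓕 (Q δ - Q (2 * δ))) ξ = (𝓕 (Q δ)) ξ - (𝓕 (Q (2 * δ))) ξ := by
    rw [sub_eq_add_neg, FourierTransform.fourier_add, FourierTransform.fourier_neg]
    simp [sub_eq_add_neg]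
  have hδ2 : 0 < 2 * δ := by positivity
  have b1 := hQ.norm_one_sub_fourier δ hδ ξ
  have b2 := hQ.norm_one_sub_fourier (2 * δ) hδ2 ξ
  have b3 := hQ.norm_fourier δ hδ ξ
  have b4 := hQ.norm_fourier (2 * δ) hδ2 ξ
  have b5 := hQ.norm_fourier_mul δ hδ ξ
  have b6 := hQ.norm_fourier_mul (2 * δ) hδ2 ξ
  rw [e]
  rw [mul_assoc 2 δ] at b2 b6
  generalize (𝓕 (Q δ)) ξ = u at *
  generalize (𝓕 (Q (2 * δ))) ξ = v at *
  set z := δ * ‖ξ‖ with hz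
  have hz0 : 0 ≤ z := by positivity
  have h2d : (4 : ℝ) ≤ 2 ^ d := by
    calc (4 : ℝ) = 2 ^ 2 := by norm_num
      _ ≤ 2 ^ d := pow_le_pow_right₀ (by norm_num) hd
  have hC4 : C * 4 ≤ C * 2 ^ d := by gcongr
  rcases le_total z 1 with h | h
  · have h1 : ‖u - v‖ ≤ C * (1 + 2 ^ d) * z ^ d := by
      calc ‖u - v‖ = ‖(1 - v) - (1 - u)‖ := by congr 1; ring
        _ ≤ C * (2 * z) ^ d + C * z ^ d := (norm_sub_le _ _).trans (add_le_add b2 b1)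
        _ = _ := by rw [mul_pow 2]; ring
    have hz2 : 1 + z ^ 2 ≤ 2 := by nlinarith
    calc (1 + z ^ 2) * ‖u - v‖ ^ 2
        ≤ 2 * (C * (1 + 2 ^ d) * z ^ d) ^ 2 := by gcongr
      _ = 2 * (C * (1 + 2 ^ d)) ^ 2 * z ^ (2 * d) := by ring
      _ ≤ _ := by
          gcongr 2 * _ * ?_
          exact pow_le_pow_of_le_one hz0 h (by omega)
  · have h1 : ‖u - v‖ ≤ C * (1 + 2 ^ d) := by
      refine (norm_sub_le _ _).trans ((add_le_add b3 b4).trans ?_)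
      linarith
    have h2 : z * ‖u - v‖ ≤ C * (1 + 2 ^ d) := by
      calc _ ≤ z * (‖u‖ + ‖v‖) := by gcongr; exact norm_sub_le _ _
        _ = z * ‖u‖ + (2 * z * ‖v‖) / 2 := by ring
        _ ≤ C + C / 2 := by gcongr
        _ ≤ _ := by linarith
    calc (1 + z ^ 2) * ‖u - v‖ ^ 2 = ‖u - v‖ ^ 2 + (z * ‖u - v‖) ^ 2 := by ring
      _ ≤ (C * (1 + 2 ^ d)) ^ 2 + (C * (1 + 2 ^ d)) ^ 2 := by gcongr
      _ = 2 * (C * (1 + 2 ^ d)) ^ 2 * 1 := by ring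
      _ ≤ _ := by
          gcongr 2 * _ * ?_
          exact one_le_pow₀ h

end Kernel

/-! ### The local `L²` maximal estimate for frequency localized averages -/

section LTwo

open scoped FourierTransform SchwartzMap Convolution

variable {d : ℕ}

/-- The convolution of `f` with a Schwartz kernel. -/
noncomputable def smear (K : 𝓢(𝔼 d, ℂ)) (f : 𝔼 d → ℂ) : 𝔼 d → ℂ :=
  f ⋆[ContinuousLinearMap.mul ℂ ℂ, volume] K

theorem smear_apply (K : 𝓢(𝔼 d, ℂ)) (f : 𝔼 d → ℂ) (x : 𝔼 d) :
    smear K f x = ∫ y, f y * K (x - y) := by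
  simp [smear, convolution_def]

theorem schwartz_bddAbove_range_norm (K : 𝓢(𝔼 d, ℂ)) : BddAbove (range fun x => ‖K x‖) :=
  ⟨SchwartzMap.seminorm ℝ 0 0 K, fun _ ⟨y, hy⟩ => hy ▸ SchwartzMap.norm_le_seminorm ℝ K y⟩

theorem continuous_smear (K : 𝓢(𝔼 d, ℂ)) {f : 𝔼 d → ℂ} (hf : Integrable f) :
    Continuous (smear K f) :=
  BddAbove.continuous_convolution_right_of_integrable _ (schwartz_bddAbove_range_norm K) hf
    K.continuous

theorem continuous_fourier_of_integrable {f : 𝔼 d → ℂ} (hf : Integrable f) : Continuous (𝓕 f) :=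
  VectorFourier.fourierIntegral_continuous Real.continuous_fourierChar continuous_inner hf

theorem norm_fourier_le_integral_norm (f : 𝔼 d → ℂ) (ξ : 𝔼 d) : ‖𝓕 f ξ‖ ≤ ∫ x, ‖f x‖ :=
  VectorFourier.norm_fourierIntegral_le_integral_norm _ _ _ _ _

theorem integrable_schwartz_mul {K : 𝓢(𝔼 d, ℂ)} {f : 𝔼 d → ℂ} (hf : Integrable f) :
    Integrable fun ξ => K ξ * 𝓕 f ξ :=
  K.integrable.mul_bdd (continuous_fourier_of_integrable hf).aestronglyMeasurable
    (Filter.Eventually.of_forall (norm_fourier_le_integral_norm f))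

theorem smear_eq_fourierInv (K : 𝓢(𝔼 d, ℂ)) {f : 𝔼 d → ℂ} (hf : Integrable f) :
    smear K f = 𝓕⁻ (fun ξ => (𝓕 K) ξ * 𝓕 f ξ) := by
  have h1 : 𝓕 (smear K f) = fun ξ => (𝓕 K) ξ * 𝓕 f ξ := by
    ext ξ
    rw [smear, Real.fourier_mul_convolution_eq hf K.integrable, mul_comm, SchwartzMap.fourier_coe]
  rw [← h1, Continuous.fourierInv_fourier_eq (continuous_smear K hf)
    (hf.integrable_convolution _ K.integrable)]
  rw [h1]
  exact integrable_schwartz_mul hf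

/-- The average of a character over a sphere. The sine part vanishes by symmetry. -/
theorem integral_sphere_fourierChar [NeZero d] (hd : 2 ≤ d) (ξ x : 𝔼 d) (t : ℝ) (ht : 0 ≤ t) :
    ∫ ω : Metric.sphere (0 : 𝔼 d) 1, ((Real.fourierChar (inner ℝ ξ (x + t • (ω : 𝔼 d))) : Circle) : ℂ)
      ∂(sphereProb d) =
      (Real.fourierChar (inner ℝ ξ x) : ℂ) * (sphereProfile d (2 * Real.pi * t * ‖ξ‖) : ℂ) := by
  have := isProbabilityMeasure_sphereProb hd
  set η : 𝔼 d := (2 * Real.pi * t) • ξ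
  have hη : ‖η‖ = 2 * Real.pi * t * ‖ξ‖ := by
    rw [norm_smul, Real.norm_eq_abs, abs_of_nonneg (by positivity)]
  have h1 : ∀ ω : Metric.sphere (0 : 𝔼 d) 1,
      ((Real.fourierChar (inner ℝ ξ (x + t • (ω : 𝔼 d))) : Circle) : ℂ) =
      (Real.fourierChar (inner ℝ ξ x) : ℂ) * ((Real.cos (inner ℝ (ω : 𝔼 d) η) : ℂ) +
        (Real.sin (inner ℝ (ω : 𝔼 d) η) : ℂ) * Complex.I) := by
    intro ω
    rw [inner_add_right, AddChar.map_add_eq_mul, Circle.coe_mul]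
    congr 1
    rw [Real.fourierChar_apply, Complex.ofReal_cos, Complex.ofReal_sin, ← Complex.exp_mul_I,
      inner_smul_right, inner_smul_right, real_inner_comm]
    congr 3
    ring
  simp only [h1]
  rw [integral_const_mul, integral_add, integral_mul_const, integral_complex_ofReal,
    integral_complex_ofReal, integral_cos_inner, integral_sin_inner, hη]
  · simp
  · exact (integrable_sphere hd (f := fun ω => Real.cos (inner ℝ ω η)) (by fun_prop)).ofReal
  · exact ((integrable_sphere hd (f := fun ω => Real.sin (inner ℝ ω η)) (by fun_prop)).ofReal).mul_const _

/-- The Fourier multiplier form of a spherical mean. -/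
theorem sphericalMean_smear [NeZero d] (hd : 2 ≤ d) (K : 𝓢(𝔼 d, ℂ)) {f : 𝔼 d → ℂ}
    (hf : Integrable f) {t : ℝ} (ht : 0 ≤ t) (x : 𝔼 d) :
    sphericalMean t (smear K f) x =
      𝓕⁻ (fun ξ => (sphereProfile d (2 * Real.pi * t * ‖ξ‖) : ℂ) * ((𝓕 K) ξ * 𝓕 f ξ)) x := by
  have := isProbabilityMeasure_sphereProb hd
  have hfc := continuous_fourier_of_integrable hf
  have hKc : Continuous (𝓕 K : 𝓢(𝔼 d, ℂ)) := (𝓕 K).continuous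
  have hG := integrable_schwartz_mul (K := 𝓕 K) hf
  rw [sphericalMean, smear_eq_fourierInv K hf, Real.fourierInv_eq]
  simp only [Real.fourierInv_eq]
  rw [integral_integral_swap]
  · refine integral_congr_ae (Filter.Eventually.of_forall fun ξ => ?_)
    simp only [Circle.smul_def, smul_eq_mul]
    rw [integral_mul_const, integral_sphere_fourierChar hd ξ x t ht]
    ring
  · have h1 : Integrable (fun z : Metric.sphere (0 : 𝔼 d) 1 × 𝔼 d => (𝓕 K) z.2 * 𝓕 f z.2)
        ((sphereProb d).prod volume) := hG.comp_snd _
    refine h1.mono (Continuous.aestronglyMeasurable ?_) (Filter.Eventually.of_forall fun z => ?_)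
    · unfold Function.uncurry
      have := Real.continuous_fourierChar
      fun_prop
    · simp [Function.uncurry]

/-- The Fourier multiplier form of the radial derivative of a spherical mean. -/
noncomputable def smearDeriv [NeZero d] (K : 𝓢(𝔼 d, ℂ)) (f : 𝔼 d → ℂ) (s : ℝ) (x : 𝔼 d) : ℂ :=
  𝓕⁻ (fun ξ => ((2 * Real.pi * ‖ξ‖ * sphereProfileDeriv d (2 * Real.pi * s * ‖ξ‖) : ℝ) : ℂ) *
    ((𝓕 K) ξ * 𝓕 f ξ)) x

theorem continuous_sphereProfile [NeZero d] (hd : 2 ≤ d) : Continuous (sphereProfile d) :=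
  continuous_iff_continuousAt.2 fun r => (hasDerivAt_sphereProfile hd r).continuousAt

theorem continuous_sphereProfileDeriv [NeZero d] (hd : 2 ≤ d) :
    Continuous (sphereProfileDeriv d) := by
  refine continuous_iff_continuousAt.2 fun r => ?_
  exact (hasDerivAt_integral_sphere hd (φ := Real.sin) (φ' := Real.cos)
    Real.hasDerivAt_sin (by fun_prop) Real.abs_cos_le_one
    (a := fun _ : 𝔼 d => 0) (b := fun ω => ω 0) (c := fun ω => ω 0) (by fun_prop) (by fun_prop)
    (by fun_prop) r).neg.continuousAt.congr (Filter.Eventually.of_forall fun s => by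
      simp [sphereProfileDeriv])

theorem integrable_norm_mul_schwartz (K : 𝓢(𝔼 d, ℂ)) {f : 𝔼 d → ℂ} (hf : Integrable f) :
    Integrable fun ξ => ‖ξ‖ * ‖K ξ * 𝓕 f ξ‖ := by
  have h1 : Integrable fun ξ => ‖ξ‖ ^ 1 * ‖K ξ‖ := K.integrable_pow_mul volume 1
  have := h1.mul_bdd (g := fun ξ => ‖𝓕 f ξ‖) (c := ∫ x, ‖f x‖)
    (continuous_fourier_of_integrable hf).norm.aestronglyMeasurable
    (Filter.Eventually.of_forall fun ξ => by
      simpa using norm_fourier_le_integral_norm f ξ)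
  simpa [mul_assoc] using this

theorem sphericalMean_smear_sub [NeZero d] (hd : 2 ≤ d) (K : 𝓢(𝔼 d, ℂ)) {f : 𝔼 d → ℂ}
    (hf : Integrable f) {t₀ t : ℝ} (ht₀ : 0 ≤ t₀) (ht : 0 ≤ t) (x : 𝔼 d) :
    sphericalMean t (smear K f) x - sphericalMean t₀ (smear K f) x =
      ∫ s in t₀..t, smearDeriv K f s x := by
  have hfc := continuous_fourier_of_integrable hf
  have hKc : Continuous (𝓕 K : 𝓢(𝔼 d, ℂ)) := (𝓕 K).continuous
  have hG := integrable_schwartz_mul (K := 𝓕 K) hf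
  have hgc := continuous_sphereProfile hd
  have hgc' := continuous_sphereProfileDeriv hd
  have hec := Real.continuous_fourierChar
  have hint : ∀ t : ℝ, Integrable fun ξ : 𝔼 d => Real.fourierChar (inner ℝ ξ x) •
      ((sphereProfile d (2 * Real.pi * t * ‖ξ‖) : ℂ) * ((𝓕 K) ξ * 𝓕 f ξ)) := by
    intro t
    refine hG.mono (Continuous.aestronglyMeasurable (by fun_prop))
      (Filter.Eventually.of_forall fun ξ => ?_)
    rw [Circle.norm_smul, norm_mul]
    refine mul_le_of_le_one_left (norm_nonneg _) ?_
    rw [Complex.norm_real]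
    exact abs_sphereProfile_le hd _
  rw [sphericalMean_smear hd K hf ht, sphericalMean_smear hd K hf ht₀, Real.fourierInv_eq,
    Real.fourierInv_eq, ← integral_sub (hint t) (hint t₀)]
  simp only [smearDeriv, Real.fourierInv_eq]
  rw [intervalIntegral_integral_swap]
  · refine integral_congr_ae (Filter.Eventually.of_forall fun ξ => ?_)
    simp only [Circle.smul_def, smul_eq_mul]
    rw [intervalIntegral.integral_const_mul, intervalIntegral.integral_mul_const,
      intervalIntegral.integral_ofReal]
    have : ∫ s in t₀..t, 2 * Real.pi * ‖ξ‖ * sphereProfileDeriv d (2 * Real.pi * s * ‖ξ‖) =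
        sphereProfile d (2 * Real.pi * t * ‖ξ‖) - sphereProfile d (2 * Real.pi * t₀ * ‖ξ‖) := by
      refine intervalIntegral.integral_eq_sub_of_hasDerivAt (f := fun s =>
        sphereProfile d (2 * Real.pi * s * ‖ξ‖)) (fun s _ => ?_)
        (Continuous.intervalIntegrable (by fun_prop) _ _)
      have h1 : HasDerivAt (fun s : ℝ => 2 * Real.pi * s * ‖ξ‖) (2 * Real.pi * ‖ξ‖) s := by
        simpa using ((hasDerivAt_id s).const_mul (2 * Real.pi)).mul_const ‖ξ‖
      exact ((hasDerivAt_sphereProfile hd (2 * Real.pi * s * ‖ξ‖)).comp s h1).congr_deriv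
        (mul_comm _ _)
    rw [this]
    push_cast
    ring
  · have h1 := (integrable_norm_mul_schwartz (𝓕 K) hf).const_mul (2 * Real.pi)
    have : IsFiniteMeasure (volume.restrict (uIoc t₀ t)) := ⟨by simp [uIoc]⟩
    have h2 : Integrable (fun z : ℝ × 𝔼 d => 2 * Real.pi * (‖z.2‖ * ‖(𝓕 K) z.2 * 𝓕 f z.2‖))
        ((volume.restrict (uIoc t₀ t)).prod volume) := h1.comp_snd _
    refine h2.mono (Continuous.aestronglyMeasurable ?_) (Filter.Eventually.of_forall fun z => ?_)
    · unfold Function.uncurry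
      fun_prop
    · simp only [Function.uncurry, Circle.norm_smul, norm_mul, Complex.norm_real, Real.norm_eq_abs,
        abs_norm, abs_two, abs_of_pos Real.pi_pos]
      have := abs_sphereProfileDeriv_le hd (2 * Real.pi * z.1 * ‖z.2‖)
      calc _ = (2 * Real.pi * ‖z.2‖ * (‖(𝓕 K) z.2‖ * ‖𝓕 f z.2‖)) *
            |sphereProfileDeriv d (2 * Real.pi * z.1 * ‖z.2‖)| := by ring
        _ ≤ (2 * Real.pi * ‖z.2‖ * (‖(𝓕 K) z.2‖ * ‖𝓕 f z.2‖)) * 1 := by gcongr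
        _ = _ := by ring

theorem stronglyMeasurable_smearDeriv [NeZero d] (hd : 2 ≤ d) (K : 𝓢(𝔼 d, ℂ)) {f : 𝔼 d → ℂ}
    (hf : Integrable f) : StronglyMeasurable (fun z : ℝ × 𝔼 d => smearDeriv K f z.1 z.2) := by
  have hfc := continuous_fourier_of_integrable hf
  have hKc : Continuous (𝓕 K : 𝓢(𝔼 d, ℂ)) := (𝓕 K).continuous
  have hgc' := continuous_sphereProfileDeriv hd
  have hec := Real.continuous_fourierChar
  have hc : Continuous (fun w : (ℝ × 𝔼 d) × 𝔼 d =>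
      Real.fourierChar (inner ℝ w.2 w.1.2) • (((2 * Real.pi * ‖w.2‖ * sphereProfileDeriv d
        (2 * Real.pi * w.1.1 * ‖w.2‖) : ℝ) : ℂ) * ((𝓕 K) w.2 * 𝓕 f w.2))) := by
    fun_prop
  have := hc.stronglyMeasurable.integral_prod_right' (ν := (volume : Measure (𝔼 d)))
  have e : (fun z : ℝ × 𝔼 d => smearDeriv K f z.1 z.2) = _ :=
    funext fun z => Real.fourierInv_eq _ _
  rw [e]
  exact this

/-- Jensen's inequality for a finite measure that need not be normalized. -/
theorem lintegral_rpow_le_measure_univ_rpow_mul {X : Type*} [MeasurableSpace X] (ν : Measure X)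
    {p : ℝ} (hp : 1 ≤ p) {h : X → ℝ≥0∞} (hh : AEMeasurable h ν) :
    (∫⁻ x, h x ∂ν) ^ p ≤ ν univ ^ (p - 1) * ∫⁻ x, h x ^ p ∂ν := by
  have hp0 : 0 < p := by linarith
  have h1 := eLpNorm'_le_eLpNorm'_mul_rpow_measure_univ (μ := ν) one_pos hp
    hh.aestronglyMeasurable
  simp only [eLpNorm', enorm_eq_self, ENNReal.rpow_one, one_div_one] at h1
  calc (∫⁻ x, h x ∂ν) ^ p ≤ ((∫⁻ x, h x ^ p ∂ν) ^ (1 / p) * ν univ ^ (1 - 1 / p)) ^ p := by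
        gcongr
    _ = ν univ ^ (p - 1) * ∫⁻ x, h x ^ p ∂ν := by
        rw [ENNReal.mul_rpow_of_nonneg _ _ hp0.le, ← ENNReal.rpow_mul, ← ENNReal.rpow_mul,
          one_div_mul_cancel hp0.ne', ENNReal.rpow_one, mul_comm]
        congr 2
        field_simp

/-- The `L²` bound for a Fourier multiplier, split as `m * G` with `m * G` bounded. -/
theorem lintegral_enorm_fourierInv_mul_sq_le {m G F : 𝔼 d → ℂ} (hm : Continuous m)
    (hG : Continuous G) (hF : Continuous F) (hint : Integrable fun ξ => m ξ * (G ξ * F ξ))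
    {B : ℝ} (hB : ∀ ξ, ‖m ξ‖ ^ 2 * ‖G ξ‖ ^ 2 ≤ B) (hF2 : ∫⁻ ξ, ‖F ξ‖ₑ ^ 2 < ⊤) :
    ∫⁻ x, ‖𝓕⁻ (fun ξ => m ξ * (G ξ * F ξ)) x‖ₑ ^ 2 ≤
      ENNReal.ofReal B * ∫⁻ ξ, ‖F ξ‖ₑ ^ 2 := by
  have hle : ∫⁻ ξ, ‖m ξ * (G ξ * F ξ)‖ₑ ^ 2 ≤ ENNReal.ofReal B * ∫⁻ ξ, ‖F ξ‖ₑ ^ 2 := by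
    rw [← lintegral_const_mul _ (by fun_prop)]
    refine lintegral_mono fun ξ => ?_
    rw [← mul_assoc, enorm_mul, mul_pow]
    gcongr
    rw [← ofReal_norm, ← ENNReal.ofReal_pow (norm_nonneg _), norm_mul, mul_pow]
    exact ENNReal.ofReal_le_ofReal (hB ξ)
  have h2 : MemLp (fun ξ => m ξ * (G ξ * F ξ)) 2 := by
    refine ⟨Continuous.aestronglyMeasurable (by fun_prop), ?_⟩
    rw [eLpNorm_lt_top_iff_lintegral_rpow_enorm_lt_top (by norm_num) (by norm_num)]
    simp only [ENNReal.toReal_ofNat, ENNReal.rpow_ofNat]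
    exact hle.trans_lt (ENNReal.mul_lt_top ENNReal.ofReal_lt_top hF2)
  rw [lintegral_enorm_fourierInv_sq hint h2]
  exact hle

/-- The `L²` bound for the maximal function over a set of radii of diameter `O(δ)`, when the kernel
`K` is such that averaging over spheres maps `K * f` to `L²` with norm `√B` and each radial
derivative costs at most `δ⁻¹`. The supremum is controlled by the fundamental theorem of
calculus. -/
theorem lintegral_iSup_sphericalMean_smear_sq_le [NeZero d] (hd : 2 ≤ d) (K : 𝓢(𝔼 d, ℂ))
    {f : 𝔼 d → ℂ} (hf : Integrable f) (hf2 : MemLp f 2) {δ B : ℝ} (hδ : 0 < δ)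
    (hB1 : ∀ t ∈ Icc (1 : ℝ) 2, ∀ ξ,
      sphereProfile d (2 * Real.pi * t * ‖ξ‖) ^ 2 * ‖(𝓕 K) ξ‖ ^ 2 ≤ B)
    (hB2 : ∀ t ∈ Icc (1 : ℝ) 2, ∀ ξ,
      (2 * Real.pi * ‖ξ‖ * sphereProfileDeriv d (2 * Real.pi * t * ‖ξ‖)) ^ 2 * ‖(𝓕 K) ξ‖ ^ 2 ≤
        B / δ ^ 2)
    {P : Set ℝ} {t₀ : ℝ} (ht₀ : t₀ ∈ Icc (1 : ℝ) 2)
    (hP : ∀ t ∈ P, t ∈ Icc (1 : ℝ) 2 ∧ |t - t₀| ≤ 2 * δ) :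
    ∫⁻ x, (⨆ t ∈ P, ‖sphericalMean t (smear K f) x‖ₑ) ^ 2 ≤
      ENNReal.ofReal (34 * B) * ∫⁻ x, ‖f x‖ₑ ^ 2 := by
  have hfc := continuous_fourier_of_integrable hf
  have hKc : Continuous (𝓕 K : 𝓢(𝔼 d, ℂ)) := (𝓕 K).continuous
  have hG := integrable_schwartz_mul (K := 𝓕 K) hf
  have hgc := continuous_sphereProfile hd
  have hgc' := continuous_sphereProfileDeriv hd
  have hec := Real.continuous_fourierChar
  set I : ℝ≥0∞ := ∫⁻ x, ‖f x‖ₑ ^ 2 with hI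
  have hF2 : ∫⁻ ξ, ‖𝓕 f ξ‖ₑ ^ 2 = I := lintegral_enorm_fourier_sq hf hf2
  have hIt : I < ⊤ := by
    have := (eLpNorm_lt_top_iff_lintegral_rpow_enorm_lt_top (by norm_num) (by norm_num)).1 hf2.2
    simpa using this
  set S : Set ℝ := Icc (1 : ℝ) 2 ∩ Icc (t₀ - 2 * δ) (t₀ + 2 * δ) with hS
  have hSm : MeasurableSet S := measurableSet_Icc.inter measurableSet_Icc
  have hSv : volume S ≤ ENNReal.ofReal (4 * δ) := by
    refine (measure_mono inter_subset_right).trans_eq ?_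
    rw [Real.volume_Icc]; congr 1; ring
  have hvmeas := (stronglyMeasurable_smearDeriv hd K hf).enorm
  have hu : ∫⁻ x, ‖sphericalMean t₀ (smear K f) x‖ₑ ^ 2 ≤ ENNReal.ofReal B * I := by
    have ht0 : 0 ≤ t₀ := zero_le_one.trans ht₀.1
    simp only [sphericalMean_smear hd K hf ht0]
    rw [← hF2]
    refine lintegral_enorm_fourierInv_mul_sq_le
      (m := fun ξ => (sphereProfile d (2 * Real.pi * t₀ * ‖ξ‖) : ℂ)) (G := (𝓕 K : 𝓢(𝔼 d, ℂ)))
      (F := 𝓕 f) (by fun_prop) hKc hfc ?_ ?_ (hF2.trans_lt hIt)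
    · refine hG.mono (Continuous.aestronglyMeasurable (by fun_prop))
        (Filter.Eventually.of_forall fun ξ => ?_)
      rw [norm_mul]
      refine mul_le_of_le_one_left (norm_nonneg _) ?_
      rw [Complex.norm_real]
      exact abs_sphereProfile_le hd _
    · intro ξ
      rw [Complex.norm_real, Real.norm_eq_abs, sq_abs]
      exact hB1 t₀ ht₀ ξ
  have hv : ∀ s ∈ S, ∫⁻ x, ‖smearDeriv K f s x‖ₑ ^ 2 ≤ ENNReal.ofReal (B / δ ^ 2) * I := by
    intro s hs
    rw [← hF2]
    refine lintegral_enorm_fourierInv_mul_sq_le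
      (m := fun ξ => ((2 * Real.pi * ‖ξ‖ *
        sphereProfileDeriv d (2 * Real.pi * s * ‖ξ‖) : ℝ) : ℂ)) (G := (𝓕 K : 𝓢(𝔼 d, ℂ)))
      (F := 𝓕 f) (by fun_prop) hKc hfc ?_ ?_ (hF2.trans_lt hIt)
    · refine ((integrable_norm_mul_schwartz (𝓕 K) hf).const_mul (2 * Real.pi)).mono
        (Continuous.aestronglyMeasurable (by fun_prop)) (Filter.Eventually.of_forall fun ξ => ?_)
      simp only [norm_mul, Complex.norm_real, Real.norm_eq_abs, abs_norm, abs_two,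
        abs_of_pos Real.pi_pos]
      have := abs_sphereProfileDeriv_le hd (2 * Real.pi * s * ‖ξ‖)
      calc _ = (2 * Real.pi * ‖ξ‖ * (‖(𝓕 K) ξ‖ * ‖𝓕 f ξ‖)) *
            |sphereProfileDeriv d (2 * Real.pi * s * ‖ξ‖)| := by ring
        _ ≤ (2 * Real.pi * ‖ξ‖ * (‖(𝓕 K) ξ‖ * ‖𝓕 f ξ‖)) * 1 := by gcongr
        _ = _ := by ring
    · intro ξ
      rw [Complex.norm_real, Real.norm_eq_abs, sq_abs]
      exact hB2 s hs.1 ξ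
  have hpt : ∀ x, (⨆ t ∈ P, ‖sphericalMean t (smear K f) x‖ₑ) ≤
      ‖sphericalMean t₀ (smear K f) x‖ₑ + ∫⁻ s in S, ‖smearDeriv K f s x‖ₑ := by
    intro x
    refine iSup₂_le fun t ht => ?_
    have h1 := sphericalMean_smear_sub hd K hf (zero_le_one.trans ht₀.1)
      (zero_le_one.trans (hP t ht).1.1) x
    have h2 : sphericalMean t (smear K f) x = sphericalMean t₀ (smear K f) x +
        ∫ s in t₀..t, smearDeriv K f s x := by rw [← h1]; ring
    rw [h2]
    refine (enorm_add_le _ _).trans ?_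
    gcongr
    have h3 : ‖∫ s in t₀..t, smearDeriv K f s x‖ₑ = ‖∫ s in uIoc t₀ t, smearDeriv K f s x‖ₑ := by
      rw [← ofReal_norm, ← ofReal_norm, intervalIntegral.norm_intervalIntegral_eq]
    rw [h3]
    refine (enorm_integral_le_lintegral_enorm _).trans (lintegral_mono_set fun s hs => ?_)
    have ha := abs_le.1 (hP t ht).2
    obtain ⟨⟨a1, a2⟩, -⟩ := hP t ht
    obtain ⟨b1, b2⟩ := ht₀
    rcases le_total t₀ t with h | h
    · rw [uIoc_of_le h] at hs
      exact ⟨⟨by linarith [hs.1], by linarith [hs.2]⟩, by linarith [hs.1], by linarith [hs.2]⟩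
    · rw [uIoc_of_ge h] at hs
      exact ⟨⟨by linarith [hs.1], by linarith [hs.2]⟩, by linarith [hs.1], by linarith [hs.2]⟩
  have hsq : ∀ a b : ℝ≥0∞, (a + b) ^ 2 ≤ 2 * a ^ 2 + 2 * b ^ 2 := by
    intro a b
    have := ENNReal.rpow_add_le_mul_rpow_add_rpow a b (p := 2) (by norm_num)
    simp only [ENNReal.rpow_ofNat] at this
    norm_num at this
    rwa [mul_add] at this
  calc ∫⁻ x, (⨆ t ∈ P, ‖sphericalMean t (smear K f) x‖ₑ) ^ 2
      ≤ ∫⁻ x, (2 * ‖sphericalMean t₀ (smear K f) x‖ₑ ^ 2 +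
          2 * (ENNReal.ofReal (4 * δ) * ∫⁻ s in S, ‖smearDeriv K f s x‖ₑ ^ 2)) := by
        refine lintegral_mono fun x => ?_
        refine (pow_le_pow_left' (hpt x) 2).trans ((hsq _ _).trans ?_)
        gcongr
        have := lintegral_rpow_le_measure_univ_rpow_mul (volume.restrict S) (p := 2) (by norm_num)
          (h := fun s => ‖smearDeriv K f s x‖ₑ)
          (hvmeas.comp (measurable_id.prodMk measurable_const)).aemeasurable
        norm_num at this
        exact this.trans (by gcongr)
    _ = 2 * (∫⁻ x, ‖sphericalMean t₀ (smear K f) x‖ₑ ^ 2) + 2 * (ENNReal.ofReal (4 * δ) *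
          ∫⁻ s in S, ∫⁻ x, ‖smearDeriv K f s x‖ₑ ^ 2) := by
        have hm : Measurable fun x => ∫⁻ s in S, ‖smearDeriv K f s x‖ₑ ^ 2 :=
          Measurable.lintegral_prod_left' (f := fun z : ℝ × 𝔼 d => ‖smearDeriv K f z.1 z.2‖ₑ ^ 2)
            (hvmeas.pow_const 2)
        rw [lintegral_add_right _ ((hm.const_mul _).const_mul _), lintegral_const_mul' _ _ (by simp),
          lintegral_const_mul' _ _ (by simp), lintegral_const_mul' _ _ ENNReal.ofReal_ne_top,
          lintegral_lintegral_swap (hvmeas.comp measurable_swap |>.pow_const 2).aemeasurable]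
    _ ≤ 2 * (ENNReal.ofReal B * I) + 2 * (ENNReal.ofReal (4 * δ) *
          ∫⁻ s in S, ENNReal.ofReal (B / δ ^ 2) * I) := by
        gcongr 2 * ?_ + 2 * (_ * ?_)
        exact setLIntegral_mono measurable_const hv
    _ ≤ 2 * (ENNReal.ofReal B * I) + 2 * (ENNReal.ofReal (4 * δ) *
          (ENNReal.ofReal (B / δ ^ 2) * I * ENNReal.ofReal (4 * δ))) := by
        rw [setLIntegral_const]
        gcongr
    _ = ENNReal.ofReal (34 * B) * I := by
        have hB0 : 0 ≤ B := (by positivity : (0 : ℝ) ≤ _).trans (hB1 t₀ ht₀ 0)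
        have e : 34 * B = 2 * B + 2 * (4 * δ * (B / δ ^ 2 * (4 * δ))) := by field_simp; ring
        rw [e]
        have hD : 0 ≤ 4 * δ := by positivity
        have hB' : 0 ≤ B / δ ^ 2 := by positivity
        generalize 4 * δ = D at hD
        generalize B / δ ^ 2 = B' at hB'
        rw [ENNReal.ofReal_add (by positivity) (by positivity), ENNReal.ofReal_mul (by norm_num),
          ENNReal.ofReal_mul (by norm_num), ENNReal.ofReal_mul hD, ENNReal.ofReal_mul hB',
          ENNReal.ofReal_ofNat]
        ring

end LTwo

/-! ### Pointwise and integral bounds through thin spherical shells -/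

section Shell

open scoped FourierTransform SchwartzMap Convolution

variable {d : ℕ}

/-- The closed spherical shell of radius `t` and half-width `w` about `x`. -/
def shell (x : 𝔼 d) (t w : ℝ) : Set (𝔼 d) := {y | |‖x - y‖ - t| ≤ w}

theorem measurableSet_shell (x : 𝔼 d) (t w : ℝ) : MeasurableSet (shell x t w) :=
  (isClosed_le (by fun_prop) continuous_const).measurableSet

theorem measurableSet_shell_prod (t w : ℝ) :
    MeasurableSet {z : 𝔼 d × 𝔼 d | z.2 ∈ shell z.1 t w} :=
  (isClosed_le (by fun_prop) continuous_const :
    IsClosed {z : 𝔼 d × 𝔼 d | |‖z.1 - z.2‖ - t| ≤ w}).measurableSet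

theorem mem_shell_comm {x y : 𝔼 d} {t w : ℝ} : y ∈ shell x t w ↔ x ∈ shell y t w := by
  simp only [shell, mem_ofPred_eq, norm_sub_rev]

/-- Averages over spheres of a function smeared at scale `δ` are controlled by averages over shells
of width `δ`: for fixed `y`, the kernel only sees a cap of the sphere of radius about `δ`, whose
measure `δ ^ (d - 1)` beats the height `δ ^ (-d)` of the kernel up to a factor `δ ^ (-1)`. -/
theorem exists_enorm_sphericalMean_smear_le (hd : 2 ≤ d) : ∃ C : ℝ, 0 < C ∧
    ∀ (K : 𝓢(𝔼 d, ℂ)) (δ M : ℝ), 0 < δ → 0 ≤ M → (∀ x, 2 * δ < ‖x‖ → K x = 0) →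
      (∀ x, ‖K x‖ ≤ M / δ ^ d) → ∀ f : 𝔼 d → ℂ, AEStronglyMeasurable f volume →
      ∀ t : ℝ, 1 ≤ t → ∀ x, ‖sphericalMean t (smear K f) x‖ₑ ≤
        ENNReal.ofReal (C * M / δ) * ∫⁻ y in shell x t (2 * δ), ‖f y‖ₑ := by
  have := isProbabilityMeasure_sphereProb hd
  obtain ⟨C, hC, hcap⟩ := exists_sphereProb_cap_le hd
  refine ⟨C * 2 ^ (d - 1), by positivity, fun K δ M hδ hM hK hKM f hf t ht x => ?_⟩
  have ht0 : 0 < t := by linarith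
  have hKc := K.continuous
  have key : ∀ y, ∫⁻ ω, ‖K (x + t • (ω : 𝔼 d) - y)‖ₑ ∂(sphereProb d) ≤
      (shell x t (2 * δ)).indicator (fun _ => ENNReal.ofReal (C * 2 ^ (d - 1) * M / δ)) y := by
    intro y
    by_cases hy : y ∈ shell x t (2 * δ)
    · rw [indicator_of_mem hy]
      calc ∫⁻ ω, ‖K (x + t • (ω : 𝔼 d) - y)‖ₑ ∂(sphereProb d)
          ≤ ∫⁻ ω, {ω : Metric.sphere (0 : 𝔼 d) 1 | ‖(ω : 𝔼 d) - t⁻¹ • (y - x)‖ ≤ 2 * δ}.indicator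
              (fun _ => ENNReal.ofReal (M / δ ^ d)) ω ∂(sphereProb d) := by
            refine lintegral_mono fun ω => ?_
            by_cases h : ‖(ω : 𝔼 d) - t⁻¹ • (y - x)‖ ≤ 2 * δ
            · rw [indicator_of_mem (s := {ω : Metric.sphere (0 : 𝔼 d) 1 |
                ‖(ω : 𝔼 d) - t⁻¹ • (y - x)‖ ≤ 2 * δ}) h, ← ofReal_norm]
              exact ENNReal.ofReal_le_ofReal (hKM _)
            · rw [hK, enorm_zero]
              · exact zero_le
              have e : x + t • (ω : 𝔼 d) - y = t • ((ω : 𝔼 d) - t⁻¹ • (y - x)) := by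
                rw [smul_sub, smul_inv_smul₀ ht0.ne']; abel
              rw [e, norm_smul, Real.norm_eq_abs, abs_of_pos ht0]
              have := not_le.1 h
              nlinarith [norm_nonneg ((ω : 𝔼 d) - t⁻¹ • (y - x))]
        _ ≤ ENNReal.ofReal (M / δ ^ d) * ENNReal.ofReal (C * (2 * δ) ^ (d - 1)) := by
            rw [lintegral_indicator_const
              (isClosed_le (by fun_prop) continuous_const).measurableSet]
            gcongr
            exact hcap _ _ (by positivity)
        _ = ENNReal.ofReal (C * 2 ^ (d - 1) * M / δ) := by
            rw [← ENNReal.ofReal_mul (by positivity)]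
            congr 1
            obtain ⟨n, rfl⟩ : ∃ n, d = n + 1 := ⟨d - 1, by omega⟩
            rw [Nat.add_sub_cancel]
            field_simp
            ring
    · rw [indicator_of_notMem hy]
      refine le_of_eq ((lintegral_congr fun ω => ?_).trans lintegral_zero)
      rw [hK, enorm_zero]
      by_contra h
      refine hy ?_
      have h' := not_lt.1 h
      have e : x + t • (ω : 𝔼 d) - y = (x - y) - (-(t • (ω : 𝔼 d))) := by abel
      have hn : ‖(-(t • (ω : 𝔼 d)))‖ = t := by
        rw [norm_neg, norm_smul, norm_eq_of_mem_sphere, Real.norm_eq_abs, abs_of_pos ht0, mul_one]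
      have := abs_norm_sub_norm_le (x - y) (-(t • (ω : 𝔼 d)))
      rw [hn, ← e] at this
      exact this.trans h'
  calc ‖sphericalMean t (smear K f) x‖ₑ
      ≤ ∫⁻ ω, ‖smear K f (x + t • (ω : 𝔼 d))‖ₑ ∂(sphereProb d) :=
        enorm_integral_le_lintegral_enorm _
    _ ≤ ∫⁻ ω : Metric.sphere (0 : 𝔼 d) 1, (∫⁻ y : 𝔼 d, ‖f y‖ₑ * ‖K (x + t • (ω : 𝔼 d) - y)‖ₑ)
          ∂(sphereProb d) := by
        refine lintegral_mono fun ω => ?_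
        rw [smear_apply]
        refine (enorm_integral_le_lintegral_enorm _).trans (le_of_eq ?_)
        simp only [enorm_mul]
    _ = ∫⁻ y, ‖f y‖ₑ * ∫⁻ ω, ‖K (x + t • (ω : 𝔼 d) - y)‖ₑ ∂(sphereProb d) := by
        rw [lintegral_lintegral_swap]
        · refine lintegral_congr fun y => ?_
          rw [lintegral_const_mul' _ _ enorm_ne_top]
        · refine AEMeasurable.mul (hf.enorm.comp_snd) (Measurable.aemeasurable ?_)
          exact (by fun_prop : Continuous (fun z : Metric.sphere (0 : 𝔼 d) 1 × 𝔼 d =>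
            ‖K (x + t • (z.1 : 𝔼 d) - z.2)‖ₑ)).measurable
    _ ≤ ∫⁻ y, ‖f y‖ₑ * (shell x t (2 * δ)).indicator
          (fun _ => ENNReal.ofReal (C * 2 ^ (d - 1) * M / δ)) y := by
        gcongr with y
        exact key y
    _ = ENNReal.ofReal (C * 2 ^ (d - 1) * M / δ) * ∫⁻ y in shell x t (2 * δ), ‖f y‖ₑ := by
        rw [← lintegral_const_mul' _ _ ENNReal.ofReal_ne_top,
          ← lintegral_indicator (measurableSet_shell _ _ _)]
        refine lintegral_congr fun y => ?_
        by_cases hy : y ∈ shell x t (2 * δ)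
        · rw [indicator_of_mem hy, indicator_of_mem hy, mul_comm]
        · rw [indicator_of_notMem hy, indicator_of_notMem hy, mul_zero]

/-- The region `G` meets every shell of radius between `1` and `2` and of half-width `w` in a set of
measure at most `κ * w`. The upper limit `8` for `w` is large enough for all later shells. -/
def ThinShells (G : Set (𝔼 d)) (κ : ℝ) : Prop :=
  ∀ y : 𝔼 d, ∀ c ∈ Icc (1 : ℝ) 2, ∀ w ∈ Ioc (0 : ℝ) 8,
    volume (G ∩ shell y c w) ≤ ENNReal.ofReal (κ * w)

/-- The volume of a shell inside `G` in polar coordinates about the centre of the shell. -/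
theorem volume_inter_shell_le (hd : 2 ≤ d) {G : Set (𝔼 d)} (hG : MeasurableSet G) (y : 𝔼 d)
    {c w : ℝ} {κ : ℝ≥0∞}
    (hκ : ∀ s : ℝ, 0 < s → s ≤ c + w → ENNReal.ofReal (s ^ (d - 1)) *
      sphereProb d {ω | y + s • (ω : 𝔼 d) ∈ G} ≤ κ) :
    volume (G ∩ shell y c w) ≤ (volume : Measure (𝔼 d)).toSphere univ *
      (κ * ENNReal.ofReal (2 * w)) := by
  have hm : MeasurableSet (G ∩ shell y c w) := hG.inter (measurableSet_shell _ _ _)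
  rw [← lintegral_indicator_one hm, ← lintegral_add_left_eq_self _ y,
    lintegral_polar hd (f := fun z => (G ∩ shell y c w).indicator 1 (y + z))
      ((measurable_one.indicator hm).comp (measurable_const_add y))]
  gcongr
  calc _ ≤ ∫⁻ s in Icc (c - w) (c + w), κ := by
        rw [← lintegral_indicator measurableSet_Ioi, ← lintegral_indicator measurableSet_Icc]
        refine lintegral_mono fun s => ?_
        by_cases hs0 : s ∈ Ioi (0 : ℝ)
        swap; · rw [indicator_of_notMem hs0]; exact zero_le
        rw [indicator_of_mem hs0]
        have hn : ∀ ω : Metric.sphere (0 : 𝔼 d) 1, ‖y - (y + s • (ω : 𝔼 d))‖ = s := by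
          intro ω
          rw [sub_add_cancel_left, norm_neg, norm_smul, norm_eq_of_mem_sphere, mul_one,
            Real.norm_eq_abs, abs_of_pos hs0]
        by_cases hs : s ∈ Icc (c - w) (c + w)
        · rw [indicator_of_mem hs]
          refine le_trans ?_ (hκ s hs0 hs.2)
          gcongr
          have hA : MeasurableSet {ω : Metric.sphere (0 : 𝔼 d) 1 | y + s • (ω : 𝔼 d) ∈ G} :=
            hG.preimage (by fun_prop : Measurable fun ω : Metric.sphere (0 : 𝔼 d) 1 =>
              y + s • (ω : 𝔼 d))
          rw [← lintegral_indicator_one hA]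
          refine lintegral_mono fun ω => ?_
          by_cases h : y + s • (ω : 𝔼 d) ∈ G ∩ shell y c w
          · rw [indicator_of_mem h, indicator_of_mem
              (s := {ω : Metric.sphere (0 : 𝔼 d) 1 | y + s • (ω : 𝔼 d) ∈ G}) h.1]
            simp
          · rw [indicator_of_notMem h]; exact zero_le
        · rw [indicator_of_notMem hs]
          refine le_of_eq (mul_eq_zero_of_right _ ?_)
          rw [lintegral_eq_zero_iff]
          · refine Filter.Eventually.of_forall fun ω => indicator_of_notMem (fun h => hs ?_) _
            have := h.2
            simp only [shell, mem_ofPred_eq, hn, abs_le] at this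
            exact ⟨by linarith, by linarith⟩
          · exact ((measurable_one.indicator hm).comp (measurable_const_add y)).comp (by fun_prop)
    _ = κ * ENNReal.ofReal (2 * w) := by
        rw [setLIntegral_const, Real.volume_Icc]; congr 2; ring

/-- The whole space has bounded density in thin shells; a ball of radius `2 * r` has density
`r ^ (d - 1)`, because it meets a sphere of radius `s` in a cap of angular size `r / s`. -/
theorem exists_thinShells (hd : 2 ≤ d) : ∃ C : ℝ, 0 < C ∧ ThinShells (univ : Set (𝔼 d)) C ∧
    ∀ r : ℝ, 0 < r → ThinShells (Metric.closedBall (0 : 𝔼 d) (2 * r)) (C * r ^ (d - 1)) := by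
  have := isProbabilityMeasure_sphereProb hd
  obtain ⟨C, hC, hcap⟩ := exists_sphereProb_cap_le hd
  have hct : (volume : Measure (𝔼 d)).toSphere univ ≠ ⊤ := measure_ne_top _ _
  set b := ((volume : Measure (𝔼 d)).toSphere univ).toReal with hb
  have hbe : (volume : Measure (𝔼 d)).toSphere univ = ENNReal.ofReal b :=
    (ENNReal.ofReal_toReal hct).symm
  have hb0 : 0 ≤ b := ENNReal.toReal_nonneg
  set D : ℝ := b * (10 ^ (d - 1) + C * 2 ^ (d - 1)) * 2 + 1
  have hD1 : b * (10 ^ (d - 1) * 2) ≤ D := by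
    have : 0 ≤ b * (C * 2 ^ (d - 1)) * 2 := by positivity
    simp only [D]; nlinarith
  have hD2 : b * (C * 2 ^ (d - 1) * 2) ≤ D := by
    have : 0 ≤ b * 10 ^ (d - 1) * 2 := by positivity
    simp only [D]; nlinarith
  refine ⟨D, by positivity, fun y c hc w hw => ?_, fun r hr y c hc w hw => ?_⟩
  · refine (volume_inter_shell_le hd MeasurableSet.univ y (κ := ENNReal.ofReal (10 ^ (d - 1)))
      fun s hs hs' => ?_).trans ?_
    · simp only [mem_univ, ofPred_true, measure_univ, mul_one]
      refine ENNReal.ofReal_le_ofReal (pow_le_pow_left₀ hs.le ?_ _)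
      linarith [hc.2, hw.2]
    · rw [hbe, ← ENNReal.ofReal_mul (by positivity), ← ENNReal.ofReal_mul hb0]
      refine ENNReal.ofReal_le_ofReal ?_
      have := mul_le_mul_of_nonneg_right hD1 hw.1.le
      linarith
  · refine (volume_inter_shell_le hd Metric.isClosed_closedBall.measurableSet y
      (κ := ENNReal.ofReal (C * (2 * r) ^ (d - 1))) fun s hs _ => ?_).trans ?_
    · have e : {ω : Metric.sphere (0 : 𝔼 d) 1 | y + s • (ω : 𝔼 d) ∈
          Metric.closedBall (0 : 𝔼 d) (2 * r)} ⊆ {ω | ‖(ω : 𝔼 d) - (-s⁻¹ • y)‖ ≤ 2 * r / s} := by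
        intro ω h
        rw [mem_ofPred_eq, mem_closedBall_zero_iff] at h
        have e : y + s • (ω : 𝔼 d) = s • ((ω : 𝔼 d) - (-s⁻¹ • y)) := by
          rw [neg_smul, sub_neg_eq_add, smul_add, smul_inv_smul₀ hs.ne', add_comm]
        rw [e, norm_smul, Real.norm_eq_abs, abs_of_pos hs] at h
        rw [mem_ofPred_eq, le_div_iff₀ hs, mul_comm]
        exact h
      calc _ ≤ ENNReal.ofReal (s ^ (d - 1)) * ENNReal.ofReal (C * (2 * r / s) ^ (d - 1)) := by
            gcongr
            exact (measure_mono e).trans (hcap _ _ (by positivity))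
        _ = _ := by
            rw [← ENNReal.ofReal_mul (by positivity)]
            congr 1
            rw [div_pow]
            field_simp
    · rw [hbe, ← ENNReal.ofReal_mul (by positivity), ← ENNReal.ofReal_mul hb0]
      refine ENNReal.ofReal_le_ofReal ?_
      have := mul_le_mul_of_nonneg_right hD2 (by have := hw.1; positivity : 0 ≤ r ^ (d - 1) * w)
      rw [mul_pow]
      linarith

/-- Fubini's theorem for the symmetric relation of lying in a shell about each other. -/
theorem lintegral_lintegral_shell (G : Set (𝔼 d)) (t w : ℝ) {g : 𝔼 d → ℝ≥0∞}
    (hg : AEMeasurable g) :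
    ∫⁻ x in G, ∫⁻ y in shell x t w, g y = ∫⁻ y, g y * volume (G ∩ shell y t w) := by
  have h1 : ∀ x, ∫⁻ y in shell x t w, g y = ∫⁻ y, (shell x t w).indicator g y := fun x =>
    (lintegral_indicator (measurableSet_shell _ _ _) _).symm
  simp only [h1]
  have hmeas : AEMeasurable (Function.uncurry fun x y => (shell x t w).indicator g y)
      ((volume.restrict G).prod volume) := by
    have := (hg.comp_snd (μ := volume.restrict G)).indicator (measurableSet_shell_prod t w)
    exact this
  rw [lintegral_lintegral_swap hmeas]
  refine lintegral_congr fun y => ?_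
  have h2 : ∀ x, (shell x t w).indicator g y = (shell y t w).indicator (fun _ => g y) x := by
    intro x
    by_cases h : x ∈ shell y t w
    · rw [indicator_of_mem h, indicator_of_mem (mem_shell_comm.1 h)]
    · rw [indicator_of_notMem h, indicator_of_notMem fun h' => h (mem_shell_comm.1 h')]
  simp only [h2]
  rw [lintegral_indicator_const (measurableSet_shell _ _ _),
    Measure.restrict_apply (measurableSet_shell _ _ _), inter_comm]

/-- The `Lᵖ` bound over a region `G` of the maximal function of a smeared function over a set of
radii of diameter comparable with the smearing scale. All the shells lie in one of half-width
`4 * δ`, and Jensen's inequality on that shell reduces the claim to `p = 1`. -/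
theorem exists_lintegral_iSup_sphericalMean_smear_rpow_le (hd : 2 ≤ d) (M : ℝ) (hM : 0 ≤ M)
    (p : ℝ) (hp : 1 ≤ p) : ∃ C : ℝ, 0 < C ∧
    ∀ (K : 𝓢(𝔼 d, ℂ)) (δ : ℝ), 0 < δ → δ ≤ 1 → (∀ x, 2 * δ < ‖x‖ → K x = 0) →
      (∀ x, ‖K x‖ ≤ M / δ ^ d) → ∀ f : 𝔼 d → ℂ, AEStronglyMeasurable f volume →
      ∀ (G : Set (𝔼 d)) (κ : ℝ), MeasurableSet G → 0 ≤ κ → ThinShells G κ →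
      ∀ (P : Set ℝ) (t₀ : ℝ), t₀ ∈ Icc (1 : ℝ) 2 → (∀ t ∈ P, t ∈ Icc (1 : ℝ) 2 ∧ |t - t₀| ≤ 2 * δ) →
        ∫⁻ x in G, (⨆ t ∈ P, ‖sphericalMean t (smear K f) x‖ₑ) ^ p ≤
          ENNReal.ofReal (C * κ) * ∫⁻ x, ‖f x‖ₑ ^ p := by
  have hp0 : 0 ≤ p := by linarith
  obtain ⟨C₁, hC₁, h₁⟩ := exists_enorm_sphericalMean_smear_le hd
  obtain ⟨C₂, hC₂, h₂, -⟩ := exists_thinShells hd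
  refine ⟨(C₁ * M) ^ p * (C₂ * 4) ^ (p - 1) * 4 + 1, by positivity, ?_⟩
  intro K δ hδ hδ1 hK hKM f hf G κ hG hκ hGκ P t₀ ht₀ hP
  have hw : 4 * δ ∈ Ioc (0 : ℝ) 8 := ⟨by positivity, by linarith⟩
  have hpt : ∀ x, (⨆ t ∈ P, ‖sphericalMean t (smear K f) x‖ₑ) ^ p ≤
      ENNReal.ofReal ((C₁ * M / δ) ^ p * (C₂ * (4 * δ)) ^ (p - 1)) *
        ∫⁻ y in shell x t₀ (4 * δ), ‖f y‖ₑ ^ p := by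
    intro x
    have a1 : (⨆ t ∈ P, ‖sphericalMean t (smear K f) x‖ₑ) ≤
        ENNReal.ofReal (C₁ * M / δ) * ∫⁻ y in shell x t₀ (4 * δ), ‖f y‖ₑ := by
      refine iSup₂_le fun t ht => (h₁ K δ M hδ hM hK hKM f hf t (hP t ht).1.1 x).trans ?_
      gcongr
      intro y hy
      have e1 : |‖x - y‖ - t| ≤ 2 * δ := hy
      have e2 := (hP t ht).2
      calc |‖x - y‖ - t₀| = |(‖x - y‖ - t) + (t - t₀)| := by congr 1; ring
        _ ≤ 2 * δ + 2 * δ := (abs_add_le _ _).trans (add_le_add e1 e2)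
        _ = 4 * δ := by ring
    have a2 := lintegral_rpow_le_measure_univ_rpow_mul (volume.restrict (shell x t₀ (4 * δ))) hp
      hf.enorm.restrict
    have a3 : volume.restrict (shell x t₀ (4 * δ)) univ ≤ ENNReal.ofReal (C₂ * (4 * δ)) := by
      rw [Measure.restrict_apply_univ]
      simpa using h₂ x t₀ ht₀ (4 * δ) hw
    calc _ ≤ (ENNReal.ofReal (C₁ * M / δ) * ∫⁻ y in shell x t₀ (4 * δ), ‖f y‖ₑ) ^ p := by gcongr
      _ ≤ ENNReal.ofReal (C₁ * M / δ) ^ p * (ENNReal.ofReal (C₂ * (4 * δ)) ^ (p - 1) *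
            ∫⁻ y in shell x t₀ (4 * δ), ‖f y‖ₑ ^ p) := by
          rw [ENNReal.mul_rpow_of_nonneg _ _ hp0]
          gcongr
          refine a2.trans ?_
          gcongr
      _ = _ := by
          rw [ENNReal.ofReal_rpow_of_nonneg (by positivity) hp0,
            ENNReal.ofReal_rpow_of_nonneg (by positivity) (by linarith), ← mul_assoc,
            ← ENNReal.ofReal_mul (by positivity)]
  calc ∫⁻ x in G, (⨆ t ∈ P, ‖sphericalMean t (smear K f) x‖ₑ) ^ p
      ≤ ∫⁻ x in G, ENNReal.ofReal ((C₁ * M / δ) ^ p * (C₂ * (4 * δ)) ^ (p - 1)) *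
        ∫⁻ y in shell x t₀ (4 * δ), ‖f y‖ₑ ^ p := lintegral_mono hpt
    _ ≤ ENNReal.ofReal ((C₁ * M / δ) ^ p * (C₂ * (4 * δ)) ^ (p - 1)) *
        ∫⁻ y, ENNReal.ofReal (κ * (4 * δ)) * ‖f y‖ₑ ^ p := by
        rw [lintegral_const_mul' _ _ ENNReal.ofReal_ne_top,
          lintegral_lintegral_shell G _ _ (hf.enorm.pow_const p)]
        refine mul_le_mul' le_rfl (lintegral_mono fun y => ?_)
        rw [mul_comm (‖f y‖ₑ ^ p)]
        exact mul_le_mul' (hGκ y t₀ ht₀ _ hw) le_rfl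
    _ = ENNReal.ofReal ((C₁ * M) ^ p * (C₂ * 4) ^ (p - 1) * 4 * κ) * ∫⁻ y, ‖f y‖ₑ ^ p := by
        rw [lintegral_const_mul' _ _ ENNReal.ofReal_ne_top, ← mul_assoc,
          ← ENNReal.ofReal_mul (by positivity)]
        congr 2
        rw [Real.div_rpow (by positivity) hδ.le, ← mul_assoc C₂,
          Real.mul_rpow (y := δ) (by positivity) hδ.le, Real.rpow_sub_one hδ.ne']
        have := Real.rpow_pos_of_pos hδ p
        field_simp
    _ ≤ _ := by
        gcongr
        linarith

end Shell

/-! ### Marcinkiewicz interpolation between `L¹` and `L²` -/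

section Marcinkiewicz

variable {d : ℕ}

theorem lintegral_Ioo_rpow {p a : ℝ} (hp : 1 < p) (ha : 0 ≤ a) :
    ∫⁻ s in Ioo 0 a, ENNReal.ofReal (s ^ (p - 2)) = ENNReal.ofReal (a ^ (p - 1) / (p - 1)) := by
  rw [Measure.restrict_congr_set Ioo_ae_eq_Ioc, ← ofReal_integral_eq_lintegral_ofReal]
  · rw [← intervalIntegral.integral_of_le ha, integral_rpow (Or.inl (by linarith)),
      Real.zero_rpow (by linarith)]
    ring_nf
  · exact (intervalIntegral.intervalIntegrable_rpow' (by linarith)).1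
  · filter_upwards [ae_restrict_mem measurableSet_Ioc] with s hs
    exact Real.rpow_nonneg hs.1.le _

theorem lintegral_Ioi_rpow {p a : ℝ} (hp : p < 2) (ha : 0 < a) :
    ∫⁻ s in Ioi a, ENNReal.ofReal (s ^ (p - 3)) = ENNReal.ofReal (a ^ (p - 2) / (2 - p)) := by
  rw [← ofReal_integral_eq_lintegral_ofReal]
  · rw [integral_Ioi_rpow_of_lt (by linarith) ha, ← neg_div_neg_eq, neg_neg]
    ring_nf
  · exact integrableOn_Ioi_rpow_of_lt (by linarith) ha
  · filter_upwards [ae_restrict_mem measurableSet_Ioi] with s hs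
    exact Real.rpow_nonneg (ha.trans hs).le _

/-- A substitute for the layer cake formula that only involves the excess of `u` over the levels.
The integrand is at least `s ^ (p - 2) * u / 2` for `s < u / 2`. -/
theorem rpow_le_lintegral_sub {p : ℝ} (hp : 1 < p) (u : ℝ≥0∞) :
    u ^ p ≤ ENNReal.ofReal (2 ^ p * (p - 1)) *
      ∫⁻ s in Ioi (0 : ℝ), ENNReal.ofReal (s ^ (p - 2)) * (u - ENNReal.ofReal s) := by
  have key : ∀ b : ℝ, 0 ≤ b → ENNReal.ofReal (2 * b) ≤ u →
      ENNReal.ofReal ((2 * b) ^ p) ≤ ENNReal.ofReal (2 ^ p * (p - 1)) *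
      ∫⁻ s in Ioi (0 : ℝ), ENNReal.ofReal (s ^ (p - 2)) * (u - ENNReal.ofReal s) := by
    intro b hb hbu
    have hp1 : 0 < p - 1 := by linarith
    calc ENNReal.ofReal ((2 * b) ^ p) = ENNReal.ofReal (2 ^ p * (p - 1)) *
          (ENNReal.ofReal (b ^ (p - 1) / (p - 1)) * ENNReal.ofReal b) := by
          rw [← ENNReal.ofReal_mul (by positivity), ← ENNReal.ofReal_mul (by positivity),
            Real.mul_rpow (by norm_num) hb]
          congr 1
          have : b ^ p = b ^ (p - 1) * b := by
            rcases hb.eq_or_lt with rfl | hb'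
            · rw [mul_zero, Real.zero_rpow (by linarith)]
            · rw [Real.rpow_sub_one hb'.ne']; field_simp
          rw [this]
          field_simp
      _ = ENNReal.ofReal (2 ^ p * (p - 1)) *
          ∫⁻ s in Ioo 0 b, ENNReal.ofReal (s ^ (p - 2)) * ENNReal.ofReal b := by
          rw [lintegral_mul_const' _ _ ENNReal.ofReal_ne_top, lintegral_Ioo_rpow hp hb]
      _ ≤ ENNReal.ofReal (2 ^ p * (p - 1)) *
          ∫⁻ s in Ioo 0 b, ENNReal.ofReal (s ^ (p - 2)) * (u - ENNReal.ofReal s) := by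
          refine mul_le_mul' le_rfl (setLIntegral_mono' measurableSet_Ioo fun s hs => ?_)
          refine mul_le_mul' le_rfl (ENNReal.le_sub_of_add_le_right ENNReal.ofReal_ne_top ?_)
          rw [← ENNReal.ofReal_add hb hs.1.le]
          refine le_trans (ENNReal.ofReal_le_ofReal ?_) hbu
          linarith [hs.2]
      _ ≤ _ := by
          gcongr
          exact Ioo_subset_Ioi_self
  rcases eq_or_ne u ⊤ with rfl | hu
  · refine le_top.trans (ENNReal.eq_top_of_forall_nnreal_le fun r => ?_).ge
    have := key ((r : ℝ) ^ (p⁻¹) / 2) (by positivity) le_top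
    rw [mul_div_cancel₀ _ two_ne_zero, Real.rpow_inv_rpow r.coe_nonneg (by linarith),
      ENNReal.ofReal_coe_nnreal] at this
    exact this
  · have := key (u.toReal / 2) (by positivity)
    rw [mul_div_cancel₀ _ two_ne_zero, ENNReal.ofReal_toReal hu,
      ← ENNReal.ofReal_rpow_of_nonneg ENNReal.toReal_nonneg (by linarith),
      ENNReal.ofReal_toReal hu] at this
    exact this le_rfl

/-- From `b ≤ s + b² / (4 s)`. -/
theorem sub_le_of_le_add {u a b : ℝ≥0∞} {s : ℝ} (hs : 0 < s) (h : u ≤ a + b) :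
    u - ENNReal.ofReal s ≤ a + ENNReal.ofReal (4 * s)⁻¹ * b ^ 2 := by
  refine tsub_le_iff_right.2 (h.trans ?_)
  rw [add_assoc]
  gcongr
  rcases eq_or_ne b ⊤ with rfl | hb
  · rw [ENNReal.top_pow two_ne_zero, ENNReal.mul_top (by simp [hs]), top_add]
  · rw [← ENNReal.ofReal_toReal hb, ← ENNReal.ofReal_pow ENNReal.toReal_nonneg,
      ← ENNReal.ofReal_mul (by positivity), ← ENNReal.ofReal_add (by positivity) hs.le]
    refine ENNReal.ofReal_le_ofReal ?_
    have : (4 * s)⁻¹ * b.toReal ^ 2 + s = b.toReal + (4 * s)⁻¹ * (b.toReal - 2 * s) ^ 2 := by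
      field_simp; ring
    rw [this]
    have : 0 ≤ (4 * s)⁻¹ * (b.toReal - 2 * s) ^ 2 := by positivity
    linarith

/-- Marcinkiewicz interpolation for `1 < p < 2`: if for every level `s` the function `u` is
dominated by the sum of a function controlled in `L¹` by the part of `f` above the level, and a
function controlled in `L²` by the part of `f` below the level, then `u` is controlled in `Lᵖ` by
`f`. The level attached to the height `s` of `u` is `A₁ / A₂ * s`, which balances both terms. -/
theorem marcinkiewicz {p : ℝ} (hp : 1 < p) (hp2 : p < 2) : ∃ C : ℝ, 0 < C ∧
    ∀ (ν : Measure (𝔼 d)) [SFinite ν] (f : 𝔼 d → ℂ) (u : 𝔼 d → ℝ≥0∞) (A₁ A₂ : ℝ), Measurable f →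
      Measurable u → 0 < A₁ → 0 < A₂ →
      (∀ s : ℝ, 0 < s → ∃ T₁ T₂ : 𝔼 d → ℝ≥0∞, Measurable T₁ ∧ (∀ x, u x ≤ T₁ x + T₂ x) ∧
        ∫⁻ x, T₁ x ∂ν ≤ ENNReal.ofReal A₁ * ∫⁻ y in {y | s < ‖f y‖}, ‖f y‖ₑ ∧
        ∫⁻ x, T₂ x ^ 2 ∂ν ≤ ENNReal.ofReal A₂ * ∫⁻ y in {y | ‖f y‖ ≤ s}, ‖f y‖ₑ ^ 2) →
      ∫⁻ x, u x ^ p ∂ν ≤ ENNReal.ofReal (C * (A₁ ^ (2 - p) * A₂ ^ (p - 1))) *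
        ∫⁻ y, ‖f y‖ₑ ^ p := by
  have hp1 : 0 < p - 1 := by linarith
  have hp2' : 0 < 2 - p := by linarith
  refine ⟨2 ^ p * (p - 1) * ((p - 1)⁻¹ + (4 * (2 - p))⁻¹), by positivity, ?_⟩
  intro ν _ f u A₁ A₂ hf hu hA₁ hA₂ H
  set γ : ℝ := A₁ / A₂ with hγ
  have hγ0 : 0 < γ := by positivity
  set F₁ : ℝ → 𝔼 d → ℝ≥0∞ := fun s y => ENNReal.ofReal (A₁ * s ^ (p - 2)) *
    {y | γ * s < ‖f y‖}.indicator (fun y => ‖f y‖ₑ) y with hF₁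
  set F₂ : ℝ → 𝔼 d → ℝ≥0∞ := fun s y => ENNReal.ofReal (A₂ / 4 * s ^ (p - 3)) *
    {y | ‖f y‖ ≤ γ * s}.indicator (fun y => ‖f y‖ₑ ^ 2) y with hF₂
  have hms : ∀ s : ℝ, MeasurableSet {y | γ * s < ‖f y‖} := fun s =>
    measurableSet_lt measurable_const hf.norm
  have hms' : ∀ s : ℝ, MeasurableSet {y | ‖f y‖ ≤ γ * s} := fun s =>
    measurableSet_le hf.norm measurable_const
  have hm₁ : Measurable (Function.uncurry F₁) := by
    refine Measurable.mul (by fun_prop) ?_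
    exact (hf.enorm.comp measurable_snd).indicator
      (s := {z : ℝ × 𝔼 d | γ * z.1 < ‖f z.2‖}) (measurableSet_lt (by fun_prop) (by fun_prop))
  have hm₂ : Measurable (Function.uncurry F₂) := by
    refine Measurable.mul (by fun_prop) ?_
    exact ((hf.enorm.pow_const 2).comp measurable_snd).indicator
      (s := {z : ℝ × 𝔼 d | ‖f z.2‖ ≤ γ * z.1}) (measurableSet_le (by fun_prop) (by fun_prop))
  have hm₁s : ∀ s, Measurable fun y => F₁ s y := fun s => hm₁.comp measurable_prodMk_left
  have hm₁y : ∀ y, Measurable fun s => F₁ s y := fun y => hm₁.comp measurable_prodMk_right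
  -- For a fixed height, the hypothesis bounds the truncated integral of `u`.
  have h1 : ∀ s ∈ Ioi (0 : ℝ), ∫⁻ x, ENNReal.ofReal (s ^ (p - 2)) * (u x - ENNReal.ofReal s) ∂ν ≤
      ∫⁻ y, (F₁ s y + F₂ s y) := by
    intro s hs
    have hs0 : 0 < s := hs
    obtain ⟨T₁, T₂, hT₁, hle, b₁, b₂⟩ := H (γ * s) (by positivity)
    calc ∫⁻ x, ENNReal.ofReal (s ^ (p - 2)) * (u x - ENNReal.ofReal s) ∂ν
        ≤ ∫⁻ x, ENNReal.ofReal (s ^ (p - 2)) * (T₁ x + ENNReal.ofReal (4 * s)⁻¹ * T₂ x ^ 2) ∂ν := by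
          gcongr with x
          exact sub_le_of_le_add hs (hle x)
      _ = ENNReal.ofReal (s ^ (p - 2)) * (∫⁻ x, T₁ x ∂ν +
            ENNReal.ofReal (4 * s)⁻¹ * ∫⁻ x, T₂ x ^ 2 ∂ν) := by
          rw [lintegral_const_mul' _ _ ENNReal.ofReal_ne_top, lintegral_add_left hT₁,
            lintegral_const_mul' _ _ ENNReal.ofReal_ne_top]
      _ ≤ ENNReal.ofReal (s ^ (p - 2)) *
            ((ENNReal.ofReal A₁ * ∫⁻ y in {y | γ * s < ‖f y‖}, ‖f y‖ₑ) +
            ENNReal.ofReal (4 * s)⁻¹ *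
              (ENNReal.ofReal A₂ * ∫⁻ y in {y | ‖f y‖ ≤ γ * s}, ‖f y‖ₑ ^ 2)) := by
          gcongr
      _ = ∫⁻ y, (F₁ s y + F₂ s y) := by
          rw [lintegral_add_left (hm₁s s)]
          simp only [hF₁, hF₂]
          rw [lintegral_const_mul' _ _ ENNReal.ofReal_ne_top,
            lintegral_const_mul' _ _ ENNReal.ofReal_ne_top, lintegral_indicator (hms s),
            lintegral_indicator (hms' s), mul_add, ← mul_assoc, ← mul_assoc, ← mul_assoc,
            ← ENNReal.ofReal_mul (by positivity), ← ENNReal.ofReal_mul (by positivity),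
            ← ENNReal.ofReal_mul (by positivity), mul_comm A₁]
          congr 3
          rw [show p - 3 = (p - 2) - 1 by ring, Real.rpow_sub_one hs0.ne' (p - 2)]
          field_simp
  -- For a fixed value of `f`, the integrals over the height are explicit.
  have h2 : ∀ y, ∫⁻ s in Ioi (0 : ℝ), F₁ s y =
      ENNReal.ofReal ((p - 1)⁻¹ * (A₁ ^ (2 - p) * A₂ ^ (p - 1))) * ‖f y‖ₑ ^ p := by
    intro y
    have e : ∀ s ∈ Ioi (0 : ℝ), F₁ s y = (Ioo 0 (‖f y‖ / γ)).indicator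
        (fun s => ENNReal.ofReal (s ^ (p - 2))) s * (ENNReal.ofReal A₁ * ‖f y‖ₑ) := by
      intro s hs
      simp only [hF₁]
      rw [ENNReal.ofReal_mul hA₁.le]
      by_cases h : γ * s < ‖f y‖
      · rw [indicator_of_mem (s := {y | γ * s < ‖f y‖}) h,
          indicator_of_mem (s := Ioo 0 (‖f y‖ / γ)) ⟨hs, (lt_div_iff₀' hγ0).2 h⟩]
        ring
      · rw [indicator_of_notMem (s := {y | γ * s < ‖f y‖}) h, indicator_of_notMem
          (s := Ioo 0 (‖f y‖ / γ)) (fun h' => h ((lt_div_iff₀' hγ0).1 h'.2)), mul_zero, zero_mul]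
    rw [setLIntegral_congr_fun measurableSet_Ioi e,
      lintegral_mul_const' _ _ (ENNReal.mul_ne_top ENNReal.ofReal_ne_top enorm_ne_top),
      setLIntegral_indicator measurableSet_Ioo,
      inter_eq_self_of_subset_left Ioo_subset_Ioi_self, lintegral_Ioo_rpow hp (by positivity),
      ← ofReal_norm, ENNReal.ofReal_rpow_of_nonneg (norm_nonneg _) (by linarith),
      ← ENNReal.ofReal_mul hA₁.le, ← ENNReal.ofReal_mul (by positivity),
      ← ENNReal.ofReal_mul (by positivity)]
    congr 1
    have e1 : ‖f y‖ ^ p = ‖f y‖ ^ (p - 1) * ‖f y‖ := by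
      rcases (norm_nonneg (f y)).eq_or_lt with h0 | h0
      · rw [← h0, mul_zero, Real.zero_rpow (by linarith)]
      · rw [Real.rpow_sub_one h0.ne']; field_simp
    have e2 : A₁ ^ (2 - p) = A₁ / A₁ ^ (p - 1) := by
      rw [show 2 - p = 1 - (p - 1) by ring, Real.rpow_sub hA₁, Real.rpow_one]
    rw [Real.div_rpow (norm_nonneg _) hγ0.le, hγ, Real.div_rpow hA₁.le hA₂.le, e1, e2]
    field_simp
  have h3 : ∀ y, ∫⁻ s in Ioi (0 : ℝ), F₂ s y ≤
      ENNReal.ofReal ((4 * (2 - p))⁻¹ * (A₁ ^ (2 - p) * A₂ ^ (p - 1))) * ‖f y‖ₑ ^ p := by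
    intro y
    rcases (norm_nonneg (f y)).eq_or_lt with h0 | h0
    · have hz : f y = 0 := norm_eq_zero.1 h0.symm
      refine (le_of_eq ((lintegral_congr fun s => ?_).trans lintegral_zero)).trans zero_le
      simp only [hF₂]
      refine mul_eq_zero_of_right _ ?_
      by_cases h : ‖f y‖ ≤ γ * s
      · rw [indicator_of_mem (s := {y | ‖f y‖ ≤ γ * s}) h]
        simp [hz]
      · rw [indicator_of_notMem (s := {y | ‖f y‖ ≤ γ * s}) h]
    have e : ∀ s ∈ Ioi (0 : ℝ), F₂ s y = (Ici (‖f y‖ / γ)).indicator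
        (fun s => ENNReal.ofReal (s ^ (p - 3))) s * (ENNReal.ofReal (A₂ / 4) * ‖f y‖ₑ ^ 2) := by
      intro s hs
      simp only [hF₂]
      rw [ENNReal.ofReal_mul (by positivity)]
      by_cases h : ‖f y‖ ≤ γ * s
      · rw [indicator_of_mem (s := {y | ‖f y‖ ≤ γ * s}) h,
          indicator_of_mem (s := Ici (‖f y‖ / γ)) ((div_le_iff₀' hγ0).2 h)]
        ring
      · rw [indicator_of_notMem (s := {y | ‖f y‖ ≤ γ * s}) h, indicator_of_notMem
          (s := Ici (‖f y‖ / γ)) (fun h' => h ((div_le_iff₀' hγ0).1 h')), mul_zero, zero_mul]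
    have hpos : 0 < ‖f y‖ / γ := by positivity
    rw [setLIntegral_congr_fun measurableSet_Ioi e,
      lintegral_mul_const' _ _ (ENNReal.mul_ne_top ENNReal.ofReal_ne_top
        (ENNReal.pow_ne_top enorm_ne_top)), setLIntegral_indicator measurableSet_Ici,
      inter_eq_self_of_subset_left (Ici_subset_Ioi.2 hpos), Measure.restrict_congr_set Ioi_ae_eq_Ici.symm,
      lintegral_Ioi_rpow hp2 hpos,
      ← ofReal_norm, ENNReal.ofReal_rpow_of_nonneg (norm_nonneg _) (by linarith),
      ← ENNReal.ofReal_pow (norm_nonneg _), ← ENNReal.ofReal_mul (by positivity),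
      ← ENNReal.ofReal_mul (by positivity), ← ENNReal.ofReal_mul (by positivity)]
    refine le_of_eq (congrArg _ ?_)
    have e1 : ‖f y‖ ^ p = ‖f y‖ ^ (p - 2) * ‖f y‖ ^ 2 := by
      rw [← Real.rpow_natCast, ← Real.rpow_add h0]; norm_num
    have e2 : A₁ ^ (2 - p) = (A₁ ^ (p - 2))⁻¹ := by
      rw [← Real.rpow_neg hA₁.le]; ring_nf
    have e3 : A₂ ^ (p - 1) = A₂ * A₂ ^ (p - 2) := by
      rw [show p - 1 = 1 + (p - 2) by ring, Real.rpow_add hA₂, Real.rpow_one]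
    rw [Real.div_rpow (norm_nonneg _) hγ0.le, hγ, Real.div_rpow hA₁.le hA₂.le, e1, e2, e3]
    field_simp
  calc ∫⁻ x, u x ^ p ∂ν
      ≤ ∫⁻ x, (ENNReal.ofReal (2 ^ p * (p - 1)) *
          ∫⁻ s in Ioi (0 : ℝ), ENNReal.ofReal (s ^ (p - 2)) * (u x - ENNReal.ofReal s)) ∂ν :=
        lintegral_mono fun x => rpow_le_lintegral_sub hp _
    _ = ENNReal.ofReal (2 ^ p * (p - 1)) * ∫⁻ s in Ioi (0 : ℝ),
          (∫⁻ x, ENNReal.ofReal (s ^ (p - 2)) * (u x - ENNReal.ofReal s) ∂ν) := by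
        rw [lintegral_const_mul' _ _ ENNReal.ofReal_ne_top, lintegral_lintegral_swap]
        exact Measurable.aemeasurable (f := Function.uncurry fun (x : 𝔼 d) (s : ℝ) =>
          ENNReal.ofReal (s ^ (p - 2)) * (u x - ENNReal.ofReal s))
          (by unfold Function.uncurry; fun_prop)
    _ ≤ ENNReal.ofReal (2 ^ p * (p - 1)) * ∫⁻ s in Ioi (0 : ℝ), ∫⁻ y, (F₁ s y + F₂ s y) := by
        refine mul_le_mul' le_rfl (setLIntegral_mono' measurableSet_Ioi h1)
    _ = ENNReal.ofReal (2 ^ p * (p - 1)) *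
          ∫⁻ y, ((∫⁻ s in Ioi (0 : ℝ), F₁ s y) + ∫⁻ s in Ioi (0 : ℝ), F₂ s y) := by
        rw [lintegral_lintegral_swap (hm₁.add hm₂).aemeasurable]
        congr 2
        ext y
        rw [lintegral_add_left (hm₁y y)]
    _ ≤ ENNReal.ofReal (2 ^ p * (p - 1)) *
          ∫⁻ y, ENNReal.ofReal (((p - 1)⁻¹ + (4 * (2 - p))⁻¹) * (A₁ ^ (2 - p) * A₂ ^ (p - 1))) *
            ‖f y‖ₑ ^ p := by
        gcongr with y
        rw [h2, add_mul, ENNReal.ofReal_add (by positivity) (by positivity), add_mul]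
        gcongr
        exact h3 y
    _ = _ := by
        rw [lintegral_const_mul' _ _ ENNReal.ofReal_ne_top, ← mul_assoc,
          ← ENNReal.ofReal_mul (by positivity)]
        congr 2
        ring

end Marcinkiewicz

/-! ### Frequency localised maximal estimates in `Lᵖ` -/

section Localised

open scoped FourierTransform SchwartzMap

variable {d : ℕ}

theorem integrable_sphere_of_continuous (hd : 2 ≤ d) {f : 𝔼 d → ℂ} (hf : Continuous f) (t : ℝ)
    (x : 𝔼 d) : Integrable (fun ω : Metric.sphere (0 : 𝔼 d) 1 => f (x + t • (ω : 𝔼 d)))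
      (sphereProb d) := by
  have := isProbabilityMeasure_sphereProb hd
  exact (hf.comp (by fun_prop : Continuous fun ω : Metric.sphere (0 : 𝔼 d) 1 =>
    x + t • (ω : 𝔼 d))).integrable_of_hasCompactSupport (HasCompactSupport.of_compactSpace _)

theorem continuous_sphericalMean (hd : 2 ≤ d) {f : 𝔼 d → ℂ} (hf : Continuous f) (t : ℝ) :
    Continuous (sphericalMean t f) := by
  have := isProbabilityMeasure_sphereProb hd
  have h := continuous_parametric_integral_of_continuous (μ := sphereProb d)
    (f := fun (x : 𝔼 d) (ω : Metric.sphere (0 : 𝔼 d) 1) => f (x + t • (ω : 𝔼 d)))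
    (by unfold Function.uncurry; fun_prop) isCompact_univ
  rw [Measure.restrict_univ] at h
  exact h

theorem lowerSemicontinuous_sphericalMax (hd : 2 ≤ d) {f : 𝔼 d → ℂ} (hf : Continuous f)
    (P : Set ℝ) : LowerSemicontinuous (sphericalMax P f) :=
  lowerSemicontinuous_biSup fun t _ =>
    (continuous_sphericalMean hd hf t).enorm.lowerSemicontinuous

theorem measurable_sphericalMax (hd : 2 ≤ d) {f : 𝔼 d → ℂ} (hf : Continuous f) (P : Set ℝ) :
    Measurable (sphericalMax P f) :=
  (lowerSemicontinuous_sphericalMax hd hf P).measurable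

theorem integrable_mul_schwartz_sub (K : 𝓢(𝔼 d, ℂ)) {f : 𝔼 d → ℂ} (hf : Integrable f) (x : 𝔼 d) :
    Integrable fun y => f y * K (x - y) := by
  obtain ⟨C, hC⟩ := schwartz_bddAbove_range_norm K
  have hK := K.continuous
  exact hf.mul_bdd (c := C) (by fun_prop)
    (Filter.Eventually.of_forall fun y => hC (mem_range_self (x - y)))

theorem sphericalMean_smear_add (hd : 2 ≤ d) (K : 𝓢(𝔼 d, ℂ)) {f g : 𝔼 d → ℂ}
    (hf : Integrable f) (hg : Integrable g) (t : ℝ) (x : 𝔼 d) :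
    sphericalMean t (smear K (f + g)) x =
      sphericalMean t (smear K f) x + sphericalMean t (smear K g) x := by
  have e : smear K (f + g) = smear K f + smear K g := by
    ext z
    simp only [Pi.add_apply, smear_apply, add_mul]
    exact integral_add (integrable_mul_schwartz_sub K hf z) (integrable_mul_schwartz_sub K hg z)
  rw [e]
  exact integral_add (integrable_sphere_of_continuous hd (continuous_smear K hf) t x)
    (integrable_sphere_of_continuous hd (continuous_smear K hg) t x)

/-- The decay of the surface measure at frequencies of size `1 / δ` gives the multiplier bounds
`δ ^ (d - 1)` for the means and `δ ^ (d - 3)` for their radial derivatives. -/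
theorem IsMollifier.exists_multiplier_le [NeZero d] (hd : 2 ≤ d) {Q : ℝ → 𝓢(𝔼 d, ℂ)} {C : ℝ}
    (hQ : IsMollifier Q C) : ∃ B : ℝ, 0 < B ∧ ∀ δ : ℝ, 0 < δ → ∀ t ∈ Icc (1 : ℝ) 2, ∀ ξ,
      sphereProfile d (2 * Real.pi * t * ‖ξ‖) ^ 2 * ‖(𝓕 (Q δ - Q (2 * δ))) ξ‖ ^ 2 ≤
        B * δ ^ (d - 1) ∧
      (2 * Real.pi * ‖ξ‖ * sphereProfileDeriv d (2 * Real.pi * t * ‖ξ‖)) ^ 2 *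
        ‖(𝓕 (Q δ - Q (2 * δ))) ξ‖ ^ 2 ≤ B * δ ^ (d - 1) / δ ^ 2 := by
  obtain ⟨C₀, hC₀, hdec⟩ := exists_sphereProfile_decay hd
  have hC := hQ.pos
  have hpi : 1 ≤ Real.pi := by linarith [Real.pi_gt_three]
  set K := 2 * (C * (1 + 2 ^ d)) ^ 2 with hK
  have hK0 : 0 < K := by positivity
  refine ⟨(2 * Real.pi) ^ 2 * (C₀ * K), by positivity, fun δ hδ t ht ξ => ?_⟩
  set m := ‖(𝓕 (Q δ - Q (2 * δ))) ξ‖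
  set a := sphereProfile d (2 * Real.pi * t * ‖ξ‖)
  set b := sphereProfileDeriv d (2 * Real.pi * t * ‖ξ‖)
  have h1 : (1 + (δ * ‖ξ‖) ^ 2) * m ^ 2 ≤ K * (δ ^ (d - 1) * ‖ξ‖ ^ (d - 1)) := by
    rw [← mul_pow]; exact hQ.norm_fourier_sub_sq_le hd hδ ξ
  have h2 : (a ^ 2 + b ^ 2) * ‖ξ‖ ^ (d - 1) ≤ C₀ := by
    rcases (norm_nonneg ξ).eq_or_lt with h0 | h0
    · rw [← h0, zero_pow (by omega), mul_zero]; exact hC₀.le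
    · refine le_trans ?_ (hdec (2 * Real.pi * t * ‖ξ‖) (by have := ht.1; positivity))
      refine mul_le_mul_of_nonneg_left (pow_le_pow_left₀ h0.le ?_ _) (by positivity)
      have : 1 ≤ 2 * Real.pi * t := by nlinarith [ht.1]
      nlinarith
  have h3 : (a ^ 2 + b ^ 2) * ((1 + (δ * ‖ξ‖) ^ 2) * m ^ 2) ≤ C₀ * K * δ ^ (d - 1) := by
    calc (a ^ 2 + b ^ 2) * ((1 + (δ * ‖ξ‖) ^ 2) * m ^ 2)
        ≤ (a ^ 2 + b ^ 2) * (K * (δ ^ (d - 1) * ‖ξ‖ ^ (d - 1))) :=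
          mul_le_mul_of_nonneg_left h1 (by positivity)
      _ = (a ^ 2 + b ^ 2) * ‖ξ‖ ^ (d - 1) * (K * δ ^ (d - 1)) := by ring
      _ ≤ C₀ * (K * δ ^ (d - 1)) := mul_le_mul_of_nonneg_right h2 (by positivity)
      _ = _ := by ring
  have hab : a ^ 2 * m ^ 2 + b ^ 2 * ((δ * ‖ξ‖) ^ 2 * m ^ 2) ≤
      (a ^ 2 + b ^ 2) * ((1 + (δ * ‖ξ‖) ^ 2) * m ^ 2) := by
    have : 0 ≤ a ^ 2 * ((δ * ‖ξ‖) ^ 2 * m ^ 2) + b ^ 2 * m ^ 2 := by positivity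
    linarith
  have hp1 : 0 ≤ a ^ 2 * m ^ 2 := by positivity
  have hp2 : 0 ≤ b ^ 2 * ((δ * ‖ξ‖) ^ 2 * m ^ 2) := by positivity
  have hT : 0 < C₀ * K * δ ^ (d - 1) := by positivity
  have hpi2 : 1 ≤ (2 * Real.pi) ^ 2 := one_le_pow₀ (by linarith)
  constructor
  · nlinarith
  · rw [le_div_iff₀ (by positivity)]
    calc (2 * Real.pi * ‖ξ‖ * b) ^ 2 * m ^ 2 * δ ^ 2
        = (2 * Real.pi) ^ 2 * (b ^ 2 * ((δ * ‖ξ‖) ^ 2 * m ^ 2)) := by ring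
      _ ≤ (2 * Real.pi) ^ 2 * (C₀ * K * δ ^ (d - 1)) :=
          mul_le_mul_of_nonneg_left (by linarith) (by positivity)
      _ = _ := by ring

theorem IsMollifier.diff_eq_zero {Q : ℝ → 𝓢(𝔼 d, ℂ)} {C : ℝ} (hQ : IsMollifier Q C) {δ : ℝ}
    (hδ : 0 < δ) {x : 𝔼 d} (hx : 2 * δ < ‖x‖) : (Q δ - Q (2 * δ)) x = 0 := by
  rw [_root_.sub_apply, hQ.eq_zero δ hδ x (by linarith),
    hQ.eq_zero (2 * δ) (by positivity) x hx, sub_zero]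

theorem IsMollifier.norm_diff_le {Q : ℝ → 𝓢(𝔼 d, ℂ)} {C : ℝ} (hQ : IsMollifier Q C) {δ : ℝ}
    (hδ : 0 < δ) (x : 𝔼 d) : ‖(Q δ - Q (2 * δ)) x‖ ≤ 2 * C / δ ^ d := by
  have hC := hQ.pos
  rw [_root_.sub_apply]
  calc ‖Q δ x - Q (2 * δ) x‖ ≤ C / δ ^ d + C / (2 * δ) ^ d :=
        (norm_sub_le _ _).trans (add_le_add (hQ.norm_le δ hδ x) (hQ.norm_le _ (by positivity) x))
    _ ≤ C / δ ^ d + C / δ ^ d := by gcongr; linarith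
    _ = _ := by ring

/-- The interpolated estimate for one frequency scale: the `L²` bound gains `δ ^ (d - 1)`, the `L¹`
bound gains the density `κ` of the set `G` in thin shells. -/
theorem IsMollifier.exists_lintegral_sphericalMax_sub_le [NeZero d] (hd : 2 ≤ d)
    {Q : ℝ → 𝓢(𝔼 d, ℂ)} {C₀ : ℝ} (hQ : IsMollifier Q C₀) {p : ℝ} (hp : 1 < p) (hp2 : p ≤ 2) :
    ∃ C : ℝ, 0 < C ∧ ∀ δ : ℝ, 0 < δ → δ ≤ 1 → ∀ f : 𝔼 d → ℂ, Measurable f → Integrable f →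
      MemLp f 2 → ∀ (G : Set (𝔼 d)) (κ : ℝ), MeasurableSet G → 0 < κ → ThinShells G κ →
      ∀ (P : Set ℝ) (t₀ : ℝ), t₀ ∈ Icc (1 : ℝ) 2 →
        (∀ t ∈ P, t ∈ Icc (1 : ℝ) 2 ∧ |t - t₀| ≤ 2 * δ) →
        ∫⁻ x in G, sphericalMax P (smear (Q δ - Q (2 * δ)) f) x ^ p ≤
          ENNReal.ofReal (C * (κ ^ (2 - p) * δ ^ (((d : ℝ) - 1) * (p - 1)))) *
            ∫⁻ x, ‖f x‖ₑ ^ p := by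
  obtain ⟨B, hB, hmult⟩ := hQ.exists_multiplier_le hd
  have hL2 : ∀ δ : ℝ, 0 < δ → ∀ f : 𝔼 d → ℂ, Integrable f → MemLp f 2 →
      ∀ (P : Set ℝ) (t₀ : ℝ), t₀ ∈ Icc (1 : ℝ) 2 →
        (∀ t ∈ P, t ∈ Icc (1 : ℝ) 2 ∧ |t - t₀| ≤ 2 * δ) →
        ∫⁻ x, sphericalMax P (smear (Q δ - Q (2 * δ)) f) x ^ 2 ≤
          ENNReal.ofReal (34 * B * δ ^ (d - 1)) * ∫⁻ x, ‖f x‖ₑ ^ 2 := by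
    intro δ hδ f hf hf2 P t₀ ht₀ hP
    rw [mul_assoc]
    exact lintegral_iSup_sphericalMean_smear_sq_le hd _ hf hf2 hδ
      (fun t ht ξ => (hmult δ hδ t ht ξ).1) (fun t ht ξ => (hmult δ hδ t ht ξ).2) ht₀ hP
  have hδd : ∀ δ : ℝ, δ ^ (d - 1) = δ ^ ((d : ℝ) - 1) := fun δ => by
    rw [← Real.rpow_natCast, Nat.cast_sub (by omega), Nat.cast_one]
  rcases hp2.eq_or_lt with rfl | hp2
  · refine ⟨34 * B, by positivity, fun δ hδ _ f _ hf hf2 G κ _ _ _ P t₀ ht₀ hP => ?_⟩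
    simp only [ENNReal.rpow_two]
    refine (setLIntegral_le_lintegral _ _).trans ((hL2 δ hδ f hf hf2 P t₀ ht₀ hP).trans_eq ?_)
    rw [sub_self, Real.rpow_zero, one_mul, hδd]
    norm_num
  obtain ⟨C₁, hC₁, hL1⟩ := exists_lintegral_iSup_sphericalMean_smear_rpow_le hd (2 * C₀)
    (by linarith [hQ.pos]) 1 le_rfl
  obtain ⟨C, hC, hM⟩ := marcinkiewicz (d := d) hp hp2
  refine ⟨C * (C₁ ^ (2 - p) * (34 * B) ^ (p - 1)), by positivity, ?_⟩
  intro δ hδ hδ1 f hfm hf hf2 G κ hG hκ hGκ P t₀ ht₀ hP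
  have key := hM (volume.restrict G) f (sphericalMax P (smear (Q δ - Q (2 * δ)) f)) (C₁ * κ)
    (34 * B * δ ^ (d - 1)) hfm (measurable_sphericalMax hd (continuous_smear _ hf) P)
    (by positivity) (by positivity) ?_
  · refine key.trans_eq ?_
    rw [Real.mul_rpow hC₁.le hκ.le, Real.mul_rpow (by positivity) (by positivity), hδd,
      ← Real.rpow_mul hδ.le]
    congr 2
    ring
  intro s hs
  have hms : MeasurableSet {y | s < ‖f y‖} := measurableSet_lt measurable_const hfm.norm
  have hms' : MeasurableSet {y | ‖f y‖ ≤ s} := measurableSet_le hfm.norm measurable_const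
  have hc : {y | ‖f y‖ ≤ s} = {y | s < ‖f y‖}ᶜ := by ext y; simp
  have i₁ := hf.indicator hms
  have i₂ := hf.indicator hms'
  refine ⟨sphericalMax P (smear (Q δ - Q (2 * δ)) ({y | s < ‖f y‖}.indicator f)),
    sphericalMax P (smear (Q δ - Q (2 * δ)) ({y | ‖f y‖ ≤ s}.indicator f)),
    measurable_sphericalMax hd (continuous_smear _ i₁) P, fun x => ?_, ?_, ?_⟩
  · refine iSup₂_le fun t ht => ?_
    have : f = {y | s < ‖f y‖}.indicator f + {y | ‖f y‖ ≤ s}.indicator f := by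
      rw [hc, indicator_self_add_compl]
    conv_lhs => rw [this]
    rw [sphericalMean_smear_add hd _ i₁ i₂]
    exact (enorm_add_le _ _).trans (add_le_add
      (le_iSup₂ (f := fun t _ => ‖sphericalMean t (smear (Q δ - Q (2 * δ))
        ({y | s < ‖f y‖}.indicator f)) x‖ₑ) t ht)
      (le_iSup₂ (f := fun t _ => ‖sphericalMean t (smear (Q δ - Q (2 * δ))
        ({y | ‖f y‖ ≤ s}.indicator f)) x‖ₑ) t ht))
  · have := hL1 (Q δ - Q (2 * δ)) δ hδ hδ1 (fun x hx => hQ.diff_eq_zero hδ hx)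
      (hQ.norm_diff_le hδ) _ i₁.aestronglyMeasurable G κ hG hκ.le hGκ P t₀ ht₀ hP
    simp only [ENNReal.rpow_one, enorm_indicator_eq_indicator_enorm] at this
    rwa [lintegral_indicator hms] at this
  · refine (setLIntegral_le_lintegral _ _).trans
      ((hL2 δ hδ _ i₂ (hf2.indicator hms') P t₀ ht₀ hP).trans_eq ?_)
    rw [← lintegral_indicator hms']
    congr 2
    ext y
    by_cases h : ‖f y‖ ≤ s
    · rw [indicator_of_mem (s := {y | ‖f y‖ ≤ s}) h, indicator_of_mem (s := {y | ‖f y‖ ≤ s}) h]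
    · rw [indicator_of_notMem (s := {y | ‖f y‖ ≤ s}) h,
        indicator_of_notMem (s := {y | ‖f y‖ ≤ s}) h]
      simp

theorem sphericalMax_empty {f : 𝔼 d → ℂ} (x : 𝔼 d) : sphericalMax ∅ f x = 0 := by
  simp [sphericalMax]

/-- The maximal function over a union is controlled by the sum of the `p`-th powers. -/
theorem lintegral_sphericalMax_rpow_le_sum (hd : 2 ≤ d) {f : 𝔼 d → ℂ} (hf : Continuous f)
    {p : ℝ} (hp : 0 < p) (ν : Measure (𝔼 d)) {ι : Type*} [Fintype ι] {J : Set ℝ} {I : ι → Set ℝ}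
    (hJ : J ⊆ ⋃ i, I i) :
    ∫⁻ x, sphericalMax J f x ^ p ∂ν ≤ ∑ i, ∫⁻ x, sphericalMax (J ∩ I i) f x ^ p ∂ν := by
  rw [← lintegral_finsetSum _ fun i _ => (measurable_sphericalMax hd hf _).pow_const p]
  refine lintegral_mono fun x => ?_
  rw [← ENNReal.le_rpow_inv_iff hp]
  refine iSup₂_le fun t ht => ?_
  obtain ⟨i, hi⟩ := mem_iUnion.1 (hJ ht)
  rw [ENNReal.le_rpow_inv_iff hp]
  refine le_trans ?_ (Finset.single_le_sum (f := fun i => sphericalMax (J ∩ I i) f x ^ p)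
    (fun _ _ => zero_le) (Finset.mem_univ i))
  refine ENNReal.rpow_le_rpow ?_ hp.le
  exact le_iSup₂ (f := fun t _ => ‖sphericalMean t f x‖ₑ) t ⟨ht, hi⟩

/-- Summing the estimate for one frequency scale over a covering by intervals of that scale. -/
theorem IsMollifier.exists_lintegral_sphericalMax_sub_le_card [NeZero d] (hd : 2 ≤ d)
    {Q : ℝ → 𝓢(𝔼 d, ℂ)} {C₀ : ℝ} (hQ : IsMollifier Q C₀) {p : ℝ} (hp : 1 < p) (hp2 : p ≤ 2) :
    ∃ C : ℝ, 0 < C ∧ ∀ δ : ℝ, 0 < δ → δ ≤ 1 → ∀ f : 𝔼 d → ℂ, Measurable f → Integrable f →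
      MemLp f 2 → ∀ (G : Set (𝔼 d)) (κ : ℝ), MeasurableSet G → 0 < κ → ThinShells G κ →
      ∀ (J : Set ℝ) (n : ℕ) (c : Fin n → ℝ), J ⊆ Icc 1 2 →
        J ⊆ ⋃ i, Icc (c i) (c i + 2 * δ) →
        ∫⁻ x in G, sphericalMax J (smear (Q δ - Q (2 * δ)) f) x ^ p ≤
          ENNReal.ofReal (C * (n * (κ ^ (2 - p) * δ ^ (((d : ℝ) - 1) * (p - 1))))) *
            ∫⁻ x, ‖f x‖ₑ ^ p := by
  obtain ⟨C, hC, h⟩ := hQ.exists_lintegral_sphericalMax_sub_le hd hp hp2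
  refine ⟨C, hC, fun δ hδ hδ1 f hfm hf hf2 G κ hG hκ hGκ J n c hJ hJc => ?_⟩
  refine (lintegral_sphericalMax_rpow_le_sum hd (continuous_smear _ hf) (by linarith) _
    hJc).trans ?_
  have hi : ∀ i, ∫⁻ x in G, sphericalMax (J ∩ Icc (c i) (c i + 2 * δ))
      (smear (Q δ - Q (2 * δ)) f) x ^ p ≤
      ENNReal.ofReal (C * (κ ^ (2 - p) * δ ^ (((d : ℝ) - 1) * (p - 1)))) * ∫⁻ x, ‖f x‖ₑ ^ p := by
    intro i
    rcases (J ∩ Icc (c i) (c i + 2 * δ)).eq_empty_or_nonempty with he | ⟨t₀, ht₀⟩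
    · rw [he]
      simp [sphericalMax_empty, (by linarith : 0 < p)]
    · refine h δ hδ hδ1 f hfm hf hf2 G κ hG hκ hGκ _ t₀ (hJ ht₀.1) fun t ht => ⟨hJ ht.1, ?_⟩
      rw [abs_le]
      constructor <;> linarith [ht.2.1, ht.2.2, ht₀.2.1, ht₀.2.2]
  refine (Finset.sum_le_sum fun i _ => hi i).trans_eq ?_
  rw [Finset.sum_const, Finset.card_univ, Fintype.card_fin, nsmul_eq_mul, ← mul_assoc,
    ← ENNReal.ofReal_natCast, ← ENNReal.ofReal_mul (by positivity)]
  congr 2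
  ring

end Localised

/-! ### Summation over dyadic frequency scales -/

section Dyadic

open scoped FourierTransform SchwartzMap

variable {d : ℕ}

/-- A form of Hölder's inequality that suffices for summing geometric series, with
`sup b ≤ (∑ b ^ p) ^ (1 / p)`. -/
theorem tsum_mul_rpow_le {p : ℝ} (hp : 0 < p) (c b : ℕ → ℝ≥0∞) :
    (∑' j, c j * b j) ^ p ≤ (∑' j, c j) ^ p * ∑' j, b j ^ p := by
  rw [← ENNReal.le_rpow_inv_iff hp, ENNReal.mul_rpow_of_nonneg _ _ (by positivity),
    ENNReal.rpow_rpow_inv hp.ne', ← ENNReal.tsum_mul_right]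
  refine ENNReal.tsum_le_tsum fun j => mul_le_mul' le_rfl ?_
  rw [ENNReal.le_rpow_inv_iff hp]
  exact ENNReal.le_tsum j

theorem tsum_ofReal_geometric {q : ℝ} (hq : 0 ≤ q) (hq1 : q < 1) :
    ∑' j : ℕ, ENNReal.ofReal (q ^ j) = ENNReal.ofReal (1 - q)⁻¹ := by
  rw [← ENNReal.ofReal_tsum_of_nonneg (fun j => by positivity)
    (summable_geometric_of_lt_one hq hq1), tsum_geometric_of_lt_one hq hq1]

/-- A sequence of functions whose `Lᵖ` norms decay geometrically can be summed in `Lᵖ`. -/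
theorem exists_lintegral_tsum_rpow_le {X : Type*} [MeasurableSpace X] {p q : ℝ} (hp : 0 < p)
    (hq : 0 < q) (hq1 : q < 1) : ∃ C : ℝ, 0 < C ∧ ∀ (ν : Measure X) (a : ℕ → X → ℝ≥0∞) (W : ℝ)
      (I : ℝ≥0∞), (∀ j, Measurable (a j)) → 0 ≤ W →
      (∀ j, ∫⁻ x, a j x ^ p ∂ν ≤ ENNReal.ofReal (W * q ^ j) * I) →
      ∫⁻ x, (∑' j, a j x) ^ p ∂ν ≤ ENNReal.ofReal (C * W) * I := by
  -- Half of the decay, `s = √q`, is kept for the integrals; the other half, distributed as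
  -- `τ ^ p = s`, makes the coefficients in Hölder's inequality summable.
  set s : ℝ := q ^ (2⁻¹ : ℝ) with hs
  set τ : ℝ := s ^ p⁻¹ with hτ
  have hs0 : 0 < s := by positivity
  have hs1 : s < 1 := Real.rpow_lt_one hq.le hq1 (by norm_num)
  have hτ0 : 0 < τ := by positivity
  have hτ1 : τ < 1 := Real.rpow_lt_one hs0.le hs1 (by positivity)
  have hτp : τ ^ p = s := Real.rpow_inv_rpow hs0.le hp.ne'
  have hss : s * s = q := by
    rw [hs, ← Real.rpow_add hq]; norm_num
  have h1 : 0 < (1 - τ)⁻¹ := inv_pos.2 (by linarith)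
  have h2 : 0 < (1 - s)⁻¹ := inv_pos.2 (by linarith)
  refine ⟨(1 - τ)⁻¹ ^ p * (1 - s)⁻¹, by positivity, fun ν a W I ha hW h => ?_⟩
  have e : ∀ x, ∑' j, a j x =
      ∑' j, ENNReal.ofReal (τ ^ j) * (ENNReal.ofReal ((τ ^ j)⁻¹) * a j x) := by
    intro x
    refine tsum_congr fun j => ?_
    rw [← mul_assoc, ← ENNReal.ofReal_mul (by positivity), mul_inv_cancel₀ (by positivity),
      ENNReal.ofReal_one, one_mul]
  calc ∫⁻ x, (∑' j, a j x) ^ p ∂ν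
      ≤ ∫⁻ x, ((∑' j, ENNReal.ofReal (τ ^ j)) ^ p *
          ∑' j, (ENNReal.ofReal ((τ ^ j)⁻¹) * a j x) ^ p) ∂ν := by
        refine lintegral_mono fun x => ?_
        rw [e]
        exact tsum_mul_rpow_le hp _ _
    _ = ENNReal.ofReal ((1 - τ)⁻¹ ^ p) *
          ∑' j, ENNReal.ofReal ((s ^ j)⁻¹) * ∫⁻ x, a j x ^ p ∂ν := by
        rw [tsum_ofReal_geometric hτ0.le hτ1, ENNReal.ofReal_rpow_of_nonneg h1.le hp.le,
          lintegral_const_mul' _ _ ENNReal.ofReal_ne_top, lintegral_tsum fun j =>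
            (((ha j).const_mul _).pow_const p).aemeasurable]
        congr 1
        refine tsum_congr fun j => ?_
        rw [← lintegral_const_mul' _ _ ENNReal.ofReal_ne_top]
        refine lintegral_congr fun x => ?_
        rw [ENNReal.mul_rpow_of_nonneg _ _ hp.le, ENNReal.ofReal_rpow_of_nonneg (by positivity)
          hp.le, Real.inv_rpow (by positivity), ← Real.rpow_natCast τ, ← Real.rpow_mul hτ0.le,
          mul_comm (j : ℝ), Real.rpow_mul hτ0.le, hτp, Real.rpow_natCast]
    _ ≤ ENNReal.ofReal ((1 - τ)⁻¹ ^ p) * ∑' j, ENNReal.ofReal (s ^ j) * (ENNReal.ofReal W * I) := by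
        refine mul_le_mul' le_rfl (ENNReal.tsum_le_tsum fun j => ?_)
        refine (mul_le_mul' le_rfl (h j)).trans_eq ?_
        rw [← mul_assoc, ← mul_assoc, ← ENNReal.ofReal_mul (by positivity),
          ← ENNReal.ofReal_mul (by positivity)]
        congr 2
        rw [← hss, mul_pow]
        field_simp
    _ = _ := by
        rw [ENNReal.tsum_mul_right, tsum_ofReal_geometric hs0.le hs1, ← mul_assoc, ← mul_assoc,
          ← ENNReal.ofReal_mul (by positivity), ← ENNReal.ofReal_mul (by positivity)]

/-- The pieces of the decomposition of `Q (r / 2 ^ N)` into the coarse kernel `Q r` and differences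
of kernels at consecutive dyadic scales. -/
noncomputable def dyadicKernel (Q : ℝ → 𝓢(𝔼 d, ℂ)) (r : ℝ) : ℕ → 𝓢(𝔼 d, ℂ)
  | 0 => Q r
  | j + 1 => Q (r / 2 ^ (j + 1)) - Q (2 * (r / 2 ^ (j + 1)))

theorem sum_dyadicKernel (Q : ℝ → 𝓢(𝔼 d, ℂ)) (r : ℝ) (N : ℕ) :
    ∑ j ∈ Finset.range (N + 1), dyadicKernel Q r j = Q (r / 2 ^ N) := by
  induction N with
  | zero => simp [dyadicKernel]
  | succ N ih =>
    rw [Finset.sum_range_succ, ih, dyadicKernel]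
    have : 2 * (r / 2 ^ (N + 1)) = r / 2 ^ N := by
      rw [pow_succ]; field_simp
    rw [this]
    abel

theorem IsMollifier.dyadicKernel_eq_zero {Q : ℝ → 𝓢(𝔼 d, ℂ)} {C : ℝ} (hQ : IsMollifier Q C)
    {r : ℝ} (hr : 0 < r) (j : ℕ) {x : 𝔼 d} (hx : 2 * r < ‖x‖) : dyadicKernel Q r j x = 0 := by
  cases j with
  | zero => exact hQ.eq_zero r hr x (by linarith)
  | succ j =>
    refine hQ.diff_eq_zero (by positivity) (lt_of_le_of_lt ?_ hx)
    have : r / 2 ^ (j + 1) ≤ r := div_le_self hr.le (one_le_pow₀ one_le_two)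
    linarith

theorem IsMollifier.integral_eq_one {Q : ℝ → 𝓢(𝔼 d, ℂ)} {C : ℝ} (hQ : IsMollifier Q C)
    {δ : ℝ} (hδ : 0 < δ) : ∫ x, Q δ x = 1 := by
  have := hQ.fourier_zero δ hδ
  rw [SchwartzMap.fourier_coe, Real.fourier_eq] at this
  simpa only [inner_zero_right, neg_zero, AddChar.map_zero_eq_one, one_smul] using this

theorem IsMollifier.exists_integral_norm_le {Q : ℝ → 𝓢(𝔼 d, ℂ)} {C : ℝ} (hQ : IsMollifier Q C) :
    ∃ M : ℝ, 0 ≤ M ∧ ∀ δ, 0 < δ → ∫ x, ‖Q δ x‖ ≤ M := by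
  have hC := hQ.pos
  refine ⟨C * volume.real (Metric.ball (0 : 𝔼 d) 1), by positivity, fun δ hδ => ?_⟩
  have h0 : ∀ x, x ∉ Metric.closedBall (0 : 𝔼 d) δ → ‖Q δ x‖ = 0 := fun x hx => by
    rw [mem_closedBall_zero_iff, not_le] at hx
    rw [hQ.eq_zero δ hδ x hx, norm_zero]
  rw [← setIntegral_eq_integral_of_forall_compl_eq_zero h0]
  calc ∫ x in Metric.closedBall (0 : 𝔼 d) δ, ‖Q δ x‖
      ≤ ∫ x in Metric.closedBall (0 : 𝔼 d) δ, C / δ ^ d := by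
        refine setIntegral_mono_on (Q δ).integrable.norm.integrableOn ?_
          measurableSet_closedBall fun x _ => hQ.norm_le δ hδ x
        exact integrableOn_const measure_closedBall_lt_top.ne
    _ = C * volume.real (Metric.ball (0 : 𝔼 d) 1) := by
        rw [setIntegral_const, Measure.real, Measure.addHaar_closedBall _ _ hδ.le,
          ENNReal.toReal_mul, ENNReal.toReal_ofReal (by positivity), finrank_euclideanSpace_fin,
          smul_eq_mul, Measure.real]
        field_simp

/-- Uniform approximation of the identity. -/
theorem IsMollifier.exists_norm_smear_sub_le {Q : ℝ → 𝓢(𝔼 d, ℂ)} {C : ℝ} (hQ : IsMollifier Q C)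
    {f : 𝔼 d → ℂ} (hf : Continuous f) (hfs : HasCompactSupport f) {η : ℝ} (hη : 0 < η) :
    ∃ δ₀ : ℝ, 0 < δ₀ ∧ ∀ δ, 0 < δ → δ < δ₀ → ∀ z, ‖smear (Q δ) f z - f z‖ ≤ η := by
  obtain ⟨M, hM, hMQ⟩ := hQ.exists_integral_norm_le
  obtain ⟨δ₀, hδ₀, hu⟩ := Metric.uniformContinuous_iff.1
    (hfs.uniformContinuous_of_continuous hf) (η / (M + 1)) (by positivity)
  refine ⟨δ₀, hδ₀, fun δ hδ hδδ z => ?_⟩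
  have i1 := integrable_mul_schwartz_sub (Q δ) (hf.integrable_of_hasCompactSupport hfs) z
  have i2 : Integrable fun y => Q δ (z - y) := (Q δ).integrable.comp_sub_left z
  have e : smear (Q δ) f z - f z = ∫ y, (f y - f z) * Q δ (z - y) := by
    simp only [sub_mul]
    rw [integral_sub i1 (i2.const_mul _), integral_const_mul, integral_sub_left_eq_self
      (fun y => Q δ y), hQ.integral_eq_one hδ, mul_one, smear_apply]
  rw [e]
  calc ‖∫ y, (f y - f z) * Q δ (z - y)‖ ≤ ∫ y, η / (M + 1) * ‖Q δ (z - y)‖ := by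
        refine norm_integral_le_of_norm_le (i2.norm.const_mul _)
          (Filter.Eventually.of_forall fun y => ?_)
        rw [norm_mul]
        by_cases h : δ < ‖z - y‖
        · rw [hQ.eq_zero δ hδ _ h]; simp
        · refine mul_le_mul_of_nonneg_right ?_ (norm_nonneg _)
          rw [← dist_eq_norm]
          refine (hu ?_).le
          rw [dist_comm, dist_eq_norm]
          linarith
    _ ≤ η / (M + 1) * M := by
        rw [integral_const_mul, integral_sub_left_eq_self (fun y => ‖Q δ y‖)]
        exact mul_le_mul_of_nonneg_left (hMQ δ hδ) (by positivity)
    _ ≤ η := by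
        rw [div_mul_eq_mul_div, div_le_iff₀ (by positivity)]
        nlinarith

theorem IsMollifier.tendsto_sphericalMean_smear (hd : 2 ≤ d) {Q : ℝ → 𝓢(𝔼 d, ℂ)} {C : ℝ}
    (hQ : IsMollifier Q C) {f : 𝔼 d → ℂ} (hf : Continuous f) (hfs : HasCompactSupport f) {r : ℝ}
    (hr : 0 < r) (t : ℝ) (x : 𝔼 d) :
    Filter.Tendsto (fun N : ℕ => sphericalMean t (smear (Q (r / 2 ^ N)) f) x) Filter.atTop
      (nhds (sphericalMean t f x)) := by
  have := isProbabilityMeasure_sphereProb hd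
  rw [Metric.tendsto_atTop]
  intro η hη
  obtain ⟨δ₀, hδ₀, h⟩ := hQ.exists_norm_smear_sub_le hf hfs (half_pos hη)
  have hlim : Filter.Tendsto (fun N : ℕ => r * (2⁻¹ : ℝ) ^ N) Filter.atTop (nhds (r * 0)) :=
    (tendsto_pow_atTop_nhds_zero_of_lt_one (by norm_num) (by norm_num)).const_mul r
  rw [mul_zero] at hlim
  obtain ⟨N, hN⟩ := Filter.eventually_atTop.1 (hlim.eventually_lt_const hδ₀)
  refine ⟨N, fun n hn => ?_⟩
  have hlt : r / 2 ^ n < δ₀ := by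
    have := hN n hn
    rwa [inv_pow, ← div_eq_mul_inv] at this
  have hfi := hf.integrable_of_hasCompactSupport hfs (μ := volume)
  rw [dist_eq_norm]
  have e : sphericalMean t (smear (Q (r / 2 ^ n)) f) x - sphericalMean t f x =
      ∫ ω : Metric.sphere (0 : 𝔼 d) 1, (smear (Q (r / 2 ^ n)) f (x + t • (ω : 𝔼 d)) -
        f (x + t • (ω : 𝔼 d))) ∂sphereProb d :=
    (integral_sub (integrable_sphere_of_continuous hd (continuous_smear _ hfi) t x)
      (integrable_sphere_of_continuous hd hf t x)).symm
  rw [e]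
  have := norm_integral_le_of_norm_le_const (μ := sphereProb d) (Filter.Eventually.of_forall
    fun ω : Metric.sphere (0 : 𝔼 d) 1 => h (r / 2 ^ n) (by positivity) hlt (x + t • (ω : 𝔼 d)))
  rw [probReal_univ, mul_one] at this
  linarith

theorem smear_add_kernel (K L : 𝓢(𝔼 d, ℂ)) {f : 𝔼 d → ℂ} (hf : Integrable f) :
    smear (K + L) f = smear K f + smear L f := by
  ext z
  simp only [Pi.add_apply, smear_apply, _root_.add_apply, mul_add]
  exact integral_add (integrable_mul_schwartz_sub K hf z) (integrable_mul_schwartz_sub L hf z)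

theorem sphericalMean_smear_sum (hd : 2 ≤ d) (K : ℕ → 𝓢(𝔼 d, ℂ)) {f : 𝔼 d → ℂ}
    (hf : Integrable f) (t : ℝ) (x : 𝔼 d) (N : ℕ) :
    sphericalMean t (smear (∑ j ∈ Finset.range N, K j) f) x =
      ∑ j ∈ Finset.range N, sphericalMean t (smear (K j) f) x := by
  induction N with
  | zero => simp [sphericalMean, smear_apply]
  | succ N ih =>
    rw [Finset.sum_range_succ, Finset.sum_range_succ, ← ih, smear_add_kernel _ _ hf]
    exact integral_add (integrable_sphere_of_continuous hd (continuous_smear _ hf) t x)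
      (integrable_sphere_of_continuous hd (continuous_smear _ hf) t x)

/-- Finite range of propagation: a kernel supported in a ball of radius `ρ` only sees `f` at distance
`ρ` from the sphere. -/
theorem sphericalMean_smear_indicator {K : 𝓢(𝔼 d, ℂ)} {ρ t : ℝ} (ht : 0 ≤ t)
    (hK : ∀ x, ρ < ‖x‖ → K x = 0)
    {x : 𝔼 d} {Y : Set (𝔼 d)} (hY : ∀ y, |‖x - y‖ - t| ≤ ρ → y ∈ Y) (f : 𝔼 d → ℂ) :
    sphericalMean t (smear K (Y.indicator f)) x = sphericalMean t (smear K f) x := by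
  refine integral_congr_ae (Filter.Eventually.of_forall fun ω => ?_)
  simp only [smear_apply]
  refine integral_congr_ae (Filter.Eventually.of_forall fun y => ?_)
  by_cases h : ρ < ‖x + t • (ω : 𝔼 d) - y‖
  · simp only [hK _ h, mul_zero]
  · have : y ∈ Y := by
      refine hY y (le_trans ?_ (not_lt.1 h))
      have e : t = ‖-(t • (ω : 𝔼 d))‖ := by
        rw [norm_neg, norm_smul, norm_eq_of_mem_sphere, mul_one, Real.norm_of_nonneg ht]
      conv_lhs => rw [e]
      refine (abs_norm_sub_norm_le _ _).trans_eq ?_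
      congr 1
      abel
    simp only [indicator_of_mem this]

/-- The dyadic decomposition. The function is cut off to `Y` only inside the pieces, so the cut-off
need not be continuous. -/
theorem IsMollifier.sphericalMax_le_tsum (hd : 2 ≤ d) {Q : ℝ → 𝓢(𝔼 d, ℂ)} {C : ℝ}
    (hQ : IsMollifier Q C) {f : 𝔼 d → ℂ} (hf : Continuous f) (hfs : HasCompactSupport f) {r : ℝ}
    (hr : 0 < r) {J : Set ℝ} (hJ : ∀ t ∈ J, 0 ≤ t) {x : 𝔼 d} {Y : Set (𝔼 d)}
    (hY : ∀ t ∈ J, ∀ y, |‖x - y‖ - t| ≤ 2 * r → y ∈ Y) :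
    sphericalMax J f x ≤ ∑' j, sphericalMax J (smear (dyadicKernel Q r j) (Y.indicator f)) x := by
  refine iSup₂_le fun t ht => ?_
  have hfi := hf.integrable_of_hasCompactSupport hfs (μ := volume)
  have hlim := (hQ.tendsto_sphericalMean_smear hd hf hfs hr t x).enorm
  refine le_of_tendsto hlim (Filter.Eventually.of_forall fun N => ?_)
  rw [← sum_dyadicKernel Q, sphericalMean_smear_sum hd _ hfi]
  refine (enorm_sum_le _ _).trans (le_trans ?_ (ENNReal.sum_le_tsum (Finset.range (N + 1))))
  refine Finset.sum_le_sum fun j _ => ?_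
  rw [← sphericalMean_smear_indicator (hJ t ht) (fun x hx => hQ.dyadicKernel_eq_zero hr j hx)
    (hY t ht)]
  exact le_iSup₂ (f := fun t _ =>
    ‖sphericalMean t (smear (dyadicKernel Q r j) (Y.indicator f)) x‖ₑ) t ht

/-- The local maximal estimate: radii in a set `J` of diameter at most `2 * r`, points in a set `G`
whose density in thin shells is `κ`. The bound of the scale `r / 2 ^ j` is assumed to decay like
`q ^ j`. -/
theorem exists_lintegral_sphericalMax_le [NeZero d] (hd : 2 ≤ d) {p q : ℝ} (hp : 1 < p)
    (hp2 : p ≤ 2) (hq : 0 < q) (hq1 : q < 1) :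
    ∃ C : ℝ, 0 < C ∧ ∀ (r : ℝ) (J : Set ℝ) (G Y : Set (𝔼 d)) (κ W : ℝ) (f : 𝔼 d → ℂ),
      0 < r → r ≤ 1 → J ⊆ Icc 1 2 → (∀ s ∈ J, ∀ t ∈ J, |s - t| ≤ 2 * r) →
      MeasurableSet G → MeasurableSet Y → 0 < κ → ThinShells G κ →
      (∀ x ∈ G, ∀ t ∈ J, ∀ y, |‖x - y‖ - t| ≤ 2 * r → y ∈ Y) → κ ≤ W →
      (∀ j : ℕ, 1 ≤ j → ∃ (n : ℕ) (c : Fin n → ℝ), J ⊆ ⋃ i, Icc (c i) (c i + 2 * (r / 2 ^ j)) ∧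
        n * (κ ^ (2 - p) * (r / 2 ^ j) ^ (((d : ℝ) - 1) * (p - 1))) ≤ W * q ^ j) →
      Continuous f → HasCompactSupport f →
      ∫⁻ x in G, sphericalMax J f x ^ p ≤ ENNReal.ofReal (C * W) * ∫⁻ x in Y, ‖f x‖ₑ ^ p := by
  obtain ⟨Q, C₀, hQ⟩ := exists_isMollifier (d := d) hd
  have hp0 : 0 < p := by linarith
  obtain ⟨C₁, hC₁, h₁⟩ := exists_lintegral_iSup_sphericalMean_smear_rpow_le hd C₀ hQ.pos.le p hp.le
  obtain ⟨C₂, hC₂, h₂⟩ := hQ.exists_lintegral_sphericalMax_sub_le_card hd hp hp2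
  obtain ⟨C₃, hC₃, h₃⟩ := exists_lintegral_tsum_rpow_le (X := 𝔼 d) hp0 hq hq1
  refine ⟨C₃ * (C₁ + C₂), by positivity, ?_⟩
  intro r J G Y κ W f hr hr1 hJ hJr hG hY hκ hGκ hGY hκW hcov hf hfs
  rcases J.eq_empty_or_nonempty with rfl | ⟨t₀, ht₀⟩
  · simp [sphericalMax_empty, hp0]
  have hW : 0 < W := hκ.trans_le hκW
  have hfY : Integrable (Y.indicator f) := (hf.integrable_of_hasCompactSupport hfs).indicator hY
  have hfYm : Measurable (Y.indicator f) := hf.measurable.indicator hY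
  have hfY2 : MemLp (Y.indicator f) 2 := (hf.memLp_of_hasCompactSupport hfs).indicator hY
  have eY : ∫⁻ x, ‖Y.indicator f x‖ₑ ^ p = ∫⁻ x in Y, ‖f x‖ₑ ^ p := by
    rw [← lintegral_indicator hY]
    refine lintegral_congr fun x => ?_
    by_cases h : x ∈ Y
    · rw [indicator_of_mem h, indicator_of_mem h]
    · rw [indicator_of_notMem h, indicator_of_notMem h, enorm_zero, ENNReal.zero_rpow_of_pos hp0]
  rw [mul_assoc, ← eY]
  refine le_trans ?_ (h₃ (volume.restrict G)
    (fun j => sphericalMax J (smear (dyadicKernel Q r j) (Y.indicator f))) ((C₁ + C₂) * W) _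
    (fun j => measurable_sphericalMax hd (continuous_smear _ hfY) J) (by positivity) ?_)
  · refine setLIntegral_mono' hG fun x hx => ENNReal.rpow_le_rpow ?_ hp0.le
    exact hQ.sphericalMax_le_tsum hd hf hfs hr (fun t ht => by linarith [(hJ ht).1])
      (hGY x hx)
  · intro j
    cases j with
    | zero =>
      refine (h₁ (Q r) r hr hr1 (fun x hx => hQ.eq_zero r hr x (by linarith))
        (hQ.norm_le r hr) _ hfY.aestronglyMeasurable G κ hG hκ.le hGκ J t₀ (hJ ht₀)
        fun t ht => ⟨hJ ht, hJr t ht t₀ ht₀⟩).trans ?_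
      refine mul_le_mul' (ENNReal.ofReal_le_ofReal ?_) le_rfl
      rw [pow_zero, mul_one]
      calc C₁ * κ ≤ C₁ * W := by gcongr
        _ ≤ (C₁ + C₂) * W := by gcongr; linarith
    | succ j =>
      obtain ⟨n, c, hc, hn⟩ := hcov (j + 1) (by omega)
      have hle : r / 2 ^ (j + 1) ≤ 1 :=
        (div_le_self hr.le (one_le_pow₀ one_le_two)).trans hr1
      refine (h₂ (r / 2 ^ (j + 1)) (by positivity) hle _ hfYm hfY hfY2 G κ hG hκ hGκ J n c hJ
        hc).trans ?_
      refine mul_le_mul' (ENNReal.ofReal_le_ofReal ?_) le_rfl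
      calc _ ≤ C₂ * (W * q ^ (j + 1)) := mul_le_mul_of_nonneg_left hn hC₂.le
        _ ≤ (C₁ + C₂) * (W * q ^ (j + 1)) := by gcongr; linarith
        _ = _ := by ring

end Dyadic

/-! ### Power weights -/

section Weighted

variable {d : ℕ}

theorem lintegral_powerWeight (α : ℝ) {g : 𝔼 d → ℝ≥0∞} (hg : Measurable g) :
    ∫⁻ x, g x ∂powerWeight d α = ∫⁻ x, ENNReal.ofReal (‖x‖ ^ α) * g x :=
  lintegral_withDensity_eq_lintegral_mul _ (by fun_prop) hg

theorem setLIntegral_weight_mul_le {α r : ℝ} (hα : α ≤ 0) (hr : 0 < r) {G : Set (𝔼 d)}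
    (hG : MeasurableSet G) (hGr : ∀ x ∈ G, r ≤ ‖x‖) (g : 𝔼 d → ℝ≥0∞) :
    ∫⁻ x in G, ENNReal.ofReal (‖x‖ ^ α) * g x ≤ ENNReal.ofReal (r ^ α) * ∫⁻ x in G, g x := by
  rw [← lintegral_const_mul' _ _ ENNReal.ofReal_ne_top]
  refine setLIntegral_mono' hG fun x hx => mul_le_mul' (ENNReal.ofReal_le_ofReal ?_) le_rfl
  exact Real.rpow_le_rpow_of_nonpos hr (hGr x hx) hα

/-- As `α ≤ 0`, the weight is bounded below on bounded sets. The origin, where `0 ^ α` is `0` for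
`α < 0`, is a null set. -/
theorem setLIntegral_le_weight_mul (hd : 2 ≤ d) {α R : ℝ} (hα : α ≤ 0) (hR : 0 < R)
    {Y : Set (𝔼 d)} (hY : MeasurableSet Y) (hYR : ∀ x ∈ Y, ‖x‖ ≤ R) (g : 𝔼 d → ℝ≥0∞) :
    ∫⁻ x in Y, g x ≤ ENNReal.ofReal (R ^ (-α)) * ∫⁻ x in Y, ENNReal.ofReal (‖x‖ ^ α) * g x := by
  have : NeZero d := ⟨by omega⟩
  rw [← lintegral_const_mul' _ _ ENNReal.ofReal_ne_top]
  refine lintegral_mono_ae ?_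
  filter_upwards [ae_restrict_mem hY, ae_restrict_of_ae (Measure.ae_ne volume (0 : 𝔼 d))]
    with x hx hx0
  have hx0' : 0 < ‖x‖ := norm_pos_iff.2 hx0
  rw [← mul_assoc, ← ENNReal.ofReal_mul (by positivity)]
  refine le_mul_of_one_le_left' ?_
  rw [← ENNReal.ofReal_one]
  refine ENNReal.ofReal_le_ofReal ?_
  calc (1 : ℝ) = R ^ (-α) * R ^ α := by rw [← Real.rpow_add hR, neg_add_cancel, Real.rpow_zero]
    _ ≤ R ^ (-α) * ‖x‖ ^ α := by
      gcongr ?_ * ?_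
      exact Real.rpow_le_rpow_of_nonpos hx0' (hYR x hx) hα

/-- The concentric shell of radius `a + i * h` and width `K * h`. -/
def annulus (d : ℕ) (a h : ℝ) (K i : ℕ) : Set (𝔼 d) := {y | |‖y‖ - (a + i * h)| ≤ K * h}

theorem measurableSet_annulus (a h : ℝ) (K i : ℕ) : MeasurableSet (annulus d a h K i) :=
  (isClosed_le (by fun_prop) continuous_const).measurableSet

/-- Equally spaced annuli overlap boundedly often. -/
theorem tsum_setLIntegral_annulus_le (a : ℝ) {h : ℝ} (hh : 0 < h) (K : ℕ) {g : 𝔼 d → ℝ≥0∞}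
    (hg : Measurable g) :
    ∑' i, ∫⁻ y in annulus d a h K i, g y ≤ ENNReal.ofReal (2 * K + 1) * ∫⁻ y, g y := by
  have e : ∀ i, ∫⁻ y in annulus d a h K i, g y = ∫⁻ y, (annulus d a h K i).indicator g y :=
    fun i => (lintegral_indicator (measurableSet_annulus _ _ _ _) _).symm
  simp only [e]
  rw [← lintegral_tsum fun i => (hg.indicator (measurableSet_annulus _ _ _ _)).aemeasurable,
    ← lintegral_const_mul _ hg]
  refine lintegral_mono fun y => ?_
  by_cases hne : ∃ i, y ∈ annulus d a h K i
  · classical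
    obtain ⟨hm, hmin⟩ := And.intro (Nat.find_spec hne) (fun i hi => Nat.find_min' hne (m := i) hi)
    set m := Nat.find hne
    have hsupp : ∀ i ∉ Finset.Icc m (m + 2 * K), (annulus d a h K i).indicator g y = 0 := by
      intro i hi
      refine indicator_of_notMem (fun hy => hi ?_) _
      rw [Finset.mem_Icc]
      refine ⟨hmin i hy, ?_⟩
      have hm' : |‖y‖ - (a + m * h)| ≤ K * h := hm
      have hy' : |‖y‖ - (a + i * h)| ≤ K * h := hy
      have h1 := (abs_le.1 hm').2
      have h2 := (abs_le.1 hy').1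
      have h3 : (i : ℝ) * h ≤ (m + 2 * K) * h := by linarith
      exact_mod_cast le_of_mul_le_mul_right h3 hh
    rw [tsum_eq_sum hsupp]
    refine (Finset.sum_le_card_nsmul _ _ (g y) fun i _ => indicator_le_self _ _ _).trans_eq ?_
    rw [Nat.card_Icc, nsmul_eq_mul, ← ENNReal.ofReal_natCast]
    congr 2
    rw [show m + 2 * K + 1 - m = 2 * K + 1 by omega]
    push_cast
    ring
  · rw [not_exists] at hne
    rw [ENNReal.tsum_eq_zero.2 fun i => indicator_of_notMem (hne i) _]
    exact zero_le

/-- The covering condition in terms of Euclidean intervals: the part of `E` in an interval of length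
comparable to `r` is covered by `n` intervals of length comparable to `δ`. -/
def HasCoverings (d : ℕ) (p α ε A : ℝ) (E : Set ℝ) : Prop :=
  ∀ a ∈ Icc (1 : ℝ) 2, ∀ δ r : ℝ, 0 < δ → δ < 1 → δ ≤ r → r ≤ 1 → ∃ (n : ℕ) (c : Fin n → ℝ),
    E ∩ Icc a (a + r / 2) ⊆ ⋃ i, Icc (c i) (c i + 2 * δ) ∧
    n * δ ^ (((d : ℝ) - 1) * (p - 1) - ε) * r ^ (α + ((d : ℝ) - 1) * (2 - p)) ≤ A ^ p

theorem ThinShells.mono {G G' : Set (𝔼 d)} {κ : ℝ} (h : ThinShells G κ) (hG : G' ⊆ G) :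
    ThinShells G' κ :=
  fun y c hc w hw => (measure_mono (inter_subset_inter_left _ hG)).trans (h y c hc w hw)

/-- The local estimate at scale `r`, with the scales counted by the covering condition. -/
theorem exists_lintegral_sphericalMax_piece_le [NeZero d] (hd : 2 ≤ d) {p α ε κ₀ : ℝ} (hp : 1 < p)
    (hp2 : p ≤ 2) (hε : 0 < ε) (hκ₀ : 0 < κ₀) :
    ∃ C : ℝ, 0 < C ∧ ∀ (E : Set ℝ) (A : ℝ), E ⊆ Icc 1 2 → 1 ≤ A → HasCoverings d p α ε A E →
      ∀ (r a : ℝ) (G Y : Set (𝔼 d)) (f : 𝔼 d → ℂ), 0 < r → r ≤ 1 → a ∈ Icc (1 : ℝ) 2 →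
      MeasurableSet G → MeasurableSet Y → ThinShells G (κ₀ * r ^ (d - 1)) →
      (∀ x ∈ G, ∀ t ∈ Icc a (a + r / 2), ∀ y, |‖x - y‖ - t| ≤ 2 * r → y ∈ Y) →
      Continuous f → HasCompactSupport f →
      ∫⁻ x in G, sphericalMax (E ∩ Icc a (a + r / 2)) f x ^ p ≤
        ENNReal.ofReal (C * (A ^ p * r ^ (ε - α))) * ∫⁻ x in Y, ‖f x‖ₑ ^ p := by
  have hp0 : 0 < p := by linarith
  set q : ℝ := 2 ^ (-ε) with hq
  have hq0 : 0 < q := by positivity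
  have hq1 : q < 1 := Real.rpow_lt_one_of_one_lt_of_neg one_lt_two (by linarith)
  obtain ⟨C, hC, h⟩ := exists_lintegral_sphericalMax_le hd hp hp2 hq0 hq1
  refine ⟨C * (κ₀ + κ₀ ^ (2 - p)), by positivity, ?_⟩
  intro E A hE hA hcov r a G Y f hr hr1 ha hG hY hGκ hGY hf hfs
  have hA0 : 0 < A := by linarith
  have hrd : r ^ (d - 1) = r ^ ((d : ℝ) - 1) := by
    rw [← Real.rpow_natCast, Nat.cast_sub (by omega), Nat.cast_one]
  rcases (E ∩ Icc a (a + r / 2)).eq_empty_or_nonempty with he | hne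
  · rw [he]
    simp [sphericalMax_empty, hp0]
  have hW : 0 ≤ A ^ p * r ^ (ε - α) := by positivity
  -- The coarse part needs `r ^ (d - 1) ≤ A ^ p * r ^ (ε - α)`. For `r < 1` this is the covering
  -- condition at `δ = r`, where at least one interval is needed; for `r = 1` it is `1 ≤ A`.
  have hlow : r ^ (d - 1) ≤ A ^ p * r ^ (ε - α) := by
    rcases hr1.eq_or_lt with rfl | hr1
    · rw [one_pow, Real.one_rpow, mul_one]
      exact Real.one_le_rpow hA hp0.le
    · obtain ⟨n, c, hc, hn⟩ := hcov a ha r r hr hr1 le_rfl hr1.le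
      have hn1 : (1 : ℝ) ≤ n := by
        obtain ⟨t, ht⟩ := hne
        obtain ⟨i, -⟩ := mem_iUnion.1 (hc ht)
        exact_mod_cast i.pos
      calc r ^ (d - 1) = 1 * r ^ (((d : ℝ) - 1) * (p - 1) - ε) *
            r ^ (α + ((d : ℝ) - 1) * (2 - p)) * r ^ (ε - α) := by
            rw [hrd, one_mul, ← Real.rpow_add hr, ← Real.rpow_add hr]
            congr 1
            ring
        _ ≤ n * r ^ (((d : ℝ) - 1) * (p - 1) - ε) *
            r ^ (α + ((d : ℝ) - 1) * (2 - p)) * r ^ (ε - α) := by gcongr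
        _ ≤ A ^ p * r ^ (ε - α) := by gcongr
  refine (h r (E ∩ Icc a (a + r / 2)) G Y (κ₀ * r ^ (d - 1))
    ((κ₀ + κ₀ ^ (2 - p)) * (A ^ p * r ^ (ε - α))) f hr hr1 (fun t ht => hE ht.1) ?_ hG hY
    (by positivity) hGκ (fun x hx t ht => hGY x hx t ht.2) ?_ ?_ hf hfs).trans_eq ?_
  · intro s hs t ht
    rw [abs_le]
    constructor <;> linarith [hs.2.1, hs.2.2, ht.2.1, ht.2.2]
  · calc κ₀ * r ^ (d - 1) ≤ κ₀ * (A ^ p * r ^ (ε - α)) := by gcongr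
      _ ≤ _ := by
        gcongr
        have : 0 < κ₀ ^ (2 - p) := by positivity
        linarith
  · intro j hj
    set δ : ℝ := r / 2 ^ j with hδ
    have hδ0 : 0 < δ := by positivity
    have hδr : δ ≤ r := div_le_self hr.le (one_le_pow₀ one_le_two)
    have hδ1 : δ < 1 := by
      refine lt_of_lt_of_le (div_lt_self hr (one_lt_pow₀ one_lt_two (by omega))) hr1
    obtain ⟨n, c, hc, hn⟩ := hcov a ha δ r hδ0 hδ1 hδr hr1
    refine ⟨n, c, hc, ?_⟩
    have e1 : δ ^ ε = r ^ ε * q ^ j := by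
      rw [hδ, Real.div_rpow hr.le (by positivity), hq, ← Real.rpow_natCast (2 ^ (-ε)),
        ← Real.rpow_mul two_pos.le, neg_mul, Real.rpow_neg two_pos.le, ← Real.rpow_natCast,
        ← Real.rpow_mul two_pos.le, mul_comm ε, div_eq_mul_inv]
    calc n * ((κ₀ * r ^ (d - 1)) ^ (2 - p) * δ ^ (((d : ℝ) - 1) * (p - 1)))
        = κ₀ ^ (2 - p) * (n * δ ^ (((d : ℝ) - 1) * (p - 1) - ε) *
            r ^ (α + ((d : ℝ) - 1) * (2 - p))) * (r ^ (-α) * δ ^ ε) := by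
          rw [Real.mul_rpow hκ₀.le (by positivity), hrd, ← Real.rpow_mul hr.le,
            Real.rpow_sub hδ0, Real.rpow_add hr, Real.rpow_neg hr.le]
          field_simp
      _ ≤ κ₀ ^ (2 - p) * A ^ p * (r ^ (-α) * δ ^ ε) := by gcongr
      _ = κ₀ ^ (2 - p) * (A ^ p * r ^ (ε - α)) * q ^ j := by
          rw [e1, Real.rpow_sub hr, Real.rpow_neg hr.le]; field_simp
      _ ≤ (κ₀ + κ₀ ^ (2 - p)) * (A ^ p * r ^ (ε - α)) * q ^ j := by
          gcongr
          linarith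
  · rw [mul_assoc]

/-- The interval `[1, 2]` is covered by intervals of length `2 ^ (-k) / 2`. -/
theorem subset_iUnion_dyadic {E : Set ℝ} (hE : E ⊆ Icc 1 2) (k : ℕ) :
    E ⊆ ⋃ i : Fin (2 ^ (k + 1) + 1), Icc (1 + (i : ℕ) * ((1 / 2 : ℝ) ^ k / 2))
      (1 + (i : ℕ) * ((1 / 2 : ℝ) ^ k / 2) + (1 / 2 : ℝ) ^ k / 2) := by
  intro t ht
  obtain ⟨h1, h2⟩ := hE ht
  set h : ℝ := (1 / 2 : ℝ) ^ k / 2 with hh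
  have hh0 : 0 < h := by positivity
  have hh1 : 2 ^ (k + 1) * h = 1 := by
    rw [hh, pow_succ, one_div, inv_pow]; field_simp
  have hu : 0 ≤ (t - 1) / h := div_nonneg (by linarith) hh0.le
  have hfl := Nat.floor_le hu
  have hlf := Nat.lt_floor_add_one ((t - 1) / h)
  rw [le_div_iff₀ hh0] at hfl
  rw [div_lt_iff₀ hh0] at hlf
  refine mem_iUnion.2 ⟨⟨⌊(t - 1) / h⌋₊, Nat.lt_succ_of_le ?_⟩, ?_, ?_⟩
  · have : (⌊(t - 1) / h⌋₊ : ℝ) * h ≤ 2 ^ (k + 1) * h := by linarith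
    exact_mod_cast le_of_mul_le_mul_right this hh0
  · simp only; linarith
  · simp only; linarith

/-- The estimate for all radii in `E` and points `x` in `G`: the local estimates for the intervals of
length `2 ^ (-k) / 2` are added up. -/
theorem exists_lintegral_sphericalMax_scale_le [NeZero d] (hd : 2 ≤ d) {p α ε κ₀ : ℝ} (hp : 1 < p)
    (hp2 : p ≤ 2) (hε : 0 < ε) (hκ₀ : 0 < κ₀) :
    ∃ C : ℝ, 0 < C ∧ ∀ (E : Set ℝ) (A : ℝ), E ⊆ Icc 1 2 → 1 ≤ A → HasCoverings d p α ε A E →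
      ∀ (k : ℕ) (G : Set (𝔼 d)) (Y : ℕ → Set (𝔼 d)) (f : 𝔼 d → ℂ),
      MeasurableSet G → (∀ i, MeasurableSet (Y i)) →
      ThinShells G (κ₀ * ((1 / 2 : ℝ) ^ k) ^ (d - 1)) →
      (∀ i : ℕ, i ≤ 2 ^ (k + 1) → ∀ x ∈ G, ∀ t, |t - (1 + i * ((1 / 2 : ℝ) ^ k / 2))| ≤
        (1 / 2 : ℝ) ^ k / 2 → ∀ y, |‖x - y‖ - t| ≤ 2 * (1 / 2 : ℝ) ^ k → y ∈ Y i) →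
      Continuous f → HasCompactSupport f →
      ∫⁻ x in G, sphericalMax E f x ^ p ≤
        ENNReal.ofReal (C * (A ^ p * ((1 / 2 : ℝ) ^ k) ^ (ε - α))) *
          ∑ i ∈ Finset.range (2 ^ (k + 1) + 1), ∫⁻ x in Y i, ‖f x‖ₑ ^ p := by
  obtain ⟨C, hC, h⟩ := exists_lintegral_sphericalMax_piece_le (α := α) hd hp hp2 hε hκ₀
  refine ⟨C, hC, fun E A hE hA hcov k G Y f hG hY hGκ hGY hf hfs => ?_⟩
  refine (lintegral_sphericalMax_rpow_le_sum hd hf (by linarith) _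
    (subset_iUnion_dyadic hE k)).trans ?_
  rw [Finset.mul_sum, ← Fin.sum_univ_eq_sum_range (fun i : ℕ =>
    ENNReal.ofReal (C * (A ^ p * ((1 / 2 : ℝ) ^ k) ^ (ε - α))) * ∫⁻ x in Y i, ‖f x‖ₑ ^ p)]
  refine Finset.sum_le_sum fun i _ => ?_
  have hi : (i : ℕ) ≤ 2 ^ (k + 1) := Nat.le_of_lt_succ i.2
  have hr : 0 < (1 / 2 : ℝ) ^ k := by positivity
  have hr1 : (1 / 2 : ℝ) ^ k ≤ 1 := pow_le_one₀ (by norm_num) (by norm_num)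
  have hi' : ((i : ℕ) : ℝ) * ((1 / 2 : ℝ) ^ k / 2) ≤ 1 := by
    have h1 : (2 : ℝ) ^ (k + 1) * ((1 / 2 : ℝ) ^ k / 2) = 1 := by
      rw [pow_succ, one_div, inv_pow]; field_simp
    refine le_trans (mul_le_mul_of_nonneg_right ?_ (by positivity)) h1.le
    exact_mod_cast hi
  have hi0 : 0 ≤ ((i : ℕ) : ℝ) * ((1 / 2 : ℝ) ^ k / 2) := by positivity
  refine h E A hE hA hcov _ _ G (Y i) f hr hr1 ⟨by linarith, by linarith⟩ hG (hY i) hGκ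
    (fun x hx t ht y hy => hGY i hi x hx t ?_ y hy) hf hfs
  rw [abs_le]
  constructor <;> linarith [ht.1, ht.2]

end Weighted

/-! ### The weighted estimate for continuous functions of compact support -/

section CompactSupport

variable {d : ℕ}

theorem exists_near_or_far {x : 𝔼 d} (hx : x ≠ 0) :
    (∃ m : ℕ, (1 / 2 : ℝ) ^ (m + 1) ≤ ‖x‖ ∧ ‖x‖ ≤ 2 * (1 / 2 : ℝ) ^ (m + 1)) ∨
      ∃ n : ℕ, (n : ℝ) + 1 ≤ ‖x‖ ∧ ‖x‖ ≤ n + 2 := by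
  rcases le_total ‖x‖ 1 with h | h
  · obtain ⟨m, h1, h2⟩ := exists_nat_pow_near_of_lt_one (norm_pos_iff.2 hx) h
      (by norm_num : (0 : ℝ) < 1 / 2) (by norm_num)
    refine Or.inl ⟨m, h1.le, h2.trans_eq ?_⟩
    rw [pow_succ]; ring
  · refine Or.inr ⟨⌊‖x‖ - 1⌋₊, ?_, ?_⟩
    · linarith [Nat.floor_le (sub_nonneg.2 h)]
    · linarith [Nat.lt_floor_add_one (‖x‖ - 1)]

/-- Decomposition of space into dyadic shells inside the unit ball and shells of width one outside. -/
theorem lintegral_le_tsum_near_add_tsum_far (hd : 2 ≤ d) (g : 𝔼 d → ℝ≥0∞) :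
    ∫⁻ x, g x ≤
      (∑' m : ℕ, ∫⁻ x in {x : 𝔼 d | (1 / 2 : ℝ) ^ (m + 1) ≤ ‖x‖ ∧ ‖x‖ ≤ 2 * (1 / 2 : ℝ) ^ (m + 1)},
        g x) + ∑' n : ℕ, ∫⁻ x in {x : 𝔼 d | (n : ℝ) + 1 ≤ ‖x‖ ∧ ‖x‖ ≤ n + 2}, g x := by
  have : NeZero d := ⟨by omega⟩
  set S := ⋃ m : ℕ, {x : 𝔼 d | (1 / 2 : ℝ) ^ (m + 1) ≤ ‖x‖ ∧ ‖x‖ ≤ 2 * (1 / 2 : ℝ) ^ (m + 1)}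
  set T := ⋃ n : ℕ, {x : 𝔼 d | (n : ℝ) + 1 ≤ ‖x‖ ∧ ‖x‖ ≤ n + 2}
  calc ∫⁻ x, g x = ∫⁻ x in S ∪ T, g x := by
        rw [← setLIntegral_univ]
        refine setLIntegral_congr ?_
        filter_upwards [Measure.ae_ne volume (0 : 𝔼 d)] with x hx
        refine propext ⟨fun _ => ?_, fun _ => mem_univ x⟩
        rcases exists_near_or_far hx with ⟨m, hm⟩ | ⟨n, hn⟩
        · exact Or.inl (mem_iUnion.2 ⟨m, hm⟩)
        · exact Or.inr (mem_iUnion.2 ⟨n, hn⟩)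
    _ ≤ (∫⁻ x in S, g x) + ∫⁻ x in T, g x := lintegral_union_le _ _ _
    _ ≤ _ := add_le_add (lintegral_iUnion_le _ _) (lintegral_iUnion_le _ _)

theorem measurableSet_norm_Icc (a b : ℝ) : MeasurableSet {x : 𝔼 d | a ≤ ‖x‖ ∧ ‖x‖ ≤ b} :=
  ((isClosed_le continuous_const continuous_norm).inter
    (isClosed_le continuous_norm continuous_const)).measurableSet

/-- The maximal inequality for continuous functions of compact support. Points `x` with
`‖x‖ ≈ r ≤ 1` only see values of `f` in annuli of width about `r` when the radii are restricted to
an interval of length `r / 2`; points with `‖x‖ ≥ 1` only see values at comparable distance from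
the origin. -/
theorem exists_lintegral_weight_sphericalMax_le [NeZero d] (hd : 2 ≤ d) {p α ε : ℝ} (hp : 1 < p)
    (hp2 : p ≤ 2) (hα : α ≤ 0) (hε : 0 < ε) :
    ∃ C : ℝ, 0 < C ∧ ∀ (E : Set ℝ) (A : ℝ), E ⊆ Icc 1 2 → 1 ≤ A → HasCoverings d p α ε A E →
      ∀ f : 𝔼 d → ℂ, Continuous f → HasCompactSupport f →
      ∫⁻ x, ENNReal.ofReal (‖x‖ ^ α) * sphericalMax E f x ^ p ≤
        ENNReal.ofReal (C * A ^ p) * ∫⁻ x, ENNReal.ofReal (‖x‖ ^ α) * ‖f x‖ₑ ^ p := by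
  have hp0 : 0 < p := by linarith
  obtain ⟨κ₀, hκ₀, hκfar, hκnear⟩ := exists_thinShells hd
  obtain ⟨C, hC, h⟩ := exists_lintegral_sphericalMax_scale_le (α := α) hd hp hp2 hε hκ₀
  set q : ℝ := (1 / 2) ^ ε with hq
  have hq0 : 0 < q := by positivity
  have hq1 : q < 1 := Real.rpow_lt_one (by norm_num) (by norm_num) hε
  have hq1' : 0 < (1 - q)⁻¹ := inv_pos.2 (by linarith)
  refine ⟨C * 5 ^ (-α) * 21 * (1 - q)⁻¹ + C * (3 * 7 ^ (-α)) * 15, by positivity, ?_⟩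
  intro E A hE hA hcov f hf hfs
  have hA0 : 0 < A := by linarith
  set w : 𝔼 d → ℝ≥0∞ := fun x => ENNReal.ofReal (‖x‖ ^ α) with hw
  have hwm : Measurable fun x : 𝔼 d => w x * ‖f x‖ₑ ^ p :=
    (by fun_prop : Measurable w).mul (hf.enorm.measurable.pow_const p)
  set I := ∫⁻ x, w x * ‖f x‖ₑ ^ p
  -- Shells inside the unit ball: `5 * r = 10 * (r / 2)` is the width of the annuli, `5` bounds the
  -- norm on them, and `21 = 2 * 10 + 1` is their overlap.
  have hnear : ∀ m : ℕ,
      ∫⁻ x in {x : 𝔼 d | (1 / 2 : ℝ) ^ (m + 1) ≤ ‖x‖ ∧ ‖x‖ ≤ 2 * (1 / 2 : ℝ) ^ (m + 1)},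
        w x * sphericalMax E f x ^ p ≤
      ENNReal.ofReal (q ^ m) * (ENNReal.ofReal (C * 5 ^ (-α) * 21 * A ^ p) * I) := by
    intro m
    set r : ℝ := (1 / 2 : ℝ) ^ (m + 1) with hr
    have hr0 : 0 < r := by positivity
    have hr2 : r ≤ 1 / 2 := pow_le_of_le_one (by norm_num) (by norm_num) (by omega)
    set G := {x : 𝔼 d | r ≤ ‖x‖ ∧ ‖x‖ ≤ 2 * r}
    have hG : MeasurableSet G := measurableSet_norm_Icc _ _
    have hih : ∀ i : ℕ, i ≤ 2 ^ (m + 1 + 1) → (i : ℝ) * (r / 2) ≤ 1 := by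
      intro i hi
      have h1 : (2 : ℝ) ^ (m + 1 + 1) * (r / 2) = 1 := by
        rw [hr, pow_succ 2 (m + 1), one_div, inv_pow]; field_simp
      refine le_trans (mul_le_mul_of_nonneg_right ?_ (by positivity)) h1.le
      exact_mod_cast hi
    calc ∫⁻ x in G, w x * sphericalMax E f x ^ p
        ≤ ENNReal.ofReal (r ^ α) * ∫⁻ x in G, sphericalMax E f x ^ p :=
          setLIntegral_weight_mul_le hα hr0 hG (fun x hx => hx.1) _
      _ ≤ ENNReal.ofReal (r ^ α) * (ENNReal.ofReal (C * (A ^ p * r ^ (ε - α))) *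
          ∑ i ∈ Finset.range (2 ^ (m + 1 + 1) + 1),
            ∫⁻ x in annulus d 1 (r / 2) 10 i, ‖f x‖ₑ ^ p) := by
          refine mul_le_mul' le_rfl (h E A hE hA hcov (m + 1) G _ f hG
            (fun i => measurableSet_annulus _ _ _ _) ?_ ?_ hf hfs)
          · exact (hκnear r hr0).mono fun x hx => mem_closedBall_zero_iff.2 hx.2
          · intro i _ x hx t ht y hy
            have h1 := abs_le.1 ht
            have h2 := abs_le.1 hy
            have h3 := abs_le.1 (abs_norm_sub_norm_le x y)
            have h4 : ‖x - y‖ ≤ ‖x‖ + ‖y‖ := norm_sub_le _ _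
            have h5 := hx.2
            change |‖y‖ - (1 + i * (r / 2))| ≤ (10 : ℕ) * (r / 2)
            rw [abs_le]
            push_cast
            constructor <;> linarith [h1.1, h1.2, h2.1, h2.2, h3.1, h3.2]
      _ ≤ ENNReal.ofReal (r ^ α) * (ENNReal.ofReal (C * (A ^ p * r ^ (ε - α))) *
          (ENNReal.ofReal (5 ^ (-α)) * (ENNReal.ofReal 21 * I))) := by
          refine mul_le_mul' le_rfl (mul_le_mul' le_rfl ?_)
          calc ∑ i ∈ Finset.range (2 ^ (m + 1 + 1) + 1),
                ∫⁻ x in annulus d 1 (r / 2) 10 i, ‖f x‖ₑ ^ p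
              ≤ ∑ i ∈ Finset.range (2 ^ (m + 1 + 1) + 1), ENNReal.ofReal (5 ^ (-α)) *
                  ∫⁻ x in annulus d 1 (r / 2) 10 i, w x * ‖f x‖ₑ ^ p := by
                refine Finset.sum_le_sum fun i hi => ?_
                refine setLIntegral_le_weight_mul hd hα (by norm_num)
                  (measurableSet_annulus _ _ _ _) (fun x hx => ?_) _
                have hx' : |‖x‖ - (1 + i * (r / 2))| ≤ (10 : ℕ) * (r / 2) := hx
                have := (abs_le.1 hx').2
                push_cast at this
                linarith [hih i (Nat.le_of_lt_succ (Finset.mem_range.1 hi))]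
            _ ≤ ENNReal.ofReal (5 ^ (-α)) *
                  ∑' i, ∫⁻ x in annulus d 1 (r / 2) 10 i, w x * ‖f x‖ₑ ^ p := by
                rw [← Finset.mul_sum]
                exact mul_le_mul' le_rfl (ENNReal.sum_le_tsum _)
            _ ≤ ENNReal.ofReal (5 ^ (-α)) * (ENNReal.ofReal 21 * I) := by
                refine mul_le_mul' le_rfl ((tsum_setLIntegral_annulus_le 1 (by positivity) 10
                  hwm).trans_eq ?_)
                norm_num
                rfl
      _ = ENNReal.ofReal (q ^ (m + 1)) * (ENNReal.ofReal (C * 5 ^ (-α) * 21 * A ^ p) * I) := by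
          simp only [← mul_assoc]
          rw [← ENNReal.ofReal_mul (by positivity), ← ENNReal.ofReal_mul (by positivity),
            ← ENNReal.ofReal_mul (by positivity), ← ENNReal.ofReal_mul (by positivity)]
          congr 2
          have e : q ^ (m + 1) = r ^ ε := by
            rw [hq, hr, ← Real.rpow_natCast, ← Real.rpow_natCast, ← Real.rpow_mul (by norm_num),
              ← Real.rpow_mul (by norm_num), mul_comm]
          rw [e, Real.rpow_sub hr0]
          field_simp
      _ ≤ _ := by
          refine mul_le_mul' (ENNReal.ofReal_le_ofReal ?_) le_rfl
          exact pow_le_pow_of_le_one hq0.le hq1.le (Nat.le_succ m)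
  -- Shells outside the unit ball, with `r = 1`; the three intervals of radii are all estimated with
  -- the same annulus.
  have hfar : ∀ n : ℕ, ∫⁻ x in {x : 𝔼 d | (n : ℝ) + 1 ≤ ‖x‖ ∧ ‖x‖ ≤ n + 2},
        w x * sphericalMax E f x ^ p ≤ ENNReal.ofReal (C * (3 * 7 ^ (-α)) * A ^ p) *
          ∫⁻ x in annulus d 0 1 7 n, w x * ‖f x‖ₑ ^ p := by
    intro n
    set G := {x : 𝔼 d | (n : ℝ) + 1 ≤ ‖x‖ ∧ ‖x‖ ≤ n + 2}
    have hG : MeasurableSet G := measurableSet_norm_Icc _ _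
    have hn0 : (0 : ℝ) < n + 1 := by positivity
    calc ∫⁻ x in G, w x * sphericalMax E f x ^ p
        ≤ ENNReal.ofReal ((n + 1 : ℝ) ^ α) * ∫⁻ x in G, sphericalMax E f x ^ p :=
          setLIntegral_weight_mul_le hα hn0 hG (fun x hx => hx.1) _
      _ ≤ ENNReal.ofReal ((n + 1 : ℝ) ^ α) *
          (ENNReal.ofReal (C * (A ^ p * ((1 / 2 : ℝ) ^ 0) ^ (ε - α))) *
          ∑ i ∈ Finset.range (2 ^ (0 + 1) + 1), ∫⁻ x in annulus d 0 1 7 n, ‖f x‖ₑ ^ p) := by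
          refine mul_le_mul' le_rfl (h E A hE hA hcov 0 G _ f hG
            (fun i => measurableSet_annulus _ _ _ _) ?_ ?_ hf hfs)
          · rw [pow_zero, one_pow, mul_one]
            exact hκfar.mono (subset_univ _)
          · intro i hi x hx t ht y hy
            have hi' : (i : ℝ) ≤ 2 := by exact_mod_cast hi
            have hi0 : (0 : ℝ) ≤ i := by positivity
            rw [pow_zero] at ht hy
            have h1 := abs_le.1 ht
            have h2 := abs_le.1 hy
            have h3 := abs_le.1 (abs_norm_sub_norm_le x y)
            have h5 := hx.1
            have h6 := hx.2
            change |‖y‖ - (0 + n * 1)| ≤ (7 : ℕ) * 1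
            rw [abs_le]
            push_cast
            constructor <;> linarith [h1.1, h1.2, h2.1, h2.2, h3.1, h3.2]
      _ ≤ ENNReal.ofReal ((n + 1 : ℝ) ^ α) * (ENNReal.ofReal (C * A ^ p) *
          (ENNReal.ofReal 3 * (ENNReal.ofReal ((7 * (n + 1 : ℝ)) ^ (-α)) *
            ∫⁻ x in annulus d 0 1 7 n, w x * ‖f x‖ₑ ^ p))) := by
          rw [pow_zero, Real.one_rpow, mul_one, Finset.sum_const, Finset.card_range, nsmul_eq_mul]
          refine mul_le_mul' le_rfl (mul_le_mul' le_rfl (mul_le_mul' (by norm_num) ?_))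
          refine setLIntegral_le_weight_mul hd hα (by positivity)
            (measurableSet_annulus _ _ _ _) (fun x hx => ?_) _
          have hx' : |‖x‖ - (0 + n * 1)| ≤ (7 : ℕ) * 1 := hx
          have := (abs_le.1 hx').2
          push_cast at this
          linarith [(Nat.cast_nonneg n : (0 : ℝ) ≤ n)]
      _ = _ := by
          simp only [← mul_assoc]
          rw [← ENNReal.ofReal_mul (by positivity), ← ENNReal.ofReal_mul (by positivity),
            ← ENNReal.ofReal_mul (by positivity)]
          congr 2
          rw [Real.mul_rpow (by norm_num) hn0.le, Real.rpow_neg hn0.le]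
          field_simp
  calc ∫⁻ x, w x * sphericalMax E f x ^ p
      ≤ _ := lintegral_le_tsum_near_add_tsum_far hd _
    _ ≤ (∑' m : ℕ, ENNReal.ofReal (q ^ m) * (ENNReal.ofReal (C * 5 ^ (-α) * 21 * A ^ p) * I)) +
          ∑' n : ℕ, ENNReal.ofReal (C * (3 * 7 ^ (-α)) * A ^ p) *
            ∫⁻ x in annulus d 0 1 7 n, w x * ‖f x‖ₑ ^ p :=
        add_le_add (ENNReal.tsum_le_tsum hnear) (ENNReal.tsum_le_tsum hfar)
    _ ≤ ENNReal.ofReal (1 - q)⁻¹ * (ENNReal.ofReal (C * 5 ^ (-α) * 21 * A ^ p) * I) +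
          ENNReal.ofReal (C * (3 * 7 ^ (-α)) * A ^ p) * (ENNReal.ofReal 15 * I) := by
        rw [ENNReal.tsum_mul_right, tsum_ofReal_geometric hq0.le hq1, ENNReal.tsum_mul_left]
        refine add_le_add le_rfl (mul_le_mul' le_rfl ?_)
        refine (tsum_setLIntegral_annulus_le 0 one_pos 7 hwm).trans_eq ?_
        norm_num
        rfl
    _ = _ := by
        rw [← mul_assoc, ← mul_assoc, ← ENNReal.ofReal_mul (by positivity),
          ← ENNReal.ofReal_mul (by positivity), ← add_mul,
          ← ENNReal.ofReal_add (by positivity) (by positivity)]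
        congr 2
        ring

end CompactSupport

/-! ### Entropy numbers and coverings -/

section Entropy

/-- The infimum defining the entropy number is attained as soon as some finite covering exists. -/
theorem entropyNumber_spec {ρ : ℝ → ℝ → ℝ} {S : Set ℝ} {δ : ℝ}
    (h : ∃ (n : ℕ) (a b : Fin n → ℝ), (∀ i, 0 < a i ∧ a i ≤ b i ∧ ρ (a i) (b i) = δ) ∧
      S ⊆ ⋃ i, Icc (a i) (b i)) :
    ∃ a b : Fin (entropyNumber ρ S δ) → ℝ, (∀ i, 0 < a i ∧ a i ≤ b i ∧ ρ (a i) (b i) = δ) ∧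
      S ⊆ ⋃ i, Icc (a i) (b i) :=
  Nat.sInf_mem h

theorem mulDist_eq {a b : ℝ} (ha : 0 < a) (hab : a ≤ b) : mulDist a b = Real.logb 2 (b / a) := by
  have h : Real.logb 2 (a / b) = -Real.logb 2 (b / a) := by
    rw [← Real.logb_inv, inv_div]
  rw [mulDist, h, abs_neg, abs_of_nonneg]
  exact Real.logb_nonneg one_lt_two ((one_le_div ha).2 hab)

theorem mulDist_mul_rpow {a s : ℝ} (ha : 0 < a) (hs : 0 ≤ s) : mulDist a (a * 2 ^ s) = s := by
  rw [mulDist_eq ha (le_mul_of_one_le_right ha.le (Real.one_le_rpow one_le_two hs)),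
    mul_div_cancel_left₀ _ ha.ne', Real.logb_rpow two_pos (by norm_num)]

theorem eq_mul_rpow_of_mulDist_eq {a b s : ℝ} (ha : 0 < a) (hab : a ≤ b) (h : mulDist a b = s) :
    b = a * 2 ^ s := by
  rw [mulDist_eq ha hab] at h
  rw [← h, Real.rpow_logb two_pos (by norm_num) (div_pos (ha.trans_le hab) ha)]
  field_simp

theorem exists_cover_dist {S : Set ℝ} (hS : S ⊆ Icc 1 2) {δ : ℝ} (hδ : 0 < δ) :
    ∃ (n : ℕ) (a b : Fin n → ℝ), (∀ i, 0 < a i ∧ a i ≤ b i ∧ dist (a i) (b i) = δ) ∧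
      S ⊆ ⋃ i, Icc (a i) (b i) := by
  refine ⟨⌊1 / δ⌋₊ + 1, fun i => 1 + (i : ℕ) * δ, fun i => 1 + (i : ℕ) * δ + δ, fun i => ?_, ?_⟩
  · refine ⟨by positivity, by linarith, ?_⟩
    rw [dist_comm, Real.dist_eq, add_sub_cancel_left, abs_of_pos hδ]
  · intro t ht
    obtain ⟨h1, h2⟩ := hS ht
    have hu : 0 ≤ (t - 1) / δ := div_nonneg (by linarith) hδ.le
    have hfl := (le_div_iff₀ hδ).1 (Nat.floor_le hu)
    have hlf := (div_lt_iff₀ hδ).1 (Nat.lt_floor_add_one ((t - 1) / δ))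
    refine mem_iUnion.2 ⟨⟨⌊(t - 1) / δ⌋₊, Nat.lt_succ_of_le (Nat.floor_le_floor ?_)⟩, ?_, ?_⟩
    · gcongr; linarith
    · simp only; linarith
    · simp only; linarith

theorem exists_cover_mulDist {S : Set ℝ} (hS : S ⊆ Icc 1 2) {δ : ℝ} (hδ : 0 < δ) :
    ∃ (n : ℕ) (a b : Fin n → ℝ), (∀ i, 0 < a i ∧ a i ≤ b i ∧ mulDist (a i) (b i) = δ) ∧
      S ⊆ ⋃ i, Icc (a i) (b i) := by
  refine ⟨⌊1 / δ⌋₊ + 1, fun i => 2 ^ ((i : ℕ) * δ), fun i => 2 ^ ((i : ℕ) * δ) * 2 ^ δ,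
    fun i => ?_, ?_⟩
  · exact ⟨by positivity,
      le_mul_of_one_le_right (by positivity) (Real.one_le_rpow one_le_two hδ.le),
      mulDist_mul_rpow (by positivity) hδ.le⟩
  · intro t ht
    obtain ⟨h1, h2⟩ := hS ht
    have ht0 : 0 < t := by linarith
    have ht : (2 : ℝ) ^ Real.logb 2 t = t := Real.rpow_logb two_pos (by norm_num) ht0
    have hl0 : 0 ≤ Real.logb 2 t := Real.logb_nonneg one_lt_two h1
    have hl1 : Real.logb 2 t ≤ 1 := by
      rw [Real.logb_le_iff_le_rpow one_lt_two ht0, Real.rpow_one]; exact h2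
    have hu : 0 ≤ Real.logb 2 t / δ := div_nonneg hl0 hδ.le
    have hfl := (le_div_iff₀ hδ).1 (Nat.floor_le hu)
    have hlf := (div_lt_iff₀ hδ).1 (Nat.lt_floor_add_one (Real.logb 2 t / δ))
    refine mem_iUnion.2
      ⟨⟨⌊Real.logb 2 t / δ⌋₊, Nat.lt_succ_of_le (Nat.floor_le_floor ?_)⟩, ?_, ?_⟩
    · gcongr
    · simp only
      conv_rhs => rw [← ht]
      exact Real.rpow_le_rpow_of_exponent_le one_le_two hfl
    · simp only
      conv_lhs => rw [← ht]
      rw [← Real.rpow_add two_pos]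
      exact Real.rpow_le_rpow_of_exponent_le one_le_two (by linarith)

theorem two_rpow_le_one_add {s : ℝ} (hs : 0 ≤ s) (hs1 : s ≤ 1) : (2 : ℝ) ^ s ≤ 1 + s := by
  have := rpow_one_add_le_one_add_mul_self (s := 1) (by norm_num) hs hs1
  norm_num at this
  exact this

theorem one_add_half_le_two_rpow (s : ℝ) (hs : 0 ≤ s) : 1 + s / 2 ≤ (2 : ℝ) ^ s := by
  rw [Real.rpow_def_of_pos two_pos]
  have h1 := Real.add_one_le_exp (Real.log 2 * s)
  have h2 := Real.log_two_gt_d9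
  nlinarith

/-- The entropy condition, for either metric, gives coverings by Euclidean intervals. For the
multiplicative metric, an interval of diameter `r` starting at `a ≥ 1` contains `[a, a + r / 2]`, and
an interval of diameter `δ` starting below `2` has length at most `2 * δ`. -/
theorem hasCoverings_of_entropyNumber {d : ℕ} {p α ε A : ℝ} {ρ : ℝ → ℝ → ℝ}
    (hρ : ρ = dist ∨ ρ = mulDist) {E : Set ℝ} (hE : E ⊆ Icc 1 2)
    (h : ∀ δ : ℝ, 0 < δ → δ < 1 → ∀ a b : ℝ, 0 < a → a ≤ b → δ ≤ ρ a b → ρ a b ≤ 1 →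
      (entropyNumber ρ (E ∩ Set.Icc a b) δ : ℝ) * δ ^ (((d : ℝ) - 1) * (p - 1) - ε) *
        (ρ a b) ^ (α + ((d : ℝ) - 1) * (2 - p)) ≤ A ^ p) : HasCoverings d p α ε A E := by
  intro a ha δ r hδ hδ1 hδr hr1
  have ha0 : 0 < a := by linarith [ha.1]
  have hr0 : 0 < r := hδ.trans_le hδr
  rcases hρ with rfl | rfl
  · have hab : dist a (a + r) = r := by
      rw [dist_comm, Real.dist_eq, add_sub_cancel_left, abs_of_pos hr0]
    have key := h δ hδ hδ1 a (a + r) ha0 (by linarith) (by rw [hab]; exact hδr)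
      (by rw [hab]; exact hr1)
    rw [hab] at key
    obtain ⟨c, b, hcb, hcov⟩ := entropyNumber_spec (exists_cover_dist
      (S := E ∩ Icc a (a + r)) (fun t ht => hE ht.1) hδ)
    refine ⟨_, c, fun t ht => ?_, key⟩
    obtain ⟨i, hi⟩ := mem_iUnion.1 (hcov ⟨ht.1, ht.2.1, by linarith [ht.2.2]⟩)
    obtain ⟨-, h2, h3⟩ := hcb i
    rw [dist_comm, Real.dist_eq, abs_of_nonneg (by linarith)] at h3
    exact mem_iUnion.2 ⟨i, hi.1, by linarith [hi.2]⟩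
  · have hab : mulDist a (a * 2 ^ r) = r := mulDist_mul_rpow ha0 hr0.le
    have hle : a + r / 2 ≤ a * 2 ^ r := by
      have := one_add_half_le_two_rpow r hr0.le
      nlinarith [ha.1]
    have key := h δ hδ hδ1 a (a * 2 ^ r) ha0 (by linarith) (by rw [hab]; exact hδr)
      (by rw [hab]; exact hr1)
    rw [hab] at key
    obtain ⟨c, b, hcb, hcov⟩ := entropyNumber_spec (exists_cover_mulDist
      (S := E ∩ Icc a (a * 2 ^ r)) (fun t ht => hE ht.1) hδ)
    refine ⟨_, c, fun t ht => ?_, key⟩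
    obtain ⟨i, hi⟩ := mem_iUnion.1 (hcov ⟨ht.1, ht.2.1, by linarith [ht.2.2]⟩)
    obtain ⟨h1, h2, h3⟩ := hcb i
    refine mem_iUnion.2 ⟨i, hi.1, hi.2.trans ?_⟩
    rw [eq_mul_rpow_of_mulDist_eq h1 h2 h3]
    have hc2 : c i ≤ 2 := hi.1.trans (hE ht.1).2
    have := two_rpow_le_one_add hδ.le hδ1.le
    nlinarith

theorem one_le_card_of_subset_iUnion {E : Set ℝ} {t a b : ℝ} {n : ℕ} {I : Fin n → Set ℝ} (ht : t ∈ E)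
    (ha : t ∈ Icc a b) (h : E ∩ Icc a b ⊆ ⋃ i, I i) : (1 : ℝ) ≤ n := by
  obtain ⟨i, -⟩ := mem_iUnion.1 (h ⟨ht, ha⟩)
  exact_mod_cast i.pos

/-- A power with negative exponent is unbounded near zero. -/
theorem exists_lt_rpow {s : ℝ} (hs : s < 0) (B : ℝ) : ∃ δ : ℝ, 0 < δ ∧ δ < 1 ∧ B < δ ^ s := by
  have h1 := tendsto_rpow_neg_nhdsGT_zero hs
  obtain ⟨δ, h2, h3⟩ := ((h1.eventually_gt_atTop B).and
    (Ioo_mem_nhdsGT (one_pos : (0 : ℝ) < 1))).exists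
  exact ⟨δ, h3.1, h3.2, h2⟩

/-- The covering condition at equal scales `δ = r` bounds the exponent of the weight from below. -/
theorem HasCoverings.le_exponent {d : ℕ} {p α ε A : ℝ} {E : Set ℝ} (hE : E ⊆ Icc 1 2)
    (hne : E.Nonempty) (h : HasCoverings d p α ε A E) : 0 ≤ (d : ℝ) - 1 - ε + α := by
  obtain ⟨t, ht⟩ := hne
  by_contra! hlt
  obtain ⟨r, hr0, hr1, hr⟩ := exists_lt_rpow hlt (A ^ p)
  obtain ⟨n, c, hc, hn⟩ := h t (hE ht) r r hr0 hr1 le_rfl hr1.le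
  have hn1 := one_le_card_of_subset_iUnion ht ⟨le_rfl, by linarith⟩ hc
  refine absurd hr (not_lt.2 (le_trans ?_ hn))
  rw [mul_assoc, ← Real.rpow_add hr0, show ((d : ℝ) - 1) * (p - 1) - ε +
    (α + ((d : ℝ) - 1) * (2 - p)) = (d : ℝ) - 1 - ε + α by ring]
  exact le_mul_of_one_le_left (by positivity) hn1

/-- The covering condition at `r = 1` forces `p > 1`. -/
theorem HasCoverings.ne_one {d : ℕ} {p α ε A : ℝ} {E : Set ℝ} (hε : 0 < ε) (hE : E ⊆ Icc 1 2)
    (hne : E.Nonempty) (h : HasCoverings d p α ε A E) : p ≠ 1 := by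
  rintro rfl
  obtain ⟨t, ht⟩ := hne
  obtain ⟨δ, hδ0, hδ1, hδ⟩ := exists_lt_rpow (by linarith : -ε < 0) (A ^ (1 : ℝ))
  obtain ⟨n, c, hc, hn⟩ := h t (hE ht) δ 1 hδ0 hδ1 hδ1.le le_rfl
  have hn1 := one_le_card_of_subset_iUnion ht ⟨le_rfl, by linarith⟩ hc
  refine absurd hδ (not_lt.2 (le_trans ?_ hn))
  rw [Real.one_rpow, mul_one, sub_self, mul_zero, zero_sub]
  exact le_mul_of_one_le_left (by positivity) hn1

end Entropy

/-! ### Extension to the weighted Lebesgue space -/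

section Extension

open Filter Topology

variable {d : ℕ}

theorem lintegral_sphere_weight (hd : 2 ≤ d) {s R : ℝ} (hs : 0 < s) (α : ℝ) :
    ∫⁻ ω : Metric.sphere (0 : 𝔼 d) 1, (Metric.ball (0 : 𝔼 d) R).indicator
      (fun x => ENNReal.ofReal (‖x‖ ^ α)) (s • (ω : 𝔼 d)) ∂sphereProb d =
      (Iio R).indicator (fun s => ENNReal.ofReal (s ^ α)) s := by
  have := isProbabilityMeasure_sphereProb hd
  have e : ∀ ω : Metric.sphere (0 : 𝔼 d) 1, (Metric.ball (0 : 𝔼 d) R).indicator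
      (fun x => ENNReal.ofReal (‖x‖ ^ α)) (s • (ω : 𝔼 d)) =
      (Iio R).indicator (fun s => ENNReal.ofReal (s ^ α)) s := by
    intro ω
    have hn : ‖s • (ω : 𝔼 d)‖ = s := by
      rw [norm_smul, norm_eq_of_mem_sphere, mul_one, Real.norm_of_nonneg hs.le]
    by_cases h : s < R
    · rw [indicator_of_mem (mem_Iio.2 h), indicator_of_mem (by simpa [hn] using h), hn]
    · have hb : s • (ω : 𝔼 d) ∉ Metric.ball (0 : 𝔼 d) R := by
        rwa [mem_ball_zero_iff, hn]
      rw [indicator_of_notMem hb, indicator_of_notMem (s := Iio R) h]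
  rw [lintegral_congr e, lintegral_const, measure_univ, mul_one]

theorem powerWeight_ball_lt_top (hd : 2 ≤ d) {α : ℝ} (hα : 0 < d + α) {R : ℝ} (hR : 0 < R) :
    powerWeight d α (Metric.ball 0 R) < ⊤ := by
  rw [powerWeight, withDensity_apply _ measurableSet_ball, ← lintegral_indicator measurableSet_ball,
    lintegral_polar hd ((by fun_prop : Measurable fun x : 𝔼 d =>
      ENNReal.ofReal (‖x‖ ^ α)).indicator measurableSet_ball)]
  refine ENNReal.mul_lt_top (measure_lt_top _ _) ?_
  have e : ∀ s ∈ Ioi (0 : ℝ), ENNReal.ofReal (s ^ (d - 1)) *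
      ∫⁻ ω : Metric.sphere (0 : 𝔼 d) 1, (Metric.ball (0 : 𝔼 d) R).indicator
        (fun x => ENNReal.ofReal (‖x‖ ^ α)) (s • (ω : 𝔼 d)) ∂sphereProb d =
      (Ioo 0 R).indicator (fun s => ENNReal.ofReal (s ^ ((d + 1 + α) - 2))) s := by
    intro s hs
    have hs0 : 0 < s := hs
    rw [lintegral_sphere_weight hd hs]
    by_cases h : s < R
    · rw [indicator_of_mem (mem_Iio.2 h), indicator_of_mem (mem_Ioo.2 ⟨hs0, h⟩),
        ← ENNReal.ofReal_mul (by positivity), ← Real.rpow_natCast, ← Real.rpow_add hs0,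
        Nat.cast_sub (by omega)]
      congr 2
      push_cast
      ring
    · rw [indicator_of_notMem (by simpa using h), indicator_of_notMem (fun h' => h h'.2), mul_zero]
  rw [setLIntegral_congr_fun measurableSet_Ioi e, setLIntegral_indicator measurableSet_Ioo,
    inter_eq_self_of_subset_left Ioo_subset_Ioi_self, lintegral_Ioo_rpow (by linarith) hR.le]
  exact ENNReal.ofReal_lt_top

theorem isLocallyFiniteMeasure_powerWeight (hd : 2 ≤ d) {α : ℝ} (hα : 0 < d + α) :
    IsLocallyFiniteMeasure (powerWeight d α) := by
  refine ⟨fun x => ⟨Metric.ball 0 (‖x‖ + 1), Metric.isOpen_ball.mem_nhds ?_,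
    powerWeight_ball_lt_top hd hα (by positivity)⟩⟩
  rw [mem_ball_zero_iff]
  linarith

theorem volume_absolutelyContinuous_powerWeight (hd : 2 ≤ d) (α : ℝ) :
    (volume : Measure (𝔼 d)) ≪ powerWeight d α := by
  have : NeZero d := ⟨by omega⟩
  refine withDensity_absolutelyContinuous' (by fun_prop) ?_
  filter_upwards [Measure.ae_ne volume (0 : 𝔼 d)] with x hx
  have := norm_pos_iff.2 hx
  rw [ne_eq, ENNReal.ofReal_eq_zero, not_le]
  positivity

/-- The modulus of a function, as a complex valued function. -/
noncomputable def cnorm (f : 𝔼 d → ℂ) (x : 𝔼 d) : ℂ := (‖f x‖ : ℂ)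

theorem enorm_cnorm (f : 𝔼 d → ℂ) (x : 𝔼 d) : ‖cnorm f x‖ₑ = ‖f x‖ₑ := by
  rw [← ofReal_norm, ← ofReal_norm, cnorm, Complex.norm_real, norm_norm]

theorem continuous_cnorm {f : 𝔼 d → ℂ} (hf : Continuous f) : Continuous (cnorm f) :=
  Complex.continuous_ofReal.comp hf.norm

theorem hasCompactSupport_cnorm {f : 𝔼 d → ℂ} (hf : HasCompactSupport f) :
    HasCompactSupport (cnorm f) :=
  hf.comp_left (g := fun z : ℂ => (‖z‖ : ℂ)) (by simp)

theorem lintegral_sphere_le_sphericalMax_cnorm (hd : 2 ≤ d) {f : 𝔼 d → ℂ} (hf : Continuous f)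
    {E : Set ℝ} {t : ℝ} (ht : t ∈ E) (x : 𝔼 d) :
    ∫⁻ ω : Metric.sphere (0 : 𝔼 d) 1, ‖f (x + t • (ω : 𝔼 d))‖ₑ ∂sphereProb d ≤
      sphericalMax E (cnorm f) x := by
  refine le_trans (le_of_eq ?_) (le_iSup₂ (f := fun t _ => ‖sphericalMean t (cnorm f) x‖ₑ) t ht)
  simp only [sphericalMean, cnorm]
  rw [integral_complex_ofReal, ← ofReal_norm, Complex.norm_real, Real.norm_of_nonneg
    (integral_nonneg fun _ => norm_nonneg _), ofReal_integral_norm_eq_lintegral_enorm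
    (integrable_sphere_of_continuous hd hf t x)]

/-- The maximal inequality for continuous functions of compact support. -/
def MaximalBound (μ : Measure (𝔼 d)) (p : ℝ) (K : ℝ≥0∞) (E : Set ℝ) : Prop :=
  ∀ f : 𝔼 d → ℂ, Continuous f → HasCompactSupport f →
    ∫⁻ x, sphericalMax E f x ^ p ∂μ ≤ K * ∫⁻ x, ‖f x‖ₑ ^ p ∂μ

/-- An open set is exhausted by compactly supported bump functions. -/
theorem exists_bump_eventually_eq_one {U : Set (𝔼 d)} (hU : IsOpen U) :
    ∃ φ : ℕ → 𝔼 d → ℂ, (∀ n, Continuous (φ n)) ∧ (∀ n, HasCompactSupport (φ n)) ∧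
      (∀ n y, ‖φ n y‖ₑ ≤ U.indicator 1 y) ∧ ∀ y ∈ U, ∀ᶠ n in atTop, ‖φ n y‖ₑ = 1 := by
  obtain ⟨F, hFc, hFU, hFun, hFm⟩ := hU.exists_iUnion_isClosed
  have hK : ∀ n : ℕ, IsCompact (F n ∩ Metric.closedBall 0 n) := fun n =>
    (isCompact_closedBall _ _).inter_left (hFc n)
  have hex : ∀ n : ℕ, ∃ f : C(𝔼 d, ℝ), EqOn f 1 (F n ∩ Metric.closedBall 0 n) ∧
      EqOn f 0 Uᶜ ∧ HasCompactSupport f ∧ ∀ x, f x ∈ Icc (0 : ℝ) 1 := fun n =>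
    exists_continuous_one_zero_of_isCompact (hK n) hU.isClosed_compl
      (disjoint_compl_right_iff_subset.2 (inter_subset_left.trans (hFU n)))
  choose f h1 h0 hc hI using hex
  have hn : ∀ n y, ‖((f n y : ℝ) : ℂ)‖ₑ = ENNReal.ofReal (f n y) := fun n y => by
    rw [← ofReal_norm, Complex.norm_real, Real.norm_of_nonneg (hI n y).1]
  refine ⟨fun n y => (f n y : ℂ), fun n => Complex.continuous_ofReal.comp (f n).continuous,
    fun n => (hc n).comp_left (g := fun r : ℝ => (r : ℂ)) (by simp), fun n y => ?_, fun y hy => ?_⟩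
  · rw [hn]
    by_cases hy : y ∈ U
    · rw [indicator_of_mem hy, Pi.one_apply, ← ENNReal.ofReal_one]
      exact ENNReal.ofReal_le_ofReal (hI n y).2
    · rw [indicator_of_notMem hy, h0 n hy]
      simp
  · rw [← hFun] at hy
    obtain ⟨m, hm⟩ := mem_iUnion.1 hy
    obtain ⟨k, hk⟩ := exists_nat_ge ‖y‖
    filter_upwards [eventually_ge_atTop (max m k)] with n hmn
    have hk' : (k : ℝ) ≤ n := by exact_mod_cast (le_max_right m k).trans hmn
    rw [hn, h1 n ⟨hFm ((le_max_left m k).trans hmn) hm, mem_closedBall_zero_iff.2 (hk.trans hk')⟩]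
    simp

theorem rpow_liminf {p : ℝ} (hp : 0 < p) (a : ℕ → ℝ≥0∞) :
    (liminf a atTop) ^ p = liminf (fun n => a n ^ p) atTop :=
  (ENNReal.orderIsoRpow p hp).liminf_apply

/-- The fraction of the sphere of radius `t` centred at `x` that lies in an open set is controlled,
uniformly in `t`, by the measure of the set. -/
theorem MaximalBound.exists_le_of_isOpen (hd : 2 ≤ d) {μ : Measure (𝔼 d)} {p : ℝ} (hp : 0 < p)
    {K : ℝ≥0∞} {E : Set ℝ} (h : MaximalBound μ p K E) {U : Set (𝔼 d)} (hU : IsOpen U) :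
    ∃ H : 𝔼 d → ℝ≥0∞, Measurable H ∧ (∀ x, ∀ t ∈ E,
      sphereProb d {ω | x + t • (ω : 𝔼 d) ∈ U} ≤ H x) ∧ ∫⁻ x, H x ^ p ∂μ ≤ K * μ U := by
  obtain ⟨φ, hφc, hφs, hφ1, hφU⟩ := exists_bump_eventually_eq_one hU
  refine ⟨fun x => liminf (fun n => sphericalMax E (cnorm (φ n)) x) atTop,
    Measurable.liminf fun n => measurable_sphericalMax hd (continuous_cnorm (hφc n)) E, ?_, ?_⟩
  · intro x t ht
    have hmU : MeasurableSet {ω : Metric.sphere (0 : 𝔼 d) 1 | x + t • (ω : 𝔼 d) ∈ U} :=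
      (hU.preimage (by fun_prop : Continuous fun ω : Metric.sphere (0 : 𝔼 d) 1 =>
        x + t • (ω : 𝔼 d))).measurableSet
    calc sphereProb d {ω | x + t • (ω : 𝔼 d) ∈ U}
        = ∫⁻ ω, {ω : Metric.sphere (0 : 𝔼 d) 1 | x + t • (ω : 𝔼 d) ∈ U}.indicator 1 ω
            ∂sphereProb d := (lintegral_indicator_one hmU).symm
      _ ≤ ∫⁻ ω : Metric.sphere (0 : 𝔼 d) 1,
            liminf (fun n => ‖φ n (x + t • (ω : 𝔼 d))‖ₑ) atTop ∂sphereProb d := by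
          refine lintegral_mono fun ω => ?_
          by_cases hω : x + t • (ω : 𝔼 d) ∈ U
          · refine le_trans (indicator_le_self _ _ _) (le_liminf_of_le (by isBoundedDefault) ?_)
            filter_upwards [hφU _ hω] with n hn
            rw [hn, Pi.one_apply]
          · rw [indicator_of_notMem (s := {ω : Metric.sphere (0 : 𝔼 d) 1 |
              x + t • (ω : 𝔼 d) ∈ U}) hω]
            exact zero_le
      _ ≤ liminf (fun n => ∫⁻ ω : Metric.sphere (0 : 𝔼 d) 1, ‖φ n (x + t • (ω : 𝔼 d))‖ₑ
            ∂sphereProb d) atTop := by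
          refine lintegral_liminf_le fun n => ?_
          have := hφc n
          exact (by fun_prop : Continuous fun ω : Metric.sphere (0 : 𝔼 d) 1 =>
            ‖φ n (x + t • (ω : 𝔼 d))‖ₑ).measurable
      _ ≤ _ := by
          refine liminf_le_liminf (Eventually.of_forall fun n => ?_)
          exact lintegral_sphere_le_sphericalMax_cnorm hd (hφc n) ht x
  · simp only [rpow_liminf hp]
    refine (lintegral_liminf_le fun n =>
      (measurable_sphericalMax hd (continuous_cnorm (hφc n)) E).pow_const p).trans ?_
    refine liminf_le_of_le (by isBoundedDefault) fun b hb => ?_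
    obtain ⟨n, hn⟩ := hb.exists
    refine hn.trans ((h _ (continuous_cnorm (hφc n)) (hasCompactSupport_cnorm (hφs n))).trans ?_)
    refine mul_le_mul' le_rfl ?_
    rw [← lintegral_indicator_one hU.measurableSet]
    refine lintegral_mono fun y => ?_
    rw [enorm_cnorm]
    by_cases hy : y ∈ U
    · have := hφ1 n y
      rw [indicator_of_mem hy] at this ⊢
      exact (ENNReal.rpow_le_rpow this hp.le).trans_eq (ENNReal.one_rpow p)
    · have := hφ1 n y
      rw [indicator_of_notMem hy] at this ⊢
      rw [le_zero_iff.1 this, ENNReal.zero_rpow_of_pos hp]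

/-- A null set meets almost all spheres in null sets, simultaneously for all radii in `E`. -/
theorem MaximalBound.ae_forall_ae_notMem (hd : 2 ≤ d) {μ : Measure (𝔼 d)} [IsLocallyFiniteMeasure μ]
    {p : ℝ} (hp : 0 < p) {K : ℝ≥0∞} (hK : K ≠ ⊤) {E : Set ℝ} (h : MaximalBound μ p K E)
    {N : Set (𝔼 d)} (hN : μ N = 0) :
    ∀ᵐ x ∂μ, ∀ t ∈ E, ∀ᵐ ω : Metric.sphere (0 : 𝔼 d) 1 ∂sphereProb d, x + t • (ω : 𝔼 d) ∉ N := by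
  have hU : ∀ k : ℕ, ∃ U ⊇ N, IsOpen U ∧ μ U < ((k : ℝ≥0∞) + 1)⁻¹ := fun k =>
    N.exists_isOpen_lt_of_lt _ (by rw [hN]; simp)
  choose U hNU hUo hUm using hU
  choose H hHm hHle hHint using fun k => h.exists_le_of_isOpen hd hp (hUo k)
  have hz : ∫⁻ x, (⨅ k, H k x) ^ p ∂μ = 0 := by
    have hb : ∀ k : ℕ, ∫⁻ x, (⨅ k, H k x) ^ p ∂μ ≤ K * ((k : ℝ≥0∞) + 1)⁻¹ := fun k => by
      refine le_trans (lintegral_mono fun x => ENNReal.rpow_le_rpow (iInf_le _ k) hp.le) ?_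
      exact (hHint k).trans (mul_le_mul' le_rfl (hUm k).le)
    have h1 : Tendsto (fun k : ℕ => ((k : ℝ≥0∞) + 1)⁻¹) atTop (𝓝 0) := by
      have := (tendsto_add_atTop_iff_nat 1).2 ENNReal.tendsto_inv_nat_nhds_zero
      simpa using this
    have := ENNReal.Tendsto.const_mul h1 (Or.inr hK)
    rw [mul_zero] at this
    exact le_zero_iff.1 (ge_of_tendsto' this hb)
  rw [lintegral_eq_zero_iff ((Measurable.iInf hHm).pow_const p)] at hz
  filter_upwards [hz] with x hx t ht
  have hx0 : ⨅ k, H k x = 0 := by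
    rcases ENNReal.rpow_eq_zero_iff.1 hx with h' | h'
    · exact h'.1
    · exact absurd h'.2 (by linarith)
  rw [ae_iff]
  simp only [not_not]
  refine le_zero_iff.1 (hx0 ▸ le_iInf fun k => le_trans (measure_mono ?_) (hHle k x t ht))
  exact fun ω hω => hNU k hω

/-- If `F n` converges to `f` almost everywhere on the sphere of radius `t` around `x`, then the
averages of the increments control the distance from `F n` to `f` on that sphere. -/
theorem lintegral_sphere_enorm_sub_le (hd : 2 ≤ d) {F : ℕ → 𝔼 d → ℂ} (hF : ∀ n, Continuous (F n))
    {f : 𝔼 d → ℂ} {E : Set ℝ} {t : ℝ} (ht : t ∈ E) {x : 𝔼 d}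
    (hlim : ∀ᵐ ω : Metric.sphere (0 : 𝔼 d) 1 ∂sphereProb d,
      Tendsto (fun n => F n (x + t • (ω : 𝔼 d))) atTop (𝓝 (f (x + t • (ω : 𝔼 d))))) (n : ℕ) :
    ∫⁻ ω : Metric.sphere (0 : 𝔼 d) 1, ‖f (x + t • (ω : 𝔼 d)) - F n (x + t • (ω : 𝔼 d))‖ₑ
      ∂sphereProb d ≤ ∑' k, sphericalMax E (cnorm (F (k + n + 1) - F (k + n))) x := by
  calc ∫⁻ ω : Metric.sphere (0 : 𝔼 d) 1, ‖f (x + t • (ω : 𝔼 d)) - F n (x + t • (ω : 𝔼 d))‖ₑ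
        ∂sphereProb d
      ≤ ∫⁻ ω : Metric.sphere (0 : 𝔼 d) 1, (∑' k, ‖(F (k + n + 1) - F (k + n))
          (x + t • (ω : 𝔼 d))‖ₑ) ∂sphereProb d := by
        refine lintegral_mono_ae ?_
        filter_upwards [hlim] with ω hω
        have := edist_le_tsum_of_edist_le_of_tendsto
          (fun k => ‖(F (k + 1) - F k) (x + t • (ω : 𝔼 d))‖ₑ) (fun k => ?_) hω n
        · rw [edist_comm, edist_eq_enorm_sub] at this
          simpa only [add_comm n] using this
        · rw [edist_comm, edist_eq_enorm_sub]
          rfl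
    _ = ∑' k, ∫⁻ ω : Metric.sphere (0 : 𝔼 d) 1, ‖(F (k + n + 1) - F (k + n))
          (x + t • (ω : 𝔼 d))‖ₑ ∂sphereProb d := by
        refine lintegral_tsum fun k => ?_
        have h1 := (hF (k + n + 1)).sub (hF (k + n))
        exact (h1.comp (by fun_prop : Continuous fun ω : Metric.sphere (0 : 𝔼 d) 1 =>
          x + t • (ω : 𝔼 d))).enorm.measurable.aemeasurable
    _ ≤ _ := ENNReal.tsum_le_tsum fun k =>
        lintegral_sphere_le_sphericalMax_cnorm hd ((hF (k + n + 1)).sub (hF (k + n))) ht x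

theorem sphericalMax_le_add {f g : 𝔼 d → ℂ} {E : Set ℝ} {x : 𝔼 d} {R : ℝ≥0∞}
    (h : ∀ t ∈ E, ‖sphericalMean t f x - sphericalMean t g x‖ₑ ≤ R) :
    sphericalMax E f x ≤ sphericalMax E g x + R := by
  refine iSup₂_le fun t ht => ?_
  calc ‖sphericalMean t f x‖ₑ
      = ‖sphericalMean t g x + (sphericalMean t f x - sphericalMean t g x)‖ₑ := by
        rw [add_sub_cancel]
    _ ≤ ‖sphericalMean t g x‖ₑ + ‖sphericalMean t f x - sphericalMean t g x‖ₑ := enorm_add_le _ _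
    _ ≤ _ := add_le_add (le_iSup₂ (f := fun t _ => ‖sphericalMean t g x‖ₑ) t ht) (h t ht)

/-- A maximal inequality for continuous functions of compact support extends to `Lᵖ`. The function
`f` is approximated by a sequence with summable increments. The maximal functions of the increments
are then summable almost everywhere, so that the means converge uniformly in the radius. -/
theorem MaximalBound.extend (hd : 2 ≤ d) {μ : Measure (𝔼 d)} [IsLocallyFiniteMeasure μ]
    {p : ℝ} (hp : 1 ≤ p) {K : ℝ≥0∞} (hK : K ≠ ⊤) {E : Set ℝ} (h : MaximalBound μ p K E)
    {f : 𝔼 d → ℂ} (hf : MemLp f (ENNReal.ofReal p) μ) :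
    (∀ᵐ x ∂μ, ∀ t ∈ E, Integrable (fun ω : Metric.sphere (0 : 𝔼 d) 1 =>
      f (x + t • (ω : 𝔼 d))) (sphereProb d)) ∧
    AEMeasurable (sphericalMax E f) μ ∧
    ∫⁻ x, sphericalMax E f x ^ p ∂μ ≤ K * eLpNorm f (ENNReal.ofReal p) μ ^ p := by
  have := isProbabilityMeasure_sphereProb hd
  have hp0 : 0 < p := by linarith
  set P := ENNReal.ofReal p with hP
  have hP0 : P ≠ 0 := by rw [hP, ne_eq, ENNReal.ofReal_eq_zero]; linarith
  have hPt : P ≠ ⊤ := ENNReal.ofReal_ne_top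
  have hP1 : 1 ≤ P := by rw [hP, ← ENNReal.ofReal_one]; exact ENNReal.ofReal_le_ofReal hp
  have hLp : ∀ g : 𝔼 d → ℂ, ∫⁻ x, ‖g x‖ₑ ^ p ∂μ = eLpNorm g P μ ^ p := by
    intro g
    rw [eLpNorm_eq_lintegral_rpow_enorm_toReal hP0 hPt, hP, ENNReal.toReal_ofReal hp0.le,
      one_div, ENNReal.rpow_inv_rpow hp0.ne']
  -- Approximation by continuous functions of compact support, with geometric rate
  have hex : ∀ n : ℕ, ∃ g : 𝔼 d → ℂ, HasCompactSupport g ∧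
      eLpNorm (f - g) P μ ≤ (2⁻¹ : ℝ≥0∞) ^ n ∧ Continuous g ∧ MemLp g P μ := fun n =>
    hf.exists_hasCompactSupport_eLpNorm_sub_le hPt (pow_ne_zero _ (by simp))
  choose g hgs hgf hgc hgL using hex
  have hgeo : Tendsto (fun n : ℕ => (2⁻¹ : ℝ≥0∞) ^ n) atTop (𝓝 0) :=
    ENNReal.tendsto_pow_atTop_nhds_zero_of_lt_one (by simp)
  obtain ⟨ns, hns, hlim⟩ := (tendstoInMeasure_of_tendsto_eLpNorm hP0
    (fun n => (hgL n).1) hf.1 (tendsto_of_tendsto_of_tendsto_of_le_of_le tendsto_const_nhds hgeo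
      (fun n => zero_le) fun n => by
        rw [eLpNorm_sub_comm]; exact hgf n)).exists_seq_tendsto_ae
  set F : ℕ → 𝔼 d → ℂ := fun n => g (ns n) with hFdef
  have hFc : ∀ n, Continuous (F n) := fun n => hgc _
  have hFf : ∀ n, eLpNorm (f - F n) P μ ≤ (2⁻¹ : ℝ≥0∞) ^ n := fun n =>
    (hgf (ns n)).trans (pow_le_pow_right_of_le_one' (by simp) (hns.id_le n))
  -- The maximal functions of the increments
  set m : ℕ → 𝔼 d → ℝ≥0∞ := fun k => sphericalMax E (cnorm (F (k + 1) - F k)) with hm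
  have hmc : ∀ k, Continuous (cnorm (F (k + 1) - F k)) := fun k =>
    continuous_cnorm ((hFc (k + 1)).sub (hFc k))
  have hmm : ∀ k, Measurable (m k) := fun k => measurable_sphericalMax hd (hmc k) E
  have hq0 : (0 : ℝ) < (1 / 2) ^ p := by positivity
  have hq1 : ((1 / 2 : ℝ)) ^ p < 1 := Real.rpow_lt_one (by norm_num) (by norm_num) hp0
  obtain ⟨C, hC, hsum⟩ := exists_lintegral_tsum_rpow_le (X := 𝔼 d) hp0 hq0 hq1
  have hmb : ∀ k, ∫⁻ x, m k x ^ p ∂μ ≤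
      ENNReal.ofReal (1 * ((1 / 2 : ℝ) ^ p) ^ k) * (K * 2 ^ p) := by
    intro k
    refine (h _ (hmc k) (hasCompactSupport_cnorm ((hgs (ns (k + 1))).sub (hgs (ns k))))).trans ?_
    simp only [enorm_cnorm]
    rw [hLp, mul_left_comm]
    refine mul_le_mul' le_rfl ?_
    have h1 : eLpNorm (F (k + 1) - F k) P μ ≤ (2⁻¹ : ℝ≥0∞) ^ k * 2 := by
      calc eLpNorm (F (k + 1) - F k) P μ = eLpNorm ((f - F k) - (f - F (k + 1))) P μ := by
            congr 1; abel
        _ ≤ eLpNorm (f - F k) P μ + eLpNorm (f - F (k + 1)) P μ :=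
            eLpNorm_sub_le (hf.1.sub (hgL _).1) (hf.1.sub (hgL _).1) hP1
        _ ≤ (2⁻¹ : ℝ≥0∞) ^ k + (2⁻¹ : ℝ≥0∞) ^ k :=
            add_le_add (hFf k) ((hFf (k + 1)).trans
              (pow_le_pow_right_of_le_one' (by simp) (Nat.le_succ k)))
        _ = _ := (mul_two _).symm
    refine (ENNReal.rpow_le_rpow h1 hp0.le).trans_eq ?_
    rw [ENNReal.mul_rpow_of_nonneg _ _ hp0.le]
    congr 1
    rw [one_mul, ← Real.rpow_natCast, ← Real.rpow_mul (by norm_num), mul_comm p,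
      Real.rpow_mul (by norm_num), Real.rpow_natCast,
      ← ENNReal.ofReal_rpow_of_nonneg (by positivity) hp0.le, ENNReal.ofReal_pow (by norm_num)]
    congr 2
    rw [one_div, ENNReal.ofReal_inv_of_pos two_pos, ENNReal.ofReal_ofNat]
  have hfin : ∀ᵐ x ∂μ, ∑' k, m k x ≠ ⊤ := by
    have h1 := hsum μ m 1 (K * 2 ^ p) hmm zero_le_one hmb
    have h2 : ∫⁻ x, (∑' k, m k x) ^ p ∂μ ≠ ⊤ := by
      refine (h1.trans_lt (ENNReal.mul_lt_top ENNReal.ofReal_lt_top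
        (ENNReal.mul_lt_top hK.lt_top ?_))).ne
      exact ENNReal.rpow_lt_top_of_nonneg hp0.le (by simp)
    filter_upwards [ae_lt_top ((Measurable.tsum hmm).pow_const p) h2] with x hx hx'
    rw [hx', ENNReal.top_rpow_of_pos hp0] at hx
    exact lt_irrefl _ hx
  -- Pointwise convergence on almost all spheres
  have hgood := h.ae_forall_ae_notMem hd hp0 hK (ae_iff.1 hlim)
  simp only [mem_ofPred_eq, not_not] at hgood
  have hkey : ∀ x, (∀ t ∈ E, ∀ᵐ ω : Metric.sphere (0 : 𝔼 d) 1 ∂sphereProb d,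
      Tendsto (fun n => F n (x + t • (ω : 𝔼 d))) atTop (𝓝 (f (x + t • (ω : 𝔼 d))))) →
      ∑' k, m k x ≠ ⊤ → ∀ t ∈ E, Integrable (fun ω : Metric.sphere (0 : 𝔼 d) 1 =>
        f (x + t • (ω : 𝔼 d))) (sphereProb d) ∧
        ∀ n, ‖sphericalMean t f x - sphericalMean t (F n) x‖ₑ ≤ ∑' k, m (k + n) x := by
    intro x hx hxm t ht
    have hb := lintegral_sphere_enorm_sub_le hd hFc ht (hx t ht)
    have hmeas : AEStronglyMeasurable (fun ω : Metric.sphere (0 : 𝔼 d) 1 => f (x + t • (ω : 𝔼 d)))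
        (sphereProb d) :=
      aestronglyMeasurable_of_tendsto_ae atTop
        (fun n => (integrable_sphere_of_continuous hd (hFc n) t x).aestronglyMeasurable) (hx t ht)
    have h0 : Integrable (fun ω : Metric.sphere (0 : 𝔼 d) 1 =>
        f (x + t • (ω : 𝔼 d)) - F 0 (x + t • (ω : 𝔼 d))) (sphereProb d) :=
      ⟨hmeas.sub (integrable_sphere_of_continuous hd (hFc 0) t x).aestronglyMeasurable,
        (hb 0).trans_lt hxm.lt_top⟩
    have hint : Integrable (fun ω : Metric.sphere (0 : 𝔼 d) 1 => f (x + t • (ω : 𝔼 d)))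
        (sphereProb d) := by
      refine (h0.add (integrable_sphere_of_continuous hd (hFc 0) t x)).congr
        (Eventually.of_forall fun ω => ?_)
      exact sub_add_cancel _ _
    refine ⟨hint, fun n => ?_⟩
    rw [sphericalMean, sphericalMean,
      ← integral_sub hint (integrable_sphere_of_continuous hd (hFc n) t x)]
    exact (enorm_integral_le_lintegral_enorm _).trans (hb n)
  have hconv : ∀ᵐ x ∂μ, Tendsto (fun n => sphericalMax E (F n) x) atTop
      (𝓝 (sphericalMax E f x)) := by
    filter_upwards [hgood, hfin] with x hx hxm
    have hR := ENNReal.tendsto_sum_nat_add (fun k => m k x) hxm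
    have hlow := ENNReal.Tendsto.sub (tendsto_const_nhds (x := sphericalMax E f x)) hR
      (Or.inr ENNReal.zero_ne_top)
    have hupp := (tendsto_const_nhds (x := sphericalMax E f x)).add hR
    rw [tsub_zero] at hlow
    rw [add_zero] at hupp
    refine tendsto_of_tendsto_of_tendsto_of_le_of_le hlow hupp (fun n => ?_) (fun n => ?_)
    · exact tsub_le_iff_right.2 (sphericalMax_le_add fun t ht => (hkey x hx hxm t ht).2 n)
    · refine sphericalMax_le_add fun t ht => ?_
      rw [← edist_eq_enorm_sub, edist_comm, edist_eq_enorm_sub]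
      exact (hkey x hx hxm t ht).2 n
  have hMm : ∀ n, Measurable (sphericalMax E (F n)) := fun n =>
    measurable_sphericalMax hd (hFc n) E
  refine ⟨?_, aemeasurable_of_tendsto_metrizable_ae' (fun n => (hMm n).aemeasurable) hconv, ?_⟩
  · filter_upwards [hgood, hfin] with x hx hxm t ht using (hkey x hx hxm t ht).1
  · have hbound : ∀ n, ∫⁻ x, sphericalMax E (F n) x ^ p ∂μ ≤
        K * (eLpNorm f P μ + (2⁻¹ : ℝ≥0∞) ^ n) ^ p := by
      intro n
      refine (h (F n) (hFc n) (hgs _)).trans ?_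
      rw [hLp]
      refine mul_le_mul' le_rfl (ENNReal.rpow_le_rpow ?_ hp0.le)
      calc eLpNorm (F n) P μ = eLpNorm (f - (f - F n)) P μ := by rw [sub_sub_cancel]
        _ ≤ eLpNorm f P μ + eLpNorm (f - F n) P μ :=
            eLpNorm_sub_le hf.1 (hf.1.sub (hgL _).1) hP1
        _ ≤ _ := add_le_add le_rfl (hFf n)
    have hlimK : Tendsto (fun n : ℕ => K * (eLpNorm f P μ + (2⁻¹ : ℝ≥0∞) ^ n) ^ p) atTop
        (𝓝 (K * eLpNorm f P μ ^ p)) := by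
      have h1 := (tendsto_const_nhds (x := eLpNorm f P μ)).add hgeo
      rw [add_zero] at h1
      exact ENNReal.Tendsto.const_mul
        ((ENNReal.continuous_rpow_const.tendsto _).comp h1) (Or.inr hK)
    calc ∫⁻ x, sphericalMax E f x ^ p ∂μ
        = ∫⁻ x, liminf (fun n => sphericalMax E (F n) x ^ p) atTop ∂μ := by
          refine lintegral_congr_ae ?_
          filter_upwards [hconv] with x hx
          rw [← rpow_liminf hp0, hx.liminf_eq]
      _ ≤ liminf (fun n => ∫⁻ x, sphericalMax E (F n) x ^ p ∂μ) atTop :=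
          lintegral_liminf_le fun n => (hMm n).pow_const p
      _ ≤ liminf (fun n : ℕ => K * (eLpNorm f P μ + (2⁻¹ : ℝ≥0∞) ^ n) ^ p) atTop :=
          liminf_le_liminf (Eventually.of_forall hbound)
      _ = _ := hlimK.liminf_eq

end Extension

/-! ### The maximal theorem -/

theorem proposition5p1 (d : ℕ) (hd : 2 ≤ d) (p : ℝ) (hp : p ∈ Set.Icc (1 : ℝ) 2)
    (α : ℝ) (hα : α ≤ 0) (ε : ℝ) (hε : 0 < ε) :
    ∃ C : ℝ, 0 < C ∧
      ∀ ρ : ℝ → ℝ → ℝ, (ρ = dist ∨ ρ = mulDist) →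
      ∀ E : Set ℝ, E ⊆ Set.Icc 1 2 → E.Nonempty →
      ∀ A : ℝ, 1 ≤ A →
      (∀ δ : ℝ, 0 < δ → δ < 1 →
        ∀ a b : ℝ, 0 < a → a ≤ b → δ ≤ ρ a b → ρ a b ≤ 1 →
          (entropyNumber ρ (E ∩ Set.Icc a b) δ : ℝ) * δ ^ (((d : ℝ) - 1) * (p - 1) - ε) *
            (ρ a b) ^ (α + ((d : ℝ) - 1) * (2 - p)) ≤ A ^ p) →
      ∀ f : EuclideanSpace ℝ (Fin d) → ℂ,
        MemLp f (ENNReal.ofReal p) (powerWeight d α) →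
        (∀ᵐ x : EuclideanSpace ℝ (Fin d), ∀ t ∈ E,
          Integrable (fun ω : Metric.sphere (0 : EuclideanSpace ℝ (Fin d)) 1 =>
            f (x + t • (ω : EuclideanSpace ℝ (Fin d)))) (sphereProb d)) ∧
        AEMeasurable (sphericalMax E f) volume ∧
        eLpNorm (sphericalMax E f) (ENNReal.ofReal p) (powerWeight d α) ≤
          ENNReal.ofReal (C * A) * eLpNorm f (ENNReal.ofReal p) (powerWeight d α) := by
  have : NeZero d := ⟨by omega⟩
  obtain ⟨hp1, hp2⟩ := hp
  rcases hp1.eq_or_lt with rfl | hp1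
  -- The covering condition cannot hold for `p = 1`.
  · exact ⟨1, one_pos, fun ρ hρ E hE hne A _ h => absurd rfl
      ((hasCoverings_of_entropyNumber hρ hE h).ne_one hε hE hne)⟩
  have hp0 : 0 < p := by linarith
  obtain ⟨C, hC, hbound⟩ := exists_lintegral_weight_sphericalMax_le hd hp1 hp2 hα hε
  refine ⟨C ^ p⁻¹, by positivity, ?_⟩
  intro ρ hρ E hE hne A hA h f hf
  have hA0 : 0 < A := by linarith
  have hcov := hasCoverings_of_entropyNumber hρ hE h
  have := isLocallyFiniteMeasure_powerWeight hd (α := α)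
    (by linarith [hcov.le_exponent hE hne])
  have hM : MaximalBound (powerWeight d α) p (ENNReal.ofReal (C * A ^ p)) E := by
    intro g hg hgs
    rw [lintegral_powerWeight _ ((measurable_sphericalMax hd hg E).pow_const p),
      lintegral_powerWeight _ (hg.enorm.measurable.pow_const p)]
    exact hbound E A hE hA hcov g hg hgs
  obtain ⟨h1, h2, h3⟩ := hM.extend hd hp1.le ENNReal.ofReal_ne_top hf
  have hac := volume_absolutelyContinuous_powerWeight hd α
  refine ⟨hac.ae_le h1, h2.mono_ac hac, ?_⟩
  rw [eLpNorm_eq_lintegral_rpow_enorm_toReal (f := sphericalMax E f)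
    (by rw [ne_eq, ENNReal.ofReal_eq_zero]; linarith)
    ENNReal.ofReal_ne_top, ENNReal.toReal_ofReal hp0.le, one_div, ENNReal.rpow_inv_le_iff hp0,
    ENNReal.mul_rpow_of_nonneg _ _ hp0.le, ENNReal.ofReal_rpow_of_nonneg (by positivity) hp0.le,
    Real.mul_rpow (by positivity) hA0.le, Real.rpow_inv_rpow hC.le hp0.ne']
  exact h3
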